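/- Let $G$ be a discrete group and let $X$ be a finite proper $G$-CW complex: a (Hausdorff) CW complex on which $G$ acts by homeomorphisms permuting the cells, such that a cell that is sent to itself by an element of $G$ is fixed pointwise by it, such that there are only finitely many $G$-orbits of cells, and such that the stabilizer of every cell is finite. Let $\mathcal F$ be a set of subgroups of $G$ containing the isotropy groups $G_x$ of all points $x\in X$, and let $\mathcal O_{\mathcal F}$ be the category whose objects are the orbits $G/H$ with $H\in\mathcal F$ and whose morphisms are the $G$-equivariant maps. For every $n\ge 0$ let $\underline C_n(X)$ be the contravariant functor $G/H\mapsto C_n(X^H)=H_n\big((X^H)_n,(X^H)_{n-1};\mathbb Z\big)$ on $\mathcal O_{\mathcal F}$, where $(X^H)_n=X^H\cap X_n$ is the $n$-skeleton of the fixed point complex; together with the cellular boundary maps these functors form a chain complex $\underline C_*(X)$. For a contravariant functor $M^?$ and a covariant functor $M_?$ from $\mathcal O_{\mathcal F}$ to abelian groups, let $H^n_G(X,M^?)$ be the $n$-th cohomology group of the cochain complex $\mathrm{Hom}_{\mathcal O_{\mathcal F}}(\underline C_*(X),M^?)$ of groups of natural transformations, and let $H_n^G(X,M_?)$ be the $n$-th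 homology group of the chain complex $\underline C_*(X)\otimes_{\mathcal O_{\mathcal F}}M_?$, where $C\otimes_{\mathcal O_{\mathcal F}}N$ is the quotient of $\bigoplus_{G/H}C(G/H)\otimes_{\mathbb Z}N(G/H)$ by the relations $\phi^*c\otimes m=c\otimes\phi_*m$. Both are $0$ for $n<0$. Assume that for every object $G/H$ there are a finite set $\beta_H$ and isomorphisms $$a_H: M^?(G/H)\xrightarrow{\cong}\mathbb Z[\beta_H]\xleftarrow{\cong}M_?(G/H):b_H$$ such that, with $D_H:\mathbb Z[\beta_H]\to\mathrm{Hom}_{\mathbb Z}(\mathbb Z[\beta_H],\mathbb Z)$ the isomorphism sending each element of the basis $\beta_H$ to the corresponding element of the dual basis, and $\widehat{a_H}=\mathrm{Hom}_{\mathbb Z}(a_H,\mathbb Z)$, the identity $$\mathrm{Hom}_{\mathbb Z}(M^?(\phi),\mathbb Z)\circ\widehat{a_H}\circ D_H\circ b_H=\widehat{a_K}\circ D_K\circ b_K\circ M_?(\phi)$$ of maps $M_?(G/H)\to \mathrm{Hom}_{\mathbb Z}(M^?(G/K),\mathbb Z)$ holds for every morphism $\phi:G/H\to G/K$ of $\mathcal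 O_{\mathcal F}$. Then for every integer $n$ there exists a short exact sequence of abelian groups $$0\to \mathrm{Ext}^1_{\mathbb Z}\big(H^G_{n-1}(X,M_?),\mathbb Z\big)\to H^n_G(X,M^?)\to \mathrm{Hom}_{\mathbb Z}\big(H^G_n(X,M_?),\mathbb Z\big)\to 0.$$ -/

import Mathlib

open CategoryTheory Topology
open scoped Pointwise TensorProduct

universe u

namespace Bredon

noncomputable section

/-! ### Relative singular homology and the connecting homomorphism -/

/-- The singular chain complex of a topological space, with integral coefficients. -/
def singularChains : TopCat.{u} ⥤ ChainComplex (ModuleCat.{u} ℤ) ℕ :=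
  (AlgebraicTopology.singularChainComplexFunctor (ModuleCat.{u} ℤ)).obj
    (ModuleCat.of ℤ (ULift.{u} ℤ))

/-- The sequence `S(A) ⟶ S(Y) ⟶ S(Y) / S(A)` of singular chain complexes of a pair `(Y, A)`. -/
def pairSequence : TopPair.{u} ⥤ ShortComplex (ChainComplex (ModuleCat.{u} ℤ) ℕ) where
  obj P := ShortComplex.mk (singularChains.map P.map)
    (Limits.cokernel.π (singularChains.map P.map)) (Limits.cokernel.condition _)
  map {P Q} f :=
    have w : singularChains.map P.map ≫ singularChains.map (TopPair.Hom.fst f) =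
        singularChains.map (TopPair.Hom.snd f) ≫ singularChains.map Q.map := by
      rw [← Functor.map_comp, ← Functor.map_comp, TopPair.Hom.w]
    { τ₁ := singularChains.map (TopPair.Hom.snd f)
      τ₂ := singularChains.map (TopPair.Hom.fst f)
      τ₃ := Limits.cokernel.map _ _ _ _ w
      comm₁₂ := w.symm
      comm₂₃ := by simp }
  map_id P := by
    ext : 1
    · exact singularChains.map_id _
    · exact singularChains.map_id _
    · apply Limits.coequalizer.hom_ext
      simp [TopPair.Hom.fst]
  map_comp f g := by
    ext : 1
    · exact singularChains.map_comp _ _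
    · exact singularChains.map_comp _ _
    · apply Limits.coequalizer.hom_ext
      simp [TopPair.Hom.fst]

/-- An injective map of spaces induces a monomorphism of singular chain complexes. -/
theorem mono_singularChains_map {A Y : TopCat.{u}} (i : A ⟶ Y) (hi : Function.Injective i) :
    Mono (singularChains.map i) := by
  have hm : Mono i := (TopCat.mono_iff_injective i).mpr hi
  have hs : Mono (TopCat.toSSet.map i) := inferInstance
  have hmod (n : ℕ) : Mono ((singularChains.map i).f n) := by
    have h1 : Mono ((TopCat.toSSet.map i).app (Opposite.op (SimplexCategory.mk n))) :=
      inferInstance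
    exact inferInstanceAs (Mono ((Limits.sigmaConst.obj (ModuleCat.of ℤ (ULift.{u} ℤ))).map
      ((TopCat.toSSet.map i).app (Opposite.op (SimplexCategory.mk n)))))
  exact HomologicalComplex.mono_of_mono_f _ hmod

/-- `0 ⟶ S(A) ⟶ S(Y) ⟶ S(Y) / S(A) ⟶ 0` is short exact. -/
theorem pairSequence_shortExact (P : TopPair.{u}) : (pairSequence.obj P).ShortExact := by
  have : Mono (singularChains.map P.map) :=
    mono_singularChains_map _ P.isEmbedding_map.injective
  exact
    { exact := ShortComplex.exact_cokernel _
      mono_f := this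
      epi_g := inferInstanceAs (Epi (Limits.cokernel.π (singularChains.map P.map))) }

/-- The `n`-th integral singular homology group of a space. -/
def singularHomology (n : ℕ) : TopCat.{u} ⥤ ModuleCat.{u} ℤ :=
  singularChains ⋙ HomologicalComplex.homologyFunctor _ _ n

/-- The `n`-th integral singular homology group `H_n(Y, A)` of a pair. -/
def relHomology (n : ℕ) : TopPair.{u} ⥤ ModuleCat.{u} ℤ :=
  pairSequence ⋙ ShortComplex.π₃ ⋙ HomologicalComplex.homologyFunctor _ _ n

/-- The map `H_n(Y) ⟶ H_n(Y, A)`. -/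
def toRelHomology (n : ℕ) : TopPair.proj₁ ⋙ singularHomology.{u} n ⟶ relHomology n where
  app P := HomologicalComplex.homologyMap (pairSequence.obj P).g n
  naturality P Q f := by
    have h := (pairSequence.map f).comm₂₃
    have h' := congrArg (fun k => HomologicalComplex.homologyMap k n) h
    simp only [HomologicalComplex.homologyMap_comp] at h'
    exact h'

/-- The connecting homomorphism `H_{n+1}(Y, A) ⟶ H_n(A)` of the pair `(Y, A)`. -/
def connecting (n : ℕ) : relHomology.{u} (n + 1) ⟶ TopPair.proj₂ ⋙ singularHomology n where
  app P := (pairSequence_shortExact P).δ (n + 1) n rfl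
  naturality P Q f :=
    (HomologicalComplex.HomologySequence.δ_naturality (pairSequence.map f)
      (pairSequence_shortExact P) (pairSequence_shortExact Q) (n + 1) n rfl).symm

/-! ### The orbit category -/

section Orbit

variable {G : Type u} [Group G]

/-- The full subcategory of the orbit category of `G` on the orbits `G/H` with `H ∈ F`. -/
structure OrbitCat (F : Set (Subgroup G)) : Type u where
  /-- The subgroup `H`. -/
  subgroup : Subgroup G
  mem : subgroup ∈ F

variable {F : Set (Subgroup G)}

/-- Morphisms `G/H ⟶ G/K` are the `G`-equivariant maps. -/
instance : Category (OrbitCat F) where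
  Hom H K := (G ⧸ H.subgroup) →[G] (G ⧸ K.subgroup)
  id _ := MulActionHom.id G
  comp φ ψ := MulActionHom.comp ψ φ

/-- The underlying equivariant map of a morphism of the orbit category. -/
def OrbitCat.Hom.toMap {H K : OrbitCat F} (φ : H ⟶ K) :
    (G ⧸ H.subgroup) →[G] (G ⧸ K.subgroup) := φ

/-- An element `g` of `G` with `φ(eH) = gK`. -/
def OrbitCat.Hom.rep {H K : OrbitCat F} (φ : H ⟶ K) : G :=
  (OrbitCat.Hom.toMap φ (QuotientGroup.mk 1)).out

theorem OrbitCat.Hom.mk_rep {H K : OrbitCat F} (φ : H ⟶ K) :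
    (QuotientGroup.mk (OrbitCat.Hom.rep φ) : G ⧸ K.subgroup) =
      OrbitCat.Hom.toMap φ (QuotientGroup.mk 1) :=
  QuotientGroup.out_eq' _

end Orbit

/-! ### The tensor product over the orbit category -/

section Tensor

variable {G : Type u} [Group G] {F : Set (Subgroup G)} {R : Type} [CommRing R]

open Classical in
/-- The relations `φ^* c ⊗ m = c ⊗ φ_* m` in the direct sum of all `C(G/H) ⊗ N(G/H)`. -/
def tensorRel (C : (OrbitCat F)ᵒᵖ ⥤ ModuleCat.{u} R) (N : OrbitCat F ⥤ ModuleCat.{u} R) :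
    Submodule R (DirectSum (OrbitCat F) fun H => C.obj (Opposite.op H) ⊗[R] N.obj H) :=
  Submodule.span R {z | ∃ (H K : OrbitCat F) (φ : H ⟶ K) (c : C.obj (Opposite.op K))
    (m : N.obj H), z =
      DirectSum.lof R _ (fun H => C.obj (Opposite.op H) ⊗[R] N.obj H) H
        ((C.map φ.op).hom c ⊗ₜ[R] m) -
      DirectSum.lof R _ (fun H => C.obj (Opposite.op H) ⊗[R] N.obj H) K
        (c ⊗ₜ[R] (N.map φ).hom m)}

/-- The map of direct sums induced by a natural transformation `C ⟶ C'`. -/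
def tensorPreMap {C C' : (OrbitCat F)ᵒᵖ ⥤ ModuleCat.{u} R} (f : C ⟶ C')
    (N : OrbitCat F ⥤ ModuleCat.{u} R) :
    (DirectSum (OrbitCat F) fun H => C.obj (Opposite.op H) ⊗[R] N.obj H) →ₗ[R]
      (DirectSum (OrbitCat F) fun H => C'.obj (Opposite.op H) ⊗[R] N.obj H) :=
  DirectSum.lmap fun H => (f.app (Opposite.op H)).hom.rTensor (N.obj H)

theorem tensorRel_le {C C' : (OrbitCat F)ᵒᵖ ⥤ ModuleCat.{u} R} (f : C ⟶ C')
    (N : OrbitCat F ⥤ ModuleCat.{u} R) :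
    tensorRel C N ≤ (tensorRel C' N).comap (tensorPreMap f N) := by
  classical
  refine Submodule.span_le.mpr ?_
  rintro _ ⟨H, K, φ, c, m, rfl⟩
  refine Submodule.subset_span ⟨H, K, φ, (f.app (Opposite.op K)).hom c, m, ?_⟩
  have h : (f.app (Opposite.op H)).hom ((C.map φ.op).hom c) =
      (C'.map φ.op).hom ((f.app (Opposite.op K)).hom c) :=
    congrArg (fun k => k.hom c) (f.naturality φ.op)
  simp [tensorPreMap, h]

theorem tensorPreMap_id (C : (OrbitCat F)ᵒᵖ ⥤ ModuleCat.{u} R) (N : OrbitCat F ⥤ ModuleCat.{u} R) :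
    tensorPreMap (𝟙 C) N = LinearMap.id := by
  classical
  refine DirectSum.linearMap_ext _ fun H => ?_
  apply TensorProduct.ext'
  intro c m
  simp [tensorPreMap]

theorem tensorPreMap_comp {C C' C'' : (OrbitCat F)ᵒᵖ ⥤ ModuleCat.{u} R} (f : C ⟶ C') (g : C' ⟶ C'')
    (N : OrbitCat F ⥤ ModuleCat.{u} R) :
    tensorPreMap (f ≫ g) N = tensorPreMap g N ∘ₗ tensorPreMap f N := by
  classical
  refine DirectSum.linearMap_ext _ fun H => ?_
  apply TensorProduct.ext'
  intro c m
  simp [tensorPreMap]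

theorem tensorPreMap_add {C C' : (OrbitCat F)ᵒᵖ ⥤ ModuleCat.{u} R} (f g : C ⟶ C')
    (N : OrbitCat F ⥤ ModuleCat.{u} R) :
    tensorPreMap (f + g) N = tensorPreMap f N + tensorPreMap g N := by
  classical
  refine DirectSum.linearMap_ext _ fun H => ?_
  apply TensorProduct.ext'
  intro c m
  simp [tensorPreMap]

/-- The functor `C ↦ C ⊗ N`, the tensor product over the orbit category of contravariant functors
with a covariant functor `N`. -/
def tensorFunctor (N : OrbitCat F ⥤ ModuleCat.{u} R) :
    ((OrbitCat F)ᵒᵖ ⥤ ModuleCat.{u} R) ⥤ ModuleCat.{u} R where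
  obj C := ModuleCat.of R
    ((DirectSum (OrbitCat F) fun H => C.obj (Opposite.op H) ⊗[R] N.obj H) ⧸ tensorRel C N)
  map f := ModuleCat.ofHom (Submodule.mapQ _ _ (tensorPreMap f N) (tensorRel_le f N))
  map_id C := by
    refine ModuleCat.hom_ext (Submodule.linearMap_qext _ (LinearMap.ext fun x => ?_))
    exact congrArg (Submodule.Quotient.mk (p := tensorRel C N))
      (LinearMap.congr_fun (tensorPreMap_id C N) x)
  map_comp {C C' C''} f g := by
    refine ModuleCat.hom_ext (Submodule.linearMap_qext _ (LinearMap.ext fun x => ?_))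
    exact congrArg (Submodule.Quotient.mk (p := tensorRel C'' N))
      (LinearMap.congr_fun (tensorPreMap_comp f g N) x)

instance (N : OrbitCat F ⥤ ModuleCat.{u} R) : (tensorFunctor N).Additive where
  map_add {C C' f g} := by
    refine ModuleCat.hom_ext (Submodule.linearMap_qext _ (LinearMap.ext fun x => ?_))
    exact congrArg (Submodule.Quotient.mk (p := tensorRel C' N))
      (LinearMap.congr_fun (tensorPreMap_add f g N) x)

end Tensor

/-! ### Coefficient systems with compatible finite bases -/

section Dual

variable {G : Type u} [Group G] {F : Set (Subgroup G)} {R : Type} [CommRing R]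

/-- The covariant functor `Hom(M(-), R)` of a contravariant functor `M`. -/
def dualSystem (M : (OrbitCat F)ᵒᵖ ⥤ ModuleCat.{u} R) : OrbitCat F ⥤ ModuleCat.{u} R where
  obj H := ModuleCat.of R (Module.Dual R (M.obj (Opposite.op H)))
  map φ := ModuleCat.ofHom (M.map φ.op).hom.dualMap
  map_id H := by
    refine ModuleCat.hom_ext (LinearMap.ext fun f => LinearMap.ext fun x => ?_)
    exact congrArg (fun k => f (k.hom x)) (M.map_id (Opposite.op H))
  map_comp {H K L} φ ψ := by
    refine ModuleCat.hom_ext (LinearMap.ext fun f => LinearMap.ext fun x => ?_)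
    exact congrArg (fun k => f (k.hom x)) (M.map_comp ψ.op φ.op)

/-- The isomorphism `R[β] ≃ Hom(R[β], R)` sending the elements of a finite basis `β` to the
elements of the dual basis. -/
def dualityIso (β : Type u) [Finite β] : (β →₀ R) ≃ₗ[R] Module.Dual R (β →₀ R) :=
  letI := Classical.decEq β
  (Finsupp.basisSingleOne (R := R) (ι := β)).toDualEquiv

/-- A contravariant functor `M` and a covariant functor `N` on the orbit category with compatible
finite bases: isomorphisms `a_H : M(G/H) ≃ R[β_H]` and `b_H : N(G/H) ≃ R[β_H]` with a finite basis
`β_H` for every object `G/H`, such that for every `φ : G/H ⟶ G/K` the isomorphisms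
`a_H^* ∘ D_H ∘ b_H : N(G/H) ≃ Hom(M(G/H), R)`, with `D_H` the duality isomorphism of the basis,
commute with the maps induced by `φ`. -/
structure DualBases (M : (OrbitCat F)ᵒᵖ ⥤ ModuleCat.{u} R) (N : OrbitCat F ⥤ ModuleCat.{u} R) where
  /-- The finite basis of the groups at `G/H`. -/
  β : OrbitCat F → Type u
  finite_β : ∀ H, Finite (β H)
  a : ∀ H : OrbitCat F, M.obj (Opposite.op H) ≃ₗ[R] (β H →₀ R)
  b : ∀ H : OrbitCat F, N.obj H ≃ₗ[R] (β H →₀ R)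
  comm : ∀ (H K : OrbitCat F) (φ : H ⟶ K),
    ((dualSystem M).map φ).hom ∘ₗ (a H).toLinearMap.dualMap ∘ₗ
        (dualityIso (β H)).toLinearMap ∘ₗ (b H).toLinearMap =
      (a K).toLinearMap.dualMap ∘ₗ (dualityIso (β K)).toLinearMap ∘ₗ
        (b K).toLinearMap ∘ₗ (N.map φ).hom

end Dual

/-! ### `G`-CW complexes -/

section GCW

variable {G : Type u} [Group G] {F : Set (Subgroup G)}

/-- The open cell with index `e` of dimension `n` of the CW complex `X`. -/
abbrev cellSet (X : Type u) [TopologicalSpace X] [CWComplex (Set.univ : Set X)] (n : ℕ)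
    (e : RelCWComplex.cell (Set.univ : Set X) n) : Set X :=
  RelCWComplex.openCell (C := Set.univ) n e

/-- A `G`-CW complex (`G` discrete) is a CW complex `X` on which `G` acts by homeomorphisms such
that the action permutes the cells, and a cell which is sent to itself is fixed pointwise. -/
class IsGCWComplex (G : Type u) [Group G] (X : Type u) [TopologicalSpace X]
    [CWComplex (Set.univ : Set X)] [MulAction G X] : Prop extends ContinuousConstSMul G X where
  exists_smul_cell_eq : ∀ (g : G) (n : ℕ) (e : RelCWComplex.cell (Set.univ : Set X) n),
    ∃ e', g • cellSet X n e = cellSet X n e'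
  smul_eq_of_smul_cell_eq : ∀ (g : G) (n : ℕ) (e : RelCWComplex.cell (Set.univ : Set X) n),
    g • cellSet X n e = cellSet X n e → ∀ x ∈ cellSet X n e, g • x = x

/-- A `G`-CW complex is proper if all cell stabilizers are finite. -/
def IsProperGCW (G : Type u) [Group G] (X : Type u) [TopologicalSpace X]
    [CWComplex (Set.univ : Set X)] [MulAction G X] : Prop :=
  ∀ (n : ℕ) (e : RelCWComplex.cell (Set.univ : Set X) n),
    Finite (MulAction.stabilizer G (cellSet X n e))

/-- A `G`-CW complex is finite if it consists of finitely many `G`-orbits of cells. -/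
def IsFiniteGCW (G : Type u) [Group G] (X : Type u) [TopologicalSpace X]
    [CWComplex (Set.univ : Set X)] [MulAction G X] : Prop :=
  ∃ S : Set (Σ n, RelCWComplex.cell (Set.univ : Set X) n), S.Finite ∧
    ∀ (n : ℕ) (e : RelCWComplex.cell (Set.univ : Set X) n),
      ∃ e₀, ⟨n, e₀⟩ ∈ S ∧ ∃ g : G, cellSet X n e = g • cellSet X n e₀

/-- The set `X^H ∩ X_{k-1}`: the `H`-fixed points of the union of all cells of dimension `< k`. -/
def fixedSkeletonLT (X : Type u) [TopologicalSpace X] [T2Space X]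
    [CWComplex (Set.univ : Set X)] [MulAction G X] (H : Subgroup G) (k : ℕ) : Set X :=
  {x | x ∈ MulAction.fixedPoints H X ∧ x ∈ RelCWComplex.skeletonLT (Set.univ : Set X) k}

theorem fixedSkeletonLT_mono {X : Type u} [TopologicalSpace X] [T2Space X]
    [CWComplex (Set.univ : Set X)] [MulAction G X] (H : Subgroup G) (k : ℕ) :
    fixedSkeletonLT X H k ⊆ fixedSkeletonLT X H (k + 1) := fun _ hx =>
  ⟨hx.1, RelCWComplex.skeletonLT_mono (by norm_cast; simp) hx.2⟩

theorem smul_mem_skeletonLT {X : Type u} [TopologicalSpace X] [T2Space X]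
    [CWComplex (Set.univ : Set X)] [MulAction G X] [IsGCWComplex G X] (g : G) (k : ℕ) {x : X}
    (hx : x ∈ RelCWComplex.skeletonLT (Set.univ : Set X) k) :
    g • x ∈ RelCWComplex.skeletonLT (Set.univ : Set X) k := by
  rw [CWComplex.mem_skeletonLT_iff] at hx ⊢
  obtain ⟨m, hm, e, he⟩ := hx
  obtain ⟨e', he'⟩ := IsGCWComplex.exists_smul_cell_eq (X := X) g m e
  exact ⟨m, hm, e', by
    have := Set.smul_mem_smul_set (a := g) he
    rwa [he'] at this⟩

/-- If `gK = g'K` then `g` and `g'` act in the same way on `X^K`. -/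
theorem smul_eq_smul_of_mk_eq {K : Subgroup G} {X : Type u} [MulAction G X] {g g' : G}
    (h : (QuotientGroup.mk g : G ⧸ K) = QuotientGroup.mk g') {x : X}
    (hx : x ∈ MulAction.fixedPoints K X) : g • x = g' • x := by
  have h1 : g⁻¹ * g' ∈ K := QuotientGroup.eq.mp h
  have h2 : (g⁻¹ * g') • x = x := hx ⟨_, h1⟩
  rw [← h2, smul_smul]
  simp [h2]

theorem rep_smul_mem {X : Type u} [TopologicalSpace X] [T2Space X]
    [CWComplex (Set.univ : Set X)] [MulAction G X] [IsGCWComplex G X]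
    {H K : OrbitCat F} (φ : H ⟶ K) (k : ℕ) {x : X}
    (hx : x ∈ fixedSkeletonLT X K.subgroup k) :
    OrbitCat.Hom.rep φ • x ∈ fixedSkeletonLT X H.subgroup k := by
  refine ⟨fun h => ?_, smul_mem_skeletonLT _ _ hx.2⟩
  change (h : G) • OrbitCat.Hom.rep φ • x = _
  rw [smul_smul]
  refine smul_eq_smul_of_mk_eq ?_ hx.1
  have : (QuotientGroup.mk ((h : G) * OrbitCat.Hom.rep φ) : G ⧸ K.subgroup) =
      (h : G) • (QuotientGroup.mk (OrbitCat.Hom.rep φ) : G ⧸ K.subgroup) := rfl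
  rw [this, OrbitCat.Hom.mk_rep, ← map_smul]
  congr 1
  exact (QuotientGroup.eq.mpr (by simp) :
    (QuotientGroup.mk ((h : G) * 1) : G ⧸ H.subgroup) = QuotientGroup.mk 1)

/-- The contravariant functor `G/H ↦ X^H ∩ X_{k-1}` on the orbit category: a morphism
`φ : G/H ⟶ G/K` with `φ(eH) = gK` induces `X^K ⟶ X^H`, `x ↦ g • x`. -/
def fixedSpace (F : Set (Subgroup G)) (X : Type u) [TopologicalSpace X] [T2Space X]
    [CWComplex (Set.univ : Set X)] [MulAction G X] [IsGCWComplex G X] (k : ℕ) :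
    (OrbitCat F)ᵒᵖ ⥤ TopCat.{u} where
  obj H := TopCat.of (fixedSkeletonLT X H.unop.subgroup k)
  map φ := TopCat.ofHom
    { toFun := fun x => ⟨OrbitCat.Hom.rep φ.unop • x.1, rep_smul_mem φ.unop k x.2⟩
      continuous_toFun := by fun_prop }
  map_id H := by
    refine TopCat.hom_ext (ContinuousMap.ext fun x => Subtype.ext ?_)
    change OrbitCat.Hom.rep (𝟙 H.unop) • x.1 = x.1
    exact (smul_eq_smul_of_mk_eq (OrbitCat.Hom.mk_rep (𝟙 H.unop)) x.2.1).trans (one_smul G x.1)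
  map_comp {H K L} φ ψ := by
    refine TopCat.hom_ext (ContinuousMap.ext fun x => Subtype.ext ?_)
    change OrbitCat.Hom.rep (ψ.unop ≫ φ.unop) • x.1 =
      OrbitCat.Hom.rep ψ.unop • OrbitCat.Hom.rep φ.unop • x.1
    rw [smul_smul]
    refine smul_eq_smul_of_mk_eq ?_ x.2.1
    have e1 : (QuotientGroup.mk (OrbitCat.Hom.rep ψ.unop * OrbitCat.Hom.rep φ.unop) :
        G ⧸ H.unop.subgroup) = OrbitCat.Hom.rep ψ.unop •
          (QuotientGroup.mk (OrbitCat.Hom.rep φ.unop) : G ⧸ H.unop.subgroup) := rfl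
    have e2 : (QuotientGroup.mk (OrbitCat.Hom.rep ψ.unop) : G ⧸ K.unop.subgroup) =
        OrbitCat.Hom.rep ψ.unop • (QuotientGroup.mk 1 : G ⧸ K.unop.subgroup) := by
      change _ = (QuotientGroup.mk (OrbitCat.Hom.rep ψ.unop * 1) : G ⧸ K.unop.subgroup)
      rw [mul_one]
    rw [e1, OrbitCat.Hom.mk_rep, OrbitCat.Hom.mk_rep, ← map_smul, ← e2, OrbitCat.Hom.mk_rep]
    rfl

/-- The contravariant functor `G/H ↦ (X^H ∩ X_k, X^H ∩ X_{k-1})` on the orbit category. -/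
def fixedPair (F : Set (Subgroup G)) (X : Type u) [TopologicalSpace X] [T2Space X]
    [CWComplex (Set.univ : Set X)] [MulAction G X] [IsGCWComplex G X] (k : ℕ) :
    (OrbitCat F)ᵒᵖ ⥤ TopPair.{u} where
  obj H := TopPair.of (A := (fixedSpace F X k).obj H) (X := (fixedSpace F X (k + 1)).obj H)
    (TopCat.ofHom
      { toFun := Set.inclusion (fixedSkeletonLT_mono (X := X) H.unop.subgroup k)
        continuous_toFun := continuous_inclusion _ })
    (IsEmbedding.inclusion (fixedSkeletonLT_mono (X := X) H.unop.subgroup k))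
  map {H K} φ := MorphismProperty.Arrow.homMk ((fixedSpace F X k).map φ) ((fixedSpace F X (k + 1)).map φ) rfl
  map_id H := by
    apply MorphismProperty.Arrow.Hom.ext
    · exact (fixedSpace F X k).map_id H
    · exact (fixedSpace F X (k + 1)).map_id H
  map_comp φ ψ := by
    apply MorphismProperty.Arrow.Hom.ext
    · exact (fixedSpace F X k).map_comp φ ψ
    · exact (fixedSpace F X (k + 1)).map_comp φ ψ

end GCW

/-! ### The cellular chain complexes of the fixed point complexes -/

section Cellular

variable {G : Type u} [Group G] (F : Set (Subgroup G)) (X : Type u) [TopologicalSpace X] [T2Space X]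
  [CWComplex (Set.univ : Set X)] [MulAction G X] [IsGCWComplex G X]

/-- The contravariant functor `G/H ↦ C_n(X^H) = H_n(X^H ∩ X_n, X^H ∩ X_{n-1})`. -/
def cellularChains (n : ℕ) : (OrbitCat F)ᵒᵖ ⥤ ModuleCat.{u} ℤ :=
  fixedPair F X n ⋙ relHomology n

/-- The identification of the subspace of the pair `(X^H ∩ X_{n+1}, X^H ∩ X_n)` with the total space
of the pair `(X^H ∩ X_n, X^H ∩ X_{n-1})`, on homology. -/
def fixedPairShift (n : ℕ) :
    fixedPair F X (n + 1) ⋙ TopPair.proj₂ ⋙ singularHomology n ⟶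
      fixedPair F X n ⋙ TopPair.proj₁ ⋙ singularHomology n where
  app H := 𝟙 ((singularHomology n).obj ((fixedSpace F X (n + 1)).obj H))
  naturality _ _ φ :=
    (Category.comp_id ((singularHomology n).map ((fixedSpace F X (n + 1)).map φ))).trans
      (Category.id_comp ((singularHomology n).map ((fixedSpace F X (n + 1)).map φ))).symm

/-- The cellular boundary map: the composition of the connecting homomorphism
`H_{n+1}(X^H ∩ X_{n+1}, X^H ∩ X_n) ⟶ H_n(X^H ∩ X_n)` with the map
`H_n(X^H ∩ X_n) ⟶ H_n(X^H ∩ X_n, X^H ∩ X_{n-1})`. -/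
def cellularBoundary (n : ℕ) : cellularChains F X (n + 1) ⟶ cellularChains F X n :=
  Functor.whiskerLeft (fixedPair F X (n + 1)) (connecting n) ≫ fixedPairShift F X n ≫
    Functor.whiskerLeft (fixedPair F X n) (toRelHomology n)

theorem toRelHomology_connecting (n : ℕ) :
    Functor.whiskerLeft (fixedPair F X (n + 1)) (toRelHomology (n + 1)) ≫
      Functor.whiskerLeft (fixedPair F X (n + 1)) (connecting n) = 0 :=
  NatTrans.ext (funext fun H =>
    (pairSequence_shortExact ((fixedPair F X (n + 1)).obj H)).comp_δ (n + 1) n rfl)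

theorem cellularBoundary_comp (n : ℕ) :
    cellularBoundary F X (n + 1) ≫ cellularBoundary F X n = 0 := by
  have key : ∀ {P Q R S T U : (OrbitCat F)ᵒᵖ ⥤ ModuleCat.{u} ℤ} (a : P ⟶ Q) (b : Q ⟶ R) (c : R ⟶ S)
      (d : S ⟶ T) (e : T ⟶ U), c ≫ d = 0 → (a ≫ b ≫ c) ≫ d ≫ e = 0 := by
    intro P Q R S T U a b c d e h
    simp [reassoc_of% h]
  exact key _ _ _ _ _ (toRelHomology_connecting F X n)

/-- The functor `G/H ↦ C_*(X^H)`, as a chain complex of contravariant functors. -/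
def cellularComplex : ChainComplex ((OrbitCat F)ᵒᵖ ⥤ ModuleCat.{u} ℤ) ℕ :=
  ChainComplex.of (cellularChains F X) (cellularBoundary F X) (cellularBoundary_comp F X)

/-! ### Bredon cohomology -/

variable {F}

/-- The Bredon cochain complex `C^n_G(X; M) = Hom(C_n(X), M)`, the group of natural
transformations, with differential induced by the cellular boundary. -/
def cochainComplex (M : (OrbitCat F)ᵒᵖ ⥤ ModuleCat.{u} ℤ) : CochainComplex (ModuleCat.{u} ℤ) ℕ :=
  (cellularComplex F X).linearYonedaObj ℤ M

/-- The Bredon cohomology group `H^n_G(X; M)`, which is zero in negative degrees. -/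
def cohomology (M : (OrbitCat F)ᵒᵖ ⥤ ModuleCat.{u} ℤ) : ℤ → ModuleCat.{u} ℤ
  | .ofNat n => (cochainComplex X M).homology n
  | .negSucc _ => ModuleCat.of ℤ PUnit.{u + 1}

/-! ### Bredon homology -/

/-- The Bredon chain complex `C_n^G(X; N) = C_n(X) ⊗ N`. -/
def chainComplex (N : OrbitCat F ⥤ ModuleCat.{u} ℤ) : ChainComplex (ModuleCat.{u} ℤ) ℕ :=
  ((tensorFunctor N).mapHomologicalComplex _).obj (cellularComplex F X)

/-- The Bredon homology group `H_n^G(X; N)`, which is zero in negative degrees. -/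
def homology (N : OrbitCat F ⥤ ModuleCat.{u} ℤ) : ℤ → ModuleCat.{u} ℤ
  | .ofNat n => (chainComplex X N).homology n
  | .negSucc _ => ModuleCat.of ℤ PUnit.{u + 1}

end Cellular

end

end Bredon

/-! The theorem follows from the universal coefficient theorem once the Bredon cochain complex is
known to be the integral dual of the Bredon chain complex, and the latter to consist of finitely
generated free abelian groups. Both facts rest on the freeness of the cellular chain functors.

Choose a representative of each orbit of `n`-cells, with stabilizer `G_i`. A preserved cell is fixed
pointwise, so `G_i` is the isotropy group of the centre of the cell and lies in the family. The
cells of `X^H` are the translates of the representatives by the morphisms `G/H ⟶ G/G_i`, and hence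
`C_n(X^H)` has a basis indexed by pairs of an orbit `i` and such a morphism
(`cellularChains_exists_basis`). By the Yoneda argument, a natural transformation to `M` is a family
of elements of the groups `M(G/G_i)`, and the tensor product with `N` is the finite direct sum of
the groups `N(G/G_i)`. The compatible bases give isomorphisms of `N(G/H)` with the dual of `M(G/H)`
which are natural in `G/H`. Pairing `θ` with `c ⊗ m` through them identifies the cochains with the
dual of the chains (`DualBases.formOf_bijective`), and naturality in `C` makes the differentials
adjoint. Over a principal ideal domain the kernel of a map into a finitely generated free module is
a direct summand of the source, which yields the sequence (`exists_universalCoefficients`).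

The cellular chains are defined by singular homology, so their basis has to be found in the singular
chains. If a space arises from a closed subset by attaching `n`-cells, the relative homology is free
on the images of one fixed chain under the characteristic maps (`IsCellAttachment.isRelBasis`). The
ingredients are excision through barycentric subdivision (`IsRelBasis.excision`), invariance under
deformations, and an inductive computation of the homology of `ℝⁿ` relative to the complement of a
cube (`exists_isRelBasis_outer`). The computation uses ungraded augmented chains, with an empty
simplex; `relClass` carries the result to the homology of Mathlib's singular complex. -/

namespace Bredon

noncomputable section

/-! ### Linear chains -/

section LinearChains

variable {K L : Type*}

/-- Augmented linear chains: formal sums of tuples of points. A tuple of `k` points is a linear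
simplex with `k` vertices; the empty tuple is allowed. -/
abbrev LinChain (K : Type*) : Type _ := (Σ k, Fin k → K) →₀ ℤ

namespace LinChain

/-- A tuple as a linear chain. -/
def tup {k : ℕ} (w : Fin k → K) : LinChain K := Finsupp.single ⟨k, w⟩ 1

theorem hom_ext {A : Type*} [AddCommGroup A] {f g : LinChain K →ₗ[ℤ] A}
    (h : ∀ k (w : Fin k → K), f (tup w) = g (tup w)) : f = g := by
  refine Finsupp.lhom_ext' fun x => LinearMap.ext_ring ?_
  exact h x.1 x.2

/-- The linear map with prescribed values on tuples. -/
def lift {A : Type*} [AddCommGroup A] (f : ∀ k, (Fin k → K) → A) : LinChain K →ₗ[ℤ] A :=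
  Finsupp.linearCombination ℤ fun x => f x.1 x.2

@[simp]
theorem lift_tup {A : Type*} [AddCommGroup A] (f : ∀ k, (Fin k → K) → A) {k : ℕ} (w : Fin k → K) :
    lift f (tup w) = f k w := by
  simp [lift, tup]

/-- The boundary of a tuple. -/
def bdTup : ∀ k, (Fin k → K) → LinChain K
  | 0, _ => 0
  | k + 1, w => ∑ i : Fin (k + 1), (-1 : ℤ) ^ (i : ℕ) • tup (w ∘ i.succAbove)

/-- The boundary operator. -/
def bd : LinChain K →ₗ[ℤ] LinChain K := lift bdTup

theorem bd_tup_zero (w : Fin 0 → K) : bd (tup w) = 0 := by simp [bd, bdTup]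

theorem bd_tup_succ {k : ℕ} (w : Fin (k + 1) → K) :
    bd (tup w) = ∑ i : Fin (k + 1), (-1 : ℤ) ^ (i : ℕ) • tup (w ∘ i.succAbove) := by
  simp [bd, bdTup]

/-- The cone with apex `b`. -/
def cone (b : K) : LinChain K →ₗ[ℤ] LinChain K :=
  lift fun k w => tup (Fin.cons b w : Fin (k + 1) → K)

@[simp]
theorem cone_tup (b : K) {k : ℕ} (w : Fin k → K) :
    cone b (tup w) = tup (Fin.cons b w : Fin (k + 1) → K) := by
  simp [cone]

/-- The zeroth face of a cone is its base. The other faces are the cones over the faces of the base,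
with the index raised by one and thus the sign reversed. Thanks to the empty tuple there is no
exception in the lowest degree. -/
theorem bd_cone (b : K) (c : LinChain K) : bd (cone b c) = c - cone b (bd c) := by
  suffices h : bd ∘ₗ cone b = LinearMap.id - cone b ∘ₗ bd from LinearMap.congr_fun h c
  refine hom_ext fun k w => ?_
  simp only [LinearMap.comp_apply, cone_tup, LinearMap.sub_apply, LinearMap.id_apply]
  rw [bd_tup_succ, Fin.sum_univ_succ]
  have h0 : (Fin.cons b w : Fin (k + 1) → K) ∘ Fin.succAbove 0 = w := by
    funext j; simp
  rw [h0]
  cases k with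
  | zero => simp [bd_tup_zero]
  | succ k =>
    rw [bd_tup_succ, map_sum]
    simp only [Fin.val_zero, pow_zero, one_smul, map_zsmul, cone_tup, sub_eq_add_neg,
      ← Finset.sum_neg_distrib]
    congr 1
    refine Finset.sum_congr rfl fun i _ => ?_
    have h1 : (Fin.cons b w : Fin (k + 2) → K) ∘ i.succ.succAbove =
        Fin.cons b (w ∘ i.succAbove) := by
      funext j
      refine Fin.cases ?_ (fun j => ?_) j <;> simp
    rw [h1, Fin.val_succ, pow_succ]
    simp

/-- Every nonempty tuple is the cone over its tail, so two applications of the cone formula reduce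
the claim to a shorter tuple. -/
theorem bd_bd (c : LinChain K) : bd (bd c) = 0 := by
  suffices h : bd ∘ₗ bd = (0 : LinChain K →ₗ[ℤ] LinChain K) from LinearMap.congr_fun h c
  have key : ∀ k (w : Fin k → K), bd (bd (tup w)) = 0 := by
    intro k
    induction k with
    | zero => intro w; simp [bd_tup_zero]
    | succ k ih =>
      intro w
      rw [← Fin.cons_self_tail w, ← cone_tup, bd_cone, map_sub, bd_cone, ih]
      simp
  exact hom_ext fun k w => by simpa using key k w

/-- The map induced on linear chains. -/
def map (f : K → L) : LinChain K →ₗ[ℤ] LinChain L := lift fun _ w => tup (f ∘ w)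

@[simp]
theorem map_tup (f : K → L) {k : ℕ} (w : Fin k → K) : map f (tup w) = tup (f ∘ w) := by simp [map]

theorem map_bd (f : K → L) (c : LinChain K) : map f (bd c) = bd (map f c) := by
  suffices h : map f ∘ₗ bd = bd ∘ₗ map f from LinearMap.congr_fun h c
  refine hom_ext fun k w => ?_
  cases k with
  | zero => simp [bd_tup_zero]
  | succ k =>
    simp only [LinearMap.comp_apply, map_tup, bd_tup_succ, map_sum, map_zsmul]
    rfl

theorem map_cone (f : K → L) (b : K) (c : LinChain K) :
    map f (cone b c) = cone (f b) (map f c) := by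
  suffices h : map f ∘ₗ cone b = cone (f b) ∘ₗ map f from LinearMap.congr_fun h c
  refine hom_ext fun k w => ?_
  simp only [LinearMap.comp_apply, map_tup, cone_tup]
  congr 1
  funext j
  refine Fin.cases ?_ (fun j => ?_) j <;> simp

/-- The values on tuples of the operator `coneRec g b`. -/
def coneRecTup (g : ∀ k, (Fin k → K) → LinChain L) (ε : ℤ) (b : ∀ k, (Fin (k + 1) → K) → L) :
    ∀ k, (Fin k → K) → LinChain L
  | 0, w => g 0 w
  | k + 1, w => cone (b k w) (g (k + 1) w + ε • ∑ i : Fin (k + 1), (-1 : ℤ) ^ (i : ℕ) •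
      coneRecTup g ε b k (w ∘ i.succAbove))

/-- The operator `D` determined by `D w = g w` for the empty tuple `w`, and by
`D w = cone (b w) (g w + ε • D (bd w))` for all other tuples. -/
def coneRec (g : ∀ k, (Fin k → K) → LinChain L) (ε : ℤ) (b : ∀ k, (Fin (k + 1) → K) → L) :
    LinChain K →ₗ[ℤ] LinChain L := lift (coneRecTup g ε b)

section

variable (g : ∀ k, (Fin k → K) → LinChain L) (ε : ℤ) (b : ∀ k, (Fin (k + 1) → K) → L)

theorem coneRec_tup_zero (w : Fin 0 → K) : coneRec g ε b (tup w) = g 0 w := by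
  simp [coneRec, coneRecTup]

theorem coneRec_tup_succ {k : ℕ} (w : Fin (k + 1) → K) :
    coneRec g ε b (tup w) = cone (b k w) (g (k + 1) w + ε • coneRec g ε b (bd (tup w))) := by
  simp [coneRec, coneRecTup, bd_tup_succ]

/-- The recursion determines the operator, so compatibility of the base values and of the apexes
propagates by induction on the number of vertices. The naturality of subdivision, of its homotopy
and of the prism are all instances. -/
theorem map_coneRec {K' L' : Type*} (g' : ∀ k, (Fin k → K') → LinChain L')
    (b' : ∀ k, (Fin (k + 1) → K') → L') (φ : K → K') (ψ : L → L')
    (hg : ∀ k (w : Fin k → K), map ψ (g k w) = g' k (φ ∘ w))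
    (hb : ∀ k (w : Fin (k + 1) → K), ψ (b k w) = b' k (φ ∘ w)) (c : LinChain K) :
    map ψ (coneRec g ε b c) = coneRec g' ε b' (map φ c) := by
  suffices h : map ψ ∘ₗ coneRec g ε b = coneRec g' ε b' ∘ₗ map φ from LinearMap.congr_fun h c
  have key : ∀ k (w : Fin k → K),
      map ψ (coneRec g ε b (tup w)) = coneRec g' ε b' (tup (φ ∘ w)) := by
    intro k
    induction k with
    | zero => intro w; rw [coneRec_tup_zero, coneRec_tup_zero, hg]
    | succ k ih =>
      intro w
      rw [coneRec_tup_succ, coneRec_tup_succ, map_cone, map_add, hg, hb, map_zsmul,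
        bd_tup_succ, bd_tup_succ]
      simp only [map_sum, map_zsmul, ih]
      rfl
  exact hom_ext fun k w => by simpa using key k w

end

/-- If `D` is obtained by coning off `f - h - D ∘ bd`, with `f` and `h` chain maps which agree
on the empty tuple, then `D` is a chain homotopy from `h` to `f`. -/
theorem bd_coneRec_homotopy {f h : LinChain K →ₗ[ℤ] LinChain L} (b : ∀ k, (Fin (k + 1) → K) → L)
    (hf : ∀ c, f (bd c) = bd (f c)) (hh : ∀ c, h (bd c) = bd (h c))
    (h0 : ∀ w : Fin 0 → K, f (tup w) = h (tup w)) (c : LinChain K) :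
    bd (coneRec (fun _ w => f (tup w) - h (tup w)) (-1) b c) +
      coneRec (fun _ w => f (tup w) - h (tup w)) (-1) b (bd c) = f c - h c := by
  set D := coneRec (fun _ w => f (tup w) - h (tup w)) (-1) b with hD
  suffices H : bd ∘ₗ D + D ∘ₗ bd = f - h from LinearMap.congr_fun H c
  have key : ∀ k (w : Fin k → K), bd (D (tup w)) + D (bd (tup w)) = f (tup w) - h (tup w) := by
    intro k
    induction k with
    | zero =>
      intro w
      rw [hD, coneRec_tup_zero, bd_tup_zero, h0]
      simp
    | succ k ih =>
      intro w
      -- This says that the chain being coned off is a cycle, so the boundary of its cone is that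
      -- chain itself.
      have ih' : bd (D (bd (tup w))) = f (bd (tup w)) - h (bd (tup w)) := by
        have h1 : bd (D (bd (tup w))) + D (bd (bd (tup w))) = f (bd (tup w)) - h (bd (tup w)) := by
          rw [bd_tup_succ]
          simp only [map_sum, map_zsmul, ← Finset.sum_add_distrib, ← smul_add, ih,
            ← Finset.sum_sub_distrib, ← smul_sub]
        rwa [bd_bd, map_zero, add_zero] at h1
      have h2 : D (tup w) = cone (b k w) (f (tup w) - h (tup w) + (-1 : ℤ) • D (bd (tup w))) :=
        coneRec_tup_succ _ _ _ w
      rw [h2, bd_cone]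
      simp only [map_add, map_sub, map_zsmul, ih', hf, hh]
      simp
  exact hom_ext fun k w => by simpa using key k w

end LinChain

end LinearChains

end

end Bredon

namespace Bredon

noncomputable section

/-! ### Affine simplices and barycentric subdivision of linear chains -/

section Affine

variable {E E' : Type*} [NormedAddCommGroup E] [NormedSpace ℝ E] [NormedAddCommGroup E']
  [NormedSpace ℝ E'] {s : Set E} {s' : Set E'}

instance {ι : Type*} [Fintype ι] : Fact (Convex ℝ (stdSimplex ℝ ι)) := ⟨convex_stdSimplex ℝ ι⟩

instance [Fact (Convex ℝ s)] [Fact (Convex ℝ s')] : Fact (Convex ℝ (s ×ˢ s')) :=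
  ⟨(Fact.out : Convex ℝ s).prod (Fact.out : Convex ℝ s')⟩

instance : Fact (Convex ℝ (Set.Icc (0 : ℝ) 1)) := ⟨convex_Icc 0 1⟩

/-- The affine simplex with prescribed vertices in a convex set. -/
def aff [hs : Fact (Convex ℝ s)] {k : ℕ} (w : Fin k → s) : C(stdSimplex ℝ (Fin k), s) where
  toFun t := ⟨∑ j, t j • (w j : E),
    hs.out.sum_mem (fun j _ => t.2.1 j) t.2.2 fun j _ => (w j).2⟩
  continuous_toFun := by
    refine Continuous.subtype_mk (continuous_finsetSum _ fun j _ => ?_) _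
    exact ((continuous_apply j).comp continuous_subtype_val).smul continuous_const

variable [Fact (Convex ℝ s)] [Fact (Convex ℝ s')]

theorem coe_aff {k : ℕ} (w : Fin k → s) (t : stdSimplex ℝ (Fin k)) :
    (aff w t : E) = ∑ j, t j • (w j : E) := rfl

/-- Maps of convex sets which preserve affine simplices. -/
def IsAffine (φ : s → s') : Prop :=
  ∀ k (w : Fin k → s) (t : stdSimplex ℝ (Fin k)), φ (aff w t) = aff (φ ∘ w) t

/-- A convex combination of convex combinations is computed by exchanging two finite sums. This lets
operators built from barycentres pass through affine simplices. -/
theorem isAffine_aff {k : ℕ} (w : Fin k → s) : IsAffine (aff w) := by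
  intro l v t
  refine Subtype.ext ?_
  have h (i : Fin k) : (aff v t) i = ∑ j, t j * v j i := by
    change (∑ j, t j • ((v j : Fin k → ℝ))) i = _
    rw [Finset.sum_apply]
    rfl
  rw [coe_aff, coe_aff]
  simp only [h, Finset.sum_smul, Function.comp_apply, coe_aff, Finset.smul_sum, mul_smul]
  exact Finset.sum_comm

theorem aff_vertex {k : ℕ} (t : stdSimplex ℝ (Fin k)) :
    aff (fun i : Fin k => stdSimplex.vertex (S := ℝ) i) t = t := by
  refine Subtype.ext (funext fun i => ?_)
  rw [coe_aff, Finset.sum_apply]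
  simp [Pi.single_apply]
  rfl

theorem aff_apply_vertex {k : ℕ} (w : Fin k → s) (i : Fin k) :
    aff w (stdSimplex.vertex i) = w i := by
  refine Subtype.ext ?_
  rw [coe_aff, Finset.sum_eq_single i]
  · simp
  · intro j _ hj
    simp [hj]
  · simp

theorem aff_map {k l : ℕ} (w : Fin k → s) (f : Fin l → Fin k) (t : stdSimplex ℝ (Fin l)) :
    aff w (stdSimplex.map f t) = aff (w ∘ f) t := by
  have h : stdSimplex.map f t = aff (fun j => stdSimplex.vertex (S := ℝ) (f j)) t := by
    refine Subtype.ext (funext fun i => ?_)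
    rw [coe_aff, Finset.sum_apply]
    change stdSimplex.map f t i = _
    rw [stdSimplex.map_coe, FunOnFinite.linearMap_apply_apply]
    simp [Pi.single_apply, Finset.sum_ite, eq_comm]
  rw [h, isAffine_aff]
  congr 1
  exact congrArg aff (funext fun j => aff_apply_vertex w (f j))

/-- The barycenter of a nonempty tuple. -/
def bary (k : ℕ) (w : Fin (k + 1) → s) : s := aff w stdSimplex.barycenter

theorem IsAffine.map_bary {φ : s → s'} (hφ : IsAffine φ) {k : ℕ} (w : Fin (k + 1) → s) :
    φ (bary k w) = bary k (φ ∘ w) := hφ _ _ _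

namespace LinChain

/-- The value of the barycentric subdivision on the empty tuple. -/
def sdBase : ∀ k, (Fin k → s) → LinChain s
  | 0, w => tup w
  | _ + 1, _ => 0

/-- Barycentric subdivision of linear chains. -/
def sd : LinChain s →ₗ[ℤ] LinChain s := coneRec sdBase 1 bary

theorem sd_tup_zero (w : Fin 0 → s) : sd (tup w) = tup w := coneRec_tup_zero _ _ _ _

theorem sd_tup_succ {k : ℕ} (w : Fin (k + 1) → s) :
    sd (tup w) = cone (bary k w) (sd (bd (tup w))) := by
  simp [sd, coneRec_tup_succ, sdBase]

theorem sd_bd (c : LinChain s) : sd (bd c) = bd (sd c) := by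
  suffices h : sd ∘ₗ bd = (bd ∘ₗ sd : LinChain s →ₗ[ℤ] LinChain s) from LinearMap.congr_fun h c
  have key : ∀ k (w : Fin k → s), sd (bd (tup w)) = bd (sd (tup w)) := by
    intro k
    induction k with
    | zero => intro w; simp [sd_tup_zero, bd_tup_zero]
    | succ k ih =>
      intro w
      have h : bd (sd (bd (tup w))) = sd (bd (bd (tup w))) := by
        conv_lhs => rw [bd_tup_succ]
        conv_rhs => rw [bd_tup_succ]
        simp only [map_sum, map_zsmul, ih]
      rw [sd_tup_succ, bd_cone, h, bd_bd]
      simp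
  exact hom_ext fun k w => by simpa using key k w

theorem map_sd {φ : s → s'} (hφ : IsAffine φ) (c : LinChain s) : map φ (sd c) = sd (map φ c) := by
  refine map_coneRec _ _ _ _ _ φ φ (fun k w => ?_) (fun k w => hφ.map_bary w) c
  cases k with
  | zero => simp [sdBase]
  | succ k => simp [sdBase]

/-- The chain homotopy from barycentric subdivision to the identity. -/
def sdHomotopy : LinChain s →ₗ[ℤ] LinChain s :=
  coneRec (fun _ w => tup w - sd (tup w)) (-1) bary

theorem bd_sdHomotopy (c : LinChain s) : bd (sdHomotopy c) + sdHomotopy (bd c) = c - sd c :=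
  bd_coneRec_homotopy (f := LinearMap.id) (h := sd) bary (fun _ => rfl) sd_bd
    (fun w => (sd_tup_zero w).symm) c

theorem map_sdHomotopy {φ : s → s'} (hφ : IsAffine φ) (c : LinChain s) :
    map φ (sdHomotopy c) = sdHomotopy (map φ c) :=
  map_coneRec _ _ _ _ _ φ φ (fun k w => by rw [map_sub, map_sd hφ, map_tup])
    (fun k w => hφ.map_bary w) c

/-- The inclusion of the slice at height `a` in the prism. -/
def slice (a : Set.Icc (0 : ℝ) 1) (x : s) : ↥(s ×ˢ Set.Icc (0 : ℝ) 1) := ⟨(x.1, a.1), x.2, a.2⟩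

theorem fst_aff {k : ℕ} (w : Fin k → ↥(s ×ˢ s')) (t : stdSimplex ℝ (Fin k)) :
    (aff w t : E × E').1 = aff (fun i => (⟨(w i).1.1, (w i).2.1⟩ : s)) t := by
  simp [coe_aff, Prod.fst_sum]

theorem snd_aff {k : ℕ} (w : Fin k → ↥(s ×ˢ s')) (t : stdSimplex ℝ (Fin k)) :
    (aff w t : E × E').2 = aff (fun i => (⟨(w i).1.2, (w i).2.2⟩ : s')) t := by
  simp [coe_aff, Prod.snd_sum]

/-- The chain homotopy between the two ends of the prism. -/
def prism : LinChain s →ₗ[ℤ] LinChain ↥(s ×ˢ Set.Icc (0 : ℝ) 1) :=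
  coneRec (fun _ w => map (slice 1) (tup w) - map (slice 0) (tup w)) (-1)
    fun k w => slice 0 (bary k w)

theorem bd_prism (c : LinChain s) :
    bd (prism c) + prism (bd c) = map (slice 1) c - map (slice 0) c :=
  bd_coneRec_homotopy _ (map_bd _) (map_bd _)
    (fun w => by rw [map_tup, map_tup]; exact congrArg tup (Subsingleton.elim _ _)) c

/-- The product of a map with the identity of the unit interval. -/
def cyl (φ : s → s') (p : ↥(s ×ˢ Set.Icc (0 : ℝ) 1)) : ↥(s' ×ˢ Set.Icc (0 : ℝ) 1) :=
  ⟨((φ ⟨p.1.1, p.2.1⟩ : E'), p.1.2), (φ ⟨p.1.1, p.2.1⟩).2, p.2.2⟩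

theorem map_prism {φ : s → s'} (hφ : IsAffine φ) (c : LinChain s) :
    map (cyl φ) (prism c) = prism (map φ c) := by
  refine map_coneRec _ _ _ _ _ φ (cyl φ) (fun k w => ?_) (fun k w => ?_) c
  · simp only [map_sub, map_tup]
    rfl
  · rw [← hφ.map_bary w]
    rfl

/-! ### The mesh of subdivisions -/

/-- Chains all of whose tuples satisfy `P`. -/
abbrev on {K : Type*} (P : Set (Σ k, Fin k → K)) : Submodule ℤ (LinChain K) :=
  Finsupp.supported ℤ ℤ P

theorem tup_mem_on {K : Type*} {P : Set (Σ k, Fin k → K)} {k : ℕ} {w : Fin k → K}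
    (h : ⟨k, w⟩ ∈ P) : tup w ∈ on P :=
  Finsupp.single_mem_supported ℤ 1 h

theorem lift_mem {K A : Type*} [AddCommGroup A] {P : Set (Σ k, Fin k → K)} {Q : Submodule ℤ A}
    {f : LinChain K →ₗ[ℤ] A} (h : ∀ k (w : Fin k → K), ⟨k, w⟩ ∈ P → f (tup w) ∈ Q)
    {c : LinChain K} (hc : c ∈ on P) : f c ∈ Q := by
  have h' : on P ≤ Q.comap f := by
    rw [on, Finsupp.supported_eq_span_single (R := ℤ), Submodule.span_le]
    rintro _ ⟨x, hx, rfl⟩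
    exact h x.1 x.2 hx
  exact h' hc

/-- Tuples of `k` points in the convex hull of `T` with mutual distances at most `d`. -/
def fineIn (T : Set E) (k : ℕ) (d : ℝ) : Set (Σ k, Fin k → s) :=
  {x | x.1 = k ∧ (∀ i, (x.2 i : E) ∈ convexHull ℝ T) ∧ ∀ i j, dist (x.2 i) (x.2 j) ≤ d}

/-- Balls are convex, so only the vertices matter. The vector from a vertex to the barycentre is the
average of `k + 1` difference vectors, one of which is zero while the others have norm at most `d`.
The resulting factor `k / (k + 1)` increases with `k`. -/
theorem dist_bary_le {k N : ℕ} (hk : k ≤ N) {d : ℝ} (w : Fin (k + 1) → s)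
    (hw : ∀ i j, dist (w i) (w j) ≤ d) {p : E}
    (hp : p ∈ convexHull ℝ (Set.range fun i => (w i : E))) :
    dist (bary k w : E) p ≤ N / (N + 1) * d := by
  have hd : 0 ≤ d := dist_nonneg.trans (hw 0 0)
  suffices h : convexHull ℝ (Set.range fun i => (w i : E)) ⊆
      Metric.closedBall (bary k w : E) (N / (N + 1) * d) by
    rw [dist_comm]; exact h hp
  refine convexHull_min ?_ (convex_closedBall _ _)
  rintro _ ⟨i, rfl⟩
  have hb : (bary k w : E) - w i = ((k : ℝ) + 1)⁻¹ • ∑ j, ((w j : E) - w i) := by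
    have h1 : (bary k w : E) = ((k : ℝ) + 1)⁻¹ • ∑ j, (w j : E) := by
      rw [bary, coe_aff, Finset.smul_sum]
      refine Finset.sum_congr rfl fun j _ => ?_
      congr 1
      change (Fintype.card (Fin (k + 1)) : ℝ)⁻¹ = _
      simp
    rw [h1, Finset.sum_sub_distrib, smul_sub]
    congr 1
    rw [Finset.sum_const, Finset.card_univ, Fintype.card_fin, ← Nat.cast_smul_eq_nsmul ℝ,
      smul_smul, Nat.cast_succ, inv_mul_cancel₀ (by positivity), one_smul]
  rw [Metric.mem_closedBall, dist_comm, dist_eq_norm, hb, norm_smul]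
  have h2 : ‖∑ j, ((w j : E) - w i)‖ ≤ k * d := by
    rw [Fin.sum_univ_succAbove _ i, sub_self, zero_add]
    refine (norm_sum_le_of_le _ fun j _ => (?_ : _ ≤ d)).trans ?_
    · rw [← dist_eq_norm]; exact hw _ _
    · simp
  rw [Real.norm_of_nonneg (by positivity)]
  calc ((k : ℝ) + 1)⁻¹ * ‖∑ j, ((w j : E) - w i)‖ ≤ ((k : ℝ) + 1)⁻¹ * (k * d) := by gcongr
    _ = (k / (k + 1)) * d := by ring
    _ ≤ N / (N + 1) * d := by
      have : (k : ℝ) ≤ N := by exact_mod_cast hk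
      gcongr ?_ * d
      rw [div_le_div_iff₀ (by positivity) (by positivity)]
      nlinarith

/-- A simplex of the subdivision is the barycentre joined to a simplex of a subdivided face. The
convex hull is carried along in the induction because `dist_bary_le` bounds distances from the new
apex only to points of the hull. The uniform `N` gives faces of all dimensions the same constant. -/
theorem sd_tup_mem_fineIn {N : ℕ} {d : ℝ} : ∀ {k : ℕ}, k ≤ N + 1 → ∀ w : Fin k → s,
    (∀ i j, dist (w i) (w j) ≤ d) →
    sd (tup w) ∈ on (fineIn (s := s) (Set.range fun i => (w i : E)) k (N / (N + 1) * d)) := by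
  intro k
  induction k with
  | zero =>
    intro _ w _
    rw [sd_tup_zero]
    exact tup_mem_on ⟨rfl, fun i => i.elim0, fun i => i.elim0⟩
  | succ k ih =>
    intro hk w hw
    have hd : 0 ≤ d := dist_nonneg.trans (hw 0 0)
    rw [sd_tup_succ]
    have h1 : sd (bd (tup w)) ∈
        on (fineIn (s := s) (Set.range fun i => (w i : E)) k (N / (N + 1) * d)) := by
      rw [bd_tup_succ]
      simp only [map_sum, map_zsmul]
      refine Submodule.sum_mem _ fun i _ => Submodule.smul_mem _ _ ?_
      refine Finsupp.supported_mono ?_ (ih (by omega) (w ∘ i.succAbove) fun a b => hw _ _)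
      rintro x ⟨hx1, hx2, hx3⟩
      refine ⟨hx1, fun j => convexHull_mono ?_ (hx2 j), hx3⟩
      rintro _ ⟨j, rfl⟩
      exact ⟨_, rfl⟩
    refine lift_mem (fun l v hv => ?_) h1
    obtain ⟨hv1, hv2, hv3⟩ := hv
    rw [cone_tup]
    have hb := fun p hp => dist_bary_le (N := N) (by omega) w hw (p := p) hp
    refine tup_mem_on ⟨congrArg (· + 1) hv1, ?_, ?_⟩
    · refine Fin.cases ?_ ?_
      · simp only [Fin.cons_zero]
        rw [bary, coe_aff]
        exact (convex_convexHull ℝ _).sum_mem (fun j _ => stdSimplex.zero_le _ j)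
          (stdSimplex.sum_eq_one _) fun j _ => subset_convexHull ℝ _ ⟨j, rfl⟩
      · intro j
        simpa using hv2 j
    · refine Fin.cases ?_ (fun i => ?_) <;> refine Fin.cases ?_ (fun j => ?_)
      · simp only [dist_self]; positivity
      · exact hb _ (hv2 j)
      · simp only [Fin.cons_zero, Fin.cons_succ]
        rw [dist_comm]
        exact hb _ (hv2 i)
      · simpa using hv3 i j

/-- Tuples of `k` points with mutual distances at most `d`. -/
def fine (k : ℕ) (d : ℝ) : Set (Σ k, Fin k → s) :=
  {x | x.1 = k ∧ ∀ i j, dist (x.2 i) (x.2 j) ≤ d}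

/-- Subdivision preserves the number of vertices, so the same ratio applies in every round. The
ratio is not optimal; it only has to be below one. -/
theorem iterate_sd_mem_fine (k : ℕ) (d : ℝ) (w : Fin k → s) (hw : ∀ i j, dist (w i) (w j) ≤ d)
    (m : ℕ) : (sd^[m]) (tup w) ∈ on (fine (s := s) k ((k / (k + 1) : ℝ) ^ m * d)) := by
  induction m with
  | zero => exact tup_mem_on ⟨rfl, by simpa using hw⟩
  | succ m ih =>
    rw [Function.iterate_succ_apply']
    refine lift_mem (fun l v hv => ?_) ih
    obtain ⟨rfl, hv2⟩ := hv
    refine Finsupp.supported_mono ?_ (sd_tup_mem_fineIn (N := l) (Nat.le_succ _) v hv2)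
    rintro x ⟨hx1, -, hx3⟩
    refine ⟨hx1, fun i j => (hx3 i j).trans_eq ?_⟩
    ring

end LinChain

end Affine

end

end Bredon

namespace Bredon

noncomputable section

/-! ### Singular chains -/

section SingularChains

variable {E E' : Type*} [NormedAddCommGroup E] [NormedSpace ℝ E] [NormedAddCommGroup E']
  [NormedSpace ℝ E'] {s : Set E} {s' : Set E'} [Fact (Convex ℝ s)] [Fact (Convex ℝ s')]
  {Y Z T : Type*} [TopologicalSpace Y] [TopologicalSpace Z] [TopologicalSpace T]

/-- The augmented total singular chains of a space. The simplices are indexed by their number of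
vertices, and the empty simplex is allowed. -/
abbrev SingChain (Y : Type*) [TopologicalSpace Y] : Type _ :=
  (Σ k, C(stdSimplex ℝ (Fin k), Y)) →₀ ℤ

namespace SingChain

/-- A singular simplex as a chain. -/
def sx {k : ℕ} (σ : C(stdSimplex ℝ (Fin k), Y)) : SingChain Y := Finsupp.single ⟨k, σ⟩ 1

theorem hom_ext {A : Type*} [AddCommGroup A] [Module ℤ A] {f g : SingChain Y →ₗ[ℤ] A}
    (h : ∀ k (σ : C(stdSimplex ℝ (Fin k), Y)), f (sx σ) = g (sx σ)) : f = g := by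
  refine Finsupp.lhom_ext' fun x => LinearMap.ext_ring ?_
  exact h x.1 x.2

theorem linearCombination_single_one {R M ι : Type*} [Semiring R] [AddCommMonoid M] [Module R M]
    (v : ι → M) (i : ι) : Finsupp.linearCombination R v (Finsupp.single i 1) = v i := by simp

/-- The linear map with prescribed values on singular simplices. -/
def lift {A : Type*} [AddCommGroup A] [Module ℤ A] (f : ∀ k, C(stdSimplex ℝ (Fin k), Y) → A) :
    SingChain Y →ₗ[ℤ] A := Finsupp.linearCombination ℤ fun x => f x.1 x.2

@[simp]
theorem lift_sx {A : Type*} [AddCommGroup A] [Module ℤ A] (f : ∀ k, C(stdSimplex ℝ (Fin k), Y) → A) {k : ℕ}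
    (σ : C(stdSimplex ℝ (Fin k), Y)) : lift f (sx σ) = f k σ := by
  exact linearCombination_single_one (R := ℤ) _ _

/-- The inclusion of a face of the standard simplex. -/
def face {k : ℕ} (i : Fin (k + 1)) : C(stdSimplex ℝ (Fin k), stdSimplex ℝ (Fin (k + 1))) :=
  ⟨stdSimplex.map i.succAbove, stdSimplex.continuous_map _⟩

/-- The boundary of a singular simplex. -/
def bdSx : ∀ k, C(stdSimplex ℝ (Fin k), Y) → SingChain Y
  | 0, _ => 0
  | k + 1, σ => ∑ i : Fin (k + 1), (-1 : ℤ) ^ (i : ℕ) • sx (σ.comp (face i))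

/-- The boundary operator. -/
def bd : SingChain Y →ₗ[ℤ] SingChain Y := lift bdSx

theorem bd_sx_zero (σ : C(stdSimplex ℝ (Fin 0), Y)) : bd (sx σ) = 0 := by simp [bd, bdSx]

theorem bd_sx_succ {k : ℕ} (σ : C(stdSimplex ℝ (Fin (k + 1)), Y)) :
    bd (sx σ) = ∑ i : Fin (k + 1), (-1 : ℤ) ^ (i : ℕ) • sx (σ.comp (face i)) := by
  simp [bd, bdSx]

/-- The map induced on singular chains. -/
def push (f : C(Y, Z)) : SingChain Y →ₗ[ℤ] SingChain Z := lift fun _ σ => sx (f.comp σ)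

@[simp]
theorem push_sx (f : C(Y, Z)) {k : ℕ} (σ : C(stdSimplex ℝ (Fin k), Y)) :
    push f (sx σ) = sx (f.comp σ) := by simp [push]

theorem push_bd (f : C(Y, Z)) (c : SingChain Y) : push f (bd c) = bd (push f c) := by
  suffices h : push f ∘ₗ bd = bd ∘ₗ push f from LinearMap.congr_fun h c
  refine hom_ext fun k w => ?_
  cases k with
  | zero => simp [bd_sx_zero]
  | succ k =>
    simp only [LinearMap.comp_apply, push_sx, bd_sx_succ, map_sum, map_zsmul]
    rfl

theorem push_push (g : C(Z, T)) (f : C(Y, Z)) (c : SingChain Y) :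
    push g (push f c) = push (g.comp f) c := by
  suffices h : push g ∘ₗ push f = push (g.comp f) from LinearMap.congr_fun h c
  exact hom_ext fun k σ => by simp [ContinuousMap.comp_assoc]

theorem push_id (c : SingChain Y) : push (ContinuousMap.id Y) c = c := by
  suffices h : push (ContinuousMap.id Y) = LinearMap.id from LinearMap.congr_fun h c
  exact hom_ext fun k σ => by simp

/-- The realization of linear chains by affine simplices. -/
def realize (f : C(s, Y)) : LinChain s →ₗ[ℤ] SingChain Y :=
  LinChain.lift fun _ w => sx (f.comp (aff w))

@[simp]
theorem realize_tup (f : C(s, Y)) {k : ℕ} (w : Fin k → s) :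
    realize f (LinChain.tup w) = sx (f.comp (aff w)) := by simp [realize]

theorem realize_bd (f : C(s, Y)) (c : LinChain s) :
    realize f (LinChain.bd c) = bd (realize f c) := by
  suffices h : realize f ∘ₗ LinChain.bd = bd ∘ₗ realize f from LinearMap.congr_fun h c
  refine LinChain.hom_ext fun k w => ?_
  cases k with
  | zero => simp [bd_sx_zero, LinChain.bd_tup_zero]
  | succ k =>
    simp only [LinearMap.comp_apply, realize_tup, bd_sx_succ, LinChain.bd_tup_succ, map_sum,
      map_zsmul]
    refine Finset.sum_congr rfl fun i _ => ?_
    congr 2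
    ext t
    exact congrArg f (aff_map w _ t).symm

theorem realize_map (f : C(s', Y)) (φ : C(s, s')) (hφ : IsAffine φ) (c : LinChain s) :
    realize f (LinChain.map φ c) = realize (f.comp φ) c := by
  suffices h : realize f ∘ₗ LinChain.map φ = realize (f.comp φ) from LinearMap.congr_fun h c
  refine LinChain.hom_ext fun k w => ?_
  simp only [LinearMap.comp_apply, LinChain.map_tup, realize_tup]
  congr 1
  ext t
  exact congrArg f (hφ k w t).symm

/-- The vertices of the standard simplex. -/
def vert (k : ℕ) : LinChain (stdSimplex ℝ (Fin k)) := LinChain.tup fun i => stdSimplex.vertex i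

/-- Every singular simplex is the realization of one universal tuple. Identities between natural
operators on singular chains therefore reduce to identities on linear chains, as in the method of
acyclic models. -/
theorem realize_vert {k : ℕ} (σ : C(stdSimplex ℝ (Fin k), Y)) : realize σ (vert k) = sx σ := by
  rw [vert, realize_tup]
  congr 1
  ext t
  exact congrArg σ (aff_vertex t)

theorem map_vert {k : ℕ} (w : Fin k → s) : LinChain.map (aff w) (vert k) = LinChain.tup w := by
  rw [vert, LinChain.map_tup]
  congr 1
  funext i
  exact aff_apply_vertex w i

theorem bd_bd (c : SingChain Y) : bd (bd c) = 0 := by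
  suffices h : bd ∘ₗ bd = (0 : SingChain Y →ₗ[ℤ] SingChain Y) from LinearMap.congr_fun h c
  refine hom_ext fun k σ => ?_
  rw [LinearMap.comp_apply, ← realize_vert, ← realize_bd, ← realize_bd, LinChain.bd_bd]
  simp

/-- Barycentric subdivision of singular chains. -/
def sd : SingChain Y →ₗ[ℤ] SingChain Y := lift fun k σ => realize σ (LinChain.sd (vert k))

/-- The chain homotopy from barycentric subdivision to the identity. -/
def sdHomotopy : SingChain Y →ₗ[ℤ] SingChain Y :=
  lift fun k σ => realize σ (LinChain.sdHomotopy (vert k))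

/-- The singular operator is defined through the universal tuple only. It agrees with linear
subdivision on all tuples because affine maps commute with the latter. -/
theorem sd_realize (f : C(s, Y)) (c : LinChain s) :
    sd (realize f c) = realize f (LinChain.sd c) := by
  suffices h : sd ∘ₗ realize f = realize f ∘ₗ LinChain.sd from LinearMap.congr_fun h c
  refine LinChain.hom_ext fun k w => ?_
  simp only [LinearMap.comp_apply, realize_tup, sd, lift_sx]
  rw [← realize_map _ _ (isAffine_aff w), LinChain.map_sd (isAffine_aff w), map_vert]

theorem sdHomotopy_realize (f : C(s, Y)) (c : LinChain s) :
    sdHomotopy (realize f c) = realize f (LinChain.sdHomotopy c) := by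
  suffices h : sdHomotopy ∘ₗ realize f = realize f ∘ₗ LinChain.sdHomotopy from
    LinearMap.congr_fun h c
  refine LinChain.hom_ext fun k w => ?_
  simp only [LinearMap.comp_apply, realize_tup, sdHomotopy, lift_sx]
  rw [← realize_map _ _ (isAffine_aff w), LinChain.map_sdHomotopy (isAffine_aff w), map_vert]

theorem sd_bd (c : SingChain Y) : sd (bd c) = bd (sd c) := by
  suffices h : sd ∘ₗ bd = (bd ∘ₗ sd : SingChain Y →ₗ[ℤ] SingChain Y) from LinearMap.congr_fun h c
  refine hom_ext fun k σ => ?_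
  simp only [LinearMap.comp_apply]
  rw [← realize_vert, ← realize_bd, sd_realize, sd_realize, ← realize_bd, LinChain.sd_bd]

theorem bd_sdHomotopy (c : SingChain Y) : bd (sdHomotopy c) + sdHomotopy (bd c) = c - sd c := by
  suffices h : bd ∘ₗ sdHomotopy + sdHomotopy ∘ₗ bd =
    (LinearMap.id - sd : SingChain Y →ₗ[ℤ] SingChain Y) from LinearMap.congr_fun h c
  refine hom_ext fun k σ => ?_
  simp only [LinearMap.comp_apply, LinearMap.add_apply, LinearMap.sub_apply, LinearMap.id_apply]
  rw [← realize_vert, ← realize_bd, sdHomotopy_realize, sdHomotopy_realize, sd_realize,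
    ← realize_bd, ← map_add, LinChain.bd_sdHomotopy, map_sub]

/-! ### The chain homotopy of a homotopy -/

/-- The map of the prism over `s` given by a map `f` of `s` and a homotopy `h`. -/
def cylMap (h : C(Y × unitInterval, Z)) (f : C(s, Y)) : C(↥(s ×ˢ Set.Icc (0 : ℝ) 1), Z) where
  toFun p := h (f ⟨p.1.1, p.2.1⟩, ⟨p.1.2, p.2.2⟩)
  continuous_toFun := by fun_prop

/-- The chain homotopy induced by a homotopy. -/
def htpy (h : C(Y × unitInterval, Z)) : SingChain Y →ₗ[ℤ] SingChain Z :=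
  lift fun k σ => realize (cylMap h σ) (LinChain.prism (vert k))

omit [NormedSpace ℝ E] [NormedSpace ℝ E'] [Fact (Convex ℝ s)] [Fact (Convex ℝ s')] in
theorem continuous_cyl (φ : C(s, s')) : Continuous (LinChain.cyl φ) := by
  unfold LinChain.cyl
  fun_prop

theorem isAffine_cyl {φ : s → s'} (hφ : IsAffine φ) : IsAffine (LinChain.cyl φ) := by
  intro k w t
  refine Subtype.ext (Prod.ext ?_ ?_)
  · rw [LinChain.fst_aff]
    refine Eq.trans ?_ (congrArg Subtype.val
      (hφ k (fun i => ⟨(w i).1.1, (w i).2.1⟩) t))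
    exact congrArg (fun x => (φ x : E')) (Subtype.ext (LinChain.fst_aff w t))
  · rw [LinChain.snd_aff]
    exact LinChain.snd_aff w t

theorem htpy_realize (h : C(Y × unitInterval, Z)) (f : C(s, Y)) (c : LinChain s) :
    htpy h (realize f c) = realize (cylMap h f) (LinChain.prism c) := by
  suffices H : htpy h ∘ₗ realize f = realize (cylMap h f) ∘ₗ LinChain.prism from
    LinearMap.congr_fun H c
  refine LinChain.hom_ext fun k w => ?_
  simp only [LinearMap.comp_apply, realize_tup, htpy, lift_sx]
  rw [← map_vert w, ← LinChain.map_prism (isAffine_aff w)]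
  exact (realize_map (cylMap h f) ⟨_, continuous_cyl (aff w)⟩
    (isAffine_cyl (isAffine_aff w)) _).symm

/-- A homotopy at a given time. -/
def atTime (h : C(Y × unitInterval, Z)) (a : unitInterval) : C(Y, Z) :=
  h.comp ⟨fun y => (y, a), by fun_prop⟩

theorem bd_htpy (h : C(Y × unitInterval, Z)) (c : SingChain Y) :
    bd (htpy h c) + htpy h (bd c) = push (atTime h 1) c - push (atTime h 0) c := by
  suffices H : bd ∘ₗ htpy h + htpy h ∘ₗ bd = push (atTime h 1) - push (atTime h 0) from
    LinearMap.congr_fun H c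
  refine hom_ext fun k σ => ?_
  have hslice (a : unitInterval) :
      realize (cylMap h σ) (LinChain.map (LinChain.slice a) (vert k)) =
        push (atTime h a) (sx σ) := by
    have haff : IsAffine (LinChain.slice a : stdSimplex ℝ (Fin k) → _) := by
      intro l w t
      refine Subtype.ext (Prod.ext ?_ ?_)
      · rw [LinChain.fst_aff]; rfl
      · rw [LinChain.snd_aff, coe_aff]
        simp only [Function.comp_apply, LinChain.slice, ← Finset.sum_smul]
        rw [stdSimplex.sum_eq_one, one_smul]
    have hc : Continuous (LinChain.slice a : stdSimplex ℝ (Fin k) → _) := by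
      unfold LinChain.slice
      fun_prop
    have h1 := realize_map (cylMap h σ) ⟨_, hc⟩ haff (vert k)
    rw [realize_vert] at h1
    rw [push_sx]
    exact h1
  simp only [LinearMap.comp_apply, LinearMap.add_apply, LinearMap.sub_apply]
  rw [← hslice, ← hslice, ← map_sub, ← LinChain.bd_prism, map_add, realize_bd, ← htpy_realize,
    ← htpy_realize, realize_bd, realize_vert]

/-! ### Chains supported in a subset -/

/-- The chains of a subset. -/
def sub (A : Set Y) : Submodule ℤ (SingChain Y) := Finsupp.supported ℤ ℤ {x | Set.range x.2 ⊆ A}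

theorem sx_mem_sub {A : Set Y} {k : ℕ} {σ : C(stdSimplex ℝ (Fin k), Y)} (h : Set.range σ ⊆ A) :
    sx σ ∈ sub A := Finsupp.single_mem_supported ℤ 1 h

theorem sub_le_iff {A : Set Y} {Q : Submodule ℤ (SingChain Y)} :
    sub A ≤ Q ↔ ∀ k (σ : C(stdSimplex ℝ (Fin k), Y)), Set.range σ ⊆ A → sx σ ∈ Q := by
  refine ⟨fun h k σ hσ => h (sx_mem_sub hσ), fun h => ?_⟩
  rw [sub, Finsupp.supported_eq_span_single (R := ℤ), Submodule.span_le]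
  rintro _ ⟨x, hx, rfl⟩
  exact h x.1 x.2 hx

theorem map_mem_of_mem_sub {A : Set Y} {M : Type*} [AddCommGroup M] [Module ℤ M] {Q : Submodule ℤ M}
    {f : SingChain Y →ₗ[ℤ] M}
    (h : ∀ k (σ : C(stdSimplex ℝ (Fin k), Y)), Set.range σ ⊆ A → f (sx σ) ∈ Q)
    {c : SingChain Y} (hc : c ∈ sub A) : f c ∈ Q := by
  have h' : sub A ≤ Q.comap f := by
    rw [sub, Finsupp.supported_eq_span_single (R := ℤ), Submodule.span_le]
    rintro _ ⟨x, hx, rfl⟩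
    exact h x.1 x.2 hx
  exact h' hc

theorem sub_mono {A B : Set Y} (h : A ⊆ B) : sub A ≤ sub B :=
  Finsupp.supported_mono fun _ hx => hx.trans h

theorem mem_sub_univ (c : SingChain Y) : c ∈ sub Set.univ := by
  simp [sub]

theorem mem_sub_inter {A B : Set Y} {c : SingChain Y} (hA : c ∈ sub A) (hB : c ∈ sub B) :
    c ∈ sub (A ∩ B) := by
  rw [sub, Finsupp.mem_supported] at *
  exact fun x hx => Set.subset_inter (hA hx) (hB hx)

theorem realize_mem {A : Set Y} {f : C(s, Y)} (h : Set.range f ⊆ A) (c : LinChain s) :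
    realize f c ∈ sub A := by
  refine LinChain.lift_mem (P := Set.univ) (fun k w _ => ?_) (by simp)
  rw [realize_tup]
  refine sx_mem_sub ?_
  rintro _ ⟨t, rfl⟩
  exact h ⟨_, rfl⟩

theorem bd_mem {A : Set Y} {c : SingChain Y} (hc : c ∈ sub A) : bd c ∈ sub A :=
  map_mem_of_mem_sub (fun k σ hσ => by
    rw [← realize_vert, ← realize_bd]
    exact realize_mem hσ _) hc

theorem sd_mem {A : Set Y} {c : SingChain Y} (hc : c ∈ sub A) : sd c ∈ sub A :=
  map_mem_of_mem_sub (fun k σ hσ => by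
    rw [sd, lift_sx]
    exact realize_mem hσ _) hc

theorem sdHomotopy_mem {A : Set Y} {c : SingChain Y} (hc : c ∈ sub A) : sdHomotopy c ∈ sub A :=
  map_mem_of_mem_sub (fun k σ hσ => by
    rw [sdHomotopy, lift_sx]
    exact realize_mem hσ _) hc

theorem push_mem {A : Set Y} {B : Set Z} {f : C(Y, Z)} (h : Set.MapsTo f A B) {c : SingChain Y}
    (hc : c ∈ sub A) : push f c ∈ sub B :=
  map_mem_of_mem_sub (fun k σ hσ => by
    rw [push_sx]
    refine sx_mem_sub ?_
    rintro _ ⟨t, rfl⟩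
    exact h (hσ ⟨t, rfl⟩)) hc

theorem htpy_mem {A : Set Y} {B : Set Z} {h : C(Y × unitInterval, Z)}
    (H : ∀ y ∈ A, ∀ a, h (y, a) ∈ B) {c : SingChain Y} (hc : c ∈ sub A) : htpy h c ∈ sub B :=
  map_mem_of_mem_sub (fun k σ hσ => by
    rw [htpy, lift_sx]
    refine realize_mem ?_ _
    rintro _ ⟨p, rfl⟩
    exact H _ (hσ ⟨_, rfl⟩) _) hc

/-! ### The degree -/

/-- The chains all of whose simplices have `k` vertices. -/
def deg (k : ℕ) : Submodule ℤ (SingChain Y) := Finsupp.supported ℤ ℤ {x | x.1 = k}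

/-- The projection onto the chains all of whose simplices have `k` vertices. -/
def proj (k : ℕ) : SingChain Y →ₗ[ℤ] SingChain Y := lift fun l σ => if l = k then sx σ else 0

theorem sx_mem_deg {k : ℕ} (σ : C(stdSimplex ℝ (Fin k), Y)) : sx σ ∈ deg k :=
  Finsupp.single_mem_supported ℤ 1 rfl

theorem map_mem_of_mem_deg {k : ℕ} {M : Type*} [AddCommGroup M] [Module ℤ M] {Q : Submodule ℤ M}
    {f : SingChain Y →ₗ[ℤ] M}
    (h : ∀ (σ : C(stdSimplex ℝ (Fin k), Y)), f (sx σ) ∈ Q)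
    {c : SingChain Y} (hc : c ∈ deg k) : f c ∈ Q := by
  have h' : deg k ≤ Q.comap f := by
    rw [deg, Finsupp.supported_eq_span_single (R := ℤ), Submodule.span_le]
    rintro _ ⟨⟨_, σ⟩, rfl, rfl⟩
    exact h σ
  exact h' hc

theorem proj_mem_deg (k : ℕ) (c : SingChain Y) : proj k c ∈ deg k := by
  refine map_mem_of_mem_sub (A := Set.univ) (fun l σ _ => ?_) (mem_sub_univ c)
  rw [proj, lift_sx]
  split_ifs with h
  · subst h; exact sx_mem_deg σ
  · exact zero_mem _

theorem proj_of_mem_deg {k : ℕ} {c : SingChain Y} (hc : c ∈ deg k) : proj k c = c := by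
  have : (proj k - LinearMap.id : SingChain Y →ₗ[ℤ] SingChain Y) c ∈ (⊥ : Submodule ℤ (SingChain Y)) :=
    map_mem_of_mem_deg (fun σ => by simp [proj]) hc
  rwa [LinearMap.sub_apply, Submodule.mem_bot, sub_eq_zero] at this

theorem proj_mem_sub {A : Set Y} (k : ℕ) {c : SingChain Y} (hc : c ∈ sub A) : proj k c ∈ sub A := by
  refine map_mem_of_mem_sub (fun l σ hσ => ?_) hc
  rw [proj, lift_sx]
  split_ifs with h
  · exact sx_mem_sub hσ
  · exact zero_mem _

theorem push_mem_deg (f : C(Y, Z)) {k : ℕ} {c : SingChain Y} (hc : c ∈ deg k) :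
    push f c ∈ deg k :=
  map_mem_of_mem_deg (fun σ => by rw [push_sx]; exact sx_mem_deg _) hc

theorem bd_proj (k : ℕ) (c : SingChain Y) : bd (proj (k + 1) c) = proj k (bd c) := by
  suffices h : bd ∘ₗ proj (k + 1) = proj k ∘ₗ (bd : SingChain Y →ₗ[ℤ] SingChain Y) from
    LinearMap.congr_fun h c
  refine hom_ext fun l σ => ?_
  simp only [LinearMap.comp_apply, proj, lift_sx]
  cases l with
  | zero => simp [bd_sx_zero]
  | succ l =>
    rw [bd_sx_succ]
    by_cases h : l = k
    · simp [h, bd_sx_succ]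
    · simp [h]

end SingChain

end SingularChains

end

end Bredon

namespace Bredon

noncomputable section

namespace SingChain

variable {Y Z : Type*} [TopologicalSpace Y] [TopologicalSpace Z]

/-! ### Small simplices -/

theorem iterate_sd_mem {A : Set Y} {c : SingChain Y} (hc : c ∈ sub A) (m : ℕ) :
    sd^[m] c ∈ sub A := by
  induction m generalizing c with
  | zero => exact hc
  | succ m ih => exact ih (sd_mem hc)

theorem iterate_sd_bd (c : SingChain Y) (m : ℕ) : sd^[m] (bd c) = bd (sd^[m] c) := by
  induction m generalizing c with
  | zero => rfl
  | succ m ih => rw [Function.iterate_succ_apply, sd_bd, ih]; rfl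

/-- The homotopies telescope: if `T` serves `m` subdivisions, then `T ∘ₗ sd + sdHomotopy` serves one
more. That `T` respects every subset is what makes it usable in relative homology. -/
theorem exists_iterate_sdHomotopy (m : ℕ) : ∃ T : SingChain Y →ₗ[ℤ] SingChain Y,
    (∀ c, bd (T c) + T (bd c) = c - sd^[m] c) ∧ ∀ (A : Set Y), ∀ c ∈ sub A, T c ∈ sub A := by
  induction m with
  | zero => exact ⟨0, fun c => by simp, fun A c _ => zero_mem _⟩
  | succ m ih =>
    obtain ⟨T, hT, hTA⟩ := ih
    refine ⟨T ∘ₗ sd + sdHomotopy, fun c => ?_, fun A c hc =>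
      add_mem (hTA A _ (sd_mem hc)) (sdHomotopy_mem hc)⟩
    have h1 := hT (sd c)
    have h2 := bd_sdHomotopy c
    simp only [LinearMap.add_apply, LinearMap.comp_apply, map_add, sd_bd,
      Function.iterate_succ_apply]
    calc _ = (bd (T (sd c)) + T (bd (sd c))) + (bd (sdHomotopy c) + sdHomotopy (bd c)) := by abel
      _ = _ := by rw [h1, h2]; abel

/-- Take a Lebesgue number of the cover pulled back to the standard simplex. Once the mesh is
smaller, the vertices of each piece lie in a ball about the first one that is contained in a member
of the cover, and convexity puts the whole piece there. The conclusion for all large `m'` permits a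
common choice for finite sums. -/
theorem exists_iterate_sd_sx_mem {ι : Type*} [Nonempty ι] {U : ι → Set Y} (hU : ∀ i, IsOpen (U i))
    {k : ℕ} {σ : C(stdSimplex ℝ (Fin k), Y)} (hσ : Set.range σ ⊆ ⋃ i, U i) :
    ∃ m, ∀ m' ≥ m, sd^[m'] (sx σ) ∈ ⨆ i, sub (U i) := by
  obtain ⟨δ, hδ, H⟩ := lebesgue_number_lemma_of_metric (isCompact_univ (X := stdSimplex ℝ (Fin k)))
    (c := fun i => σ ⁻¹' U i) (fun i => (hU i).preimage σ.continuous) (fun x _ => by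
      simpa using hσ ⟨x, rfl⟩)
  set d := Metric.diam (Set.univ : Set (stdSimplex ℝ (Fin k))) with hd
  have hr0 : 0 ≤ (k / (k + 1) : ℝ) := by positivity
  have hr1 : (k / (k + 1) : ℝ) < 1 := by rw [div_lt_one (by positivity)]; linarith
  have hlim : Filter.Tendsto (fun m : ℕ => (k / (k + 1) : ℝ) ^ m * d) Filter.atTop (𝓝 0) := by
    simpa using (tendsto_pow_atTop_nhds_zero_of_lt_one hr0 hr1).mul_const d
  obtain ⟨m, hm⟩ := Filter.eventually_atTop.mp (hlim.eventually (gt_mem_nhds hδ))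
  refine ⟨m, fun m' hm' => ?_⟩
  have hit (n : ℕ) (c : LinChain (stdSimplex ℝ (Fin k))) :
      sd^[n] (realize σ c) = realize σ (LinChain.sd^[n] c) := by
    induction n generalizing c with
    | zero => rfl
    | succ n ih => rw [Function.iterate_succ_apply, sd_realize, ih]; rfl
  rw [← realize_vert, hit]
  refine LinChain.lift_mem (fun l w hw => ?_) (LinChain.iterate_sd_mem_fine k d _ (fun i j =>
    Metric.dist_le_diam_of_mem isCompact_univ.isBounded (Set.mem_univ _) (Set.mem_univ _)) m')
  have hw' : ∀ i j : Fin l, dist (w i) (w j) < δ := fun i j => (hw.2 i j).trans_lt (hm m' hm')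
  rw [realize_tup]
  cases l with
  | zero =>
    -- The empty simplex lies in every member of the cover, but some member has to exist.
    refine Submodule.mem_iSup_of_mem (Classical.arbitrary ι) (sx_mem_sub ?_)
    rintro _ ⟨t, rfl⟩
    simpa using stdSimplex.sum_eq_one t
  | succ l =>
    obtain ⟨i, hi⟩ := H (w 0) (Set.mem_univ _)
    refine Submodule.mem_iSup_of_mem i (sx_mem_sub ?_)
    rintro _ ⟨t, rfl⟩
    refine hi ?_
    change (aff w t).1 ∈ Metric.ball (w 0).1 δ
    rw [coe_aff]
    exact (convex_ball _ _).sum_mem (fun j _ => stdSimplex.zero_le t j) (stdSimplex.sum_eq_one t)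
      fun j _ => hw' j 0

/-- Chains in a union of open sets become small after sufficiently many subdivisions. -/
theorem exists_iterate_sd_mem {ι : Type*} [Nonempty ι] {U : ι → Set Y} (hU : ∀ i, IsOpen (U i))
    {c : SingChain Y} (hc : c ∈ sub (⋃ i, U i)) : ∃ m, sd^[m] c ∈ ⨆ i, sub (U i) := by
  suffices h : ∃ m, ∀ m' ≥ m, sd^[m'] c ∈ ⨆ i, sub (U i) from
    h.imp fun m h => h m le_rfl
  rw [sub, Finsupp.supported_eq_span_single (R := ℤ)] at hc
  induction hc using Submodule.span_induction with
  | mem x hx =>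
    obtain ⟨⟨k, σ⟩, hσ, rfl⟩ := hx
    exact exists_iterate_sd_sx_mem hU hσ
  | zero => exact ⟨0, fun m' _ => by rw [iterate_map_zero]; exact zero_mem _⟩
  | add x y _ _ hx hy =>
    obtain ⟨m₁, h₁⟩ := hx
    obtain ⟨m₂, h₂⟩ := hy
    refine ⟨max m₁ m₂, fun m' hm' => ?_⟩
    rw [iterate_map_add]
    exact add_mem (h₁ _ (le_of_max_le_left hm')) (h₂ _ (le_of_max_le_right hm'))
  | smul a x _ hx =>
    obtain ⟨m, h⟩ := hx
    refine ⟨m, fun m' hm' => ?_⟩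
    rw [iterate_map_zsmul]
    exact Submodule.smul_mem _ _ (h m' hm')

/-! ### Bases of relative homology -/

/-- The chains which represent zero in the homology of `A` relative to `B`. -/
def relNull (A B : Set Y) : Submodule ℤ (SingChain Y) := (sub A).map bd ⊔ sub B

theorem mem_relNull {A B : Set Y} {c : SingChain Y} :
    c ∈ relNull A B ↔ ∃ w ∈ sub A, ∃ b ∈ sub B, bd w + b = c := by
  simp [relNull, Submodule.mem_sup]

theorem bd_add_mem_relNull {A B : Set Y} {w b : SingChain Y} (hw : w ∈ sub A) (hb : b ∈ sub B) :
    bd w + b ∈ relNull A B := mem_relNull.mpr ⟨w, hw, b, hb, rfl⟩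

theorem relNull_mono {A B A' B' : Set Y} (hA : A ⊆ A') (hB : B ⊆ B') :
    relNull A B ≤ relNull A' B' :=
  sup_le_sup (Submodule.map_mono (sub_mono hA)) (sub_mono hB)

/-- The relative cycles of `A` modulo `B`. -/
def relCycles (A B : Set Y) : Submodule ℤ (SingChain Y) := sub A ⊓ (sub B).comap bd

theorem relCycles_mono {A B A' B' : Set Y} (hA : A ⊆ A') (hB : B ⊆ B') :
    relCycles A B ≤ relCycles A' B' :=
  inf_le_inf (sub_mono hA) (Submodule.comap_mono (sub_mono hB))

theorem push_mem_relNull {A B : Set Y} {A' B' : Set Z} {f : C(Y, Z)} (hA : Set.MapsTo f A A')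
    (hB : Set.MapsTo f B B') {c : SingChain Y} (hc : c ∈ relNull A B) :
    push f c ∈ relNull A' B' := by
  obtain ⟨w, hw, b, hb, rfl⟩ := mem_relNull.mp hc
  rw [map_add, push_bd]
  exact bd_add_mem_relNull (push_mem hA hw) (push_mem hB hb)

theorem push_mem_relCycles {A B : Set Y} {A' B' : Set Z} {f : C(Y, Z)} (hA : Set.MapsTo f A A')
    (hB : Set.MapsTo f B B') {c : SingChain Y} (hc : c ∈ relCycles A B) :
    push f c ∈ relCycles A' B' :=
  ⟨push_mem hA hc.1, by
    have : bd (push f c) ∈ sub B' := push_bd f c ▸ push_mem hB hc.2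
    exact this⟩

/-- A family of relative cycles whose classes form a basis of the homology of `A` relative to
`B`. -/
structure IsRelBasis {J : Type*} (A B : Set Y) (τ : J → SingChain Y) : Prop where
  mem : ∀ j, τ j ∈ relCycles A B
  span : ∀ z ∈ relCycles A B, ∃ c : J →₀ ℤ, z - Finsupp.linearCombination ℤ τ c ∈ relNull A B
  indep : ∀ c : J →₀ ℤ, Finsupp.linearCombination ℤ τ c ∈ relNull A B → c = 0

/-- The hypotheses say, on representatives, that `F` induces an isomorphism of relative homology;
such a map carries bases to bases. -/
theorem IsRelBasis.map {J : Type*} {A B : Set Y} {A' B' : Set Z} {τ : J → SingChain Y}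
    (h : IsRelBasis A B τ) (F : SingChain Y →ₗ[ℤ] SingChain Z)
    (hF : ∀ z ∈ relCycles A B, F z ∈ relCycles A' B')
    (hF' : ∀ z ∈ relNull A B, F z ∈ relNull A' B')
    (hsurj : ∀ z' ∈ relCycles A' B', ∃ z ∈ relCycles A B, z' - F z ∈ relNull A' B')
    (hinj : ∀ z ∈ relCycles A B, F z ∈ relNull A' B' → z ∈ relNull A B) :
    IsRelBasis A' B' (fun j => F (τ j)) := by
  have hcomb (c : J →₀ ℤ) : Finsupp.linearCombination ℤ (fun j => F (τ j)) c =
      F (Finsupp.linearCombination ℤ τ c) := by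
    simp [Finsupp.linearCombination_apply, Finsupp.sum, map_sum]
  refine ⟨fun j => hF _ (h.mem j), fun z' hz' => ?_, fun c hc => ?_⟩
  · obtain ⟨z, hz, hzz⟩ := hsurj z' hz'
    obtain ⟨c, hc⟩ := h.span z hz
    refine ⟨c, ?_⟩
    rw [hcomb, ← sub_add_sub_cancel z' (F z), ← map_sub]
    exact add_mem hzz (hF' _ hc)
  · rw [hcomb] at hc
    refine h.indep c (hinj _ ?_ hc)
    rw [Finsupp.linearCombination_apply]
    exact Submodule.sum_mem _ fun j _ => Submodule.smul_mem _ _ (h.mem j)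

/-! ### Invariance of relative bases under deformations. -/

section Deformation

variable {A B A' B' : Set Y} (h : C(Y × unitInterval, Y)) (h0 : ∀ y, h (y, 0) = y)

include h0

theorem push_sub_self_mem_relNull (hA : ∀ y ∈ A, ∀ a, h (y, a) ∈ A)
    (hB : ∀ y ∈ B, ∀ a, h (y, a) ∈ B) {z : SingChain Y} (hz : z ∈ relCycles A B) :
    push (atTime h 1) z - z ∈ relNull A B := by
  have e : atTime h 0 = ContinuousMap.id Y := ContinuousMap.ext h0
  have := bd_htpy h z
  rw [e, push_id] at this
  rw [← this]
  exact bd_add_mem_relNull (htpy_mem hA hz.1) (htpy_mem hB hz.2)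

variable (hAA' : A ⊆ A') (hBB' : B ⊆ B') (hA : ∀ y ∈ A, ∀ a, h (y, a) ∈ A)
  (hB : ∀ y ∈ B, ∀ a, h (y, a) ∈ B) (hA' : ∀ y ∈ A', ∀ a, h (y, a) ∈ A')
  (hB' : ∀ y ∈ B', ∀ a, h (y, a) ∈ B') (h1A : ∀ y ∈ A', h (y, 1) ∈ A)
  (h1B : ∀ y ∈ B', h (y, 1) ∈ B)

include hAA' hBB' hA hB hA' hB' h1A h1B

/-- The inclusion of the smaller pair is a homotopy equivalence of pairs: the end of the deformation
is an inverse, and the deformation preserves both pairs. -/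
theorem IsRelBasis.of_deformation {J : Type*} {τ : J → SingChain Y} (hτ : IsRelBasis A B τ) :
    IsRelBasis A' B' τ := by
  refine hτ.map LinearMap.id (fun z hz => relCycles_mono hAA' hBB' hz)
    (fun z hz => relNull_mono hAA' hBB' hz) (fun z' hz' => ?_) (fun z hz hz0 => ?_)
  · refine ⟨push (atTime h 1) z', push_mem_relCycles (f := atTime h 1) h1A h1B hz', ?_⟩
    rw [LinearMap.id_apply, ← neg_sub]
    exact neg_mem (push_sub_self_mem_relNull h h0 hA' hB' hz')
  · have h1 : push (atTime h 1) z ∈ relNull A B := push_mem_relNull (f := atTime h 1) h1A h1B hz0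
    have h2 := sub_mem h1 (push_sub_self_mem_relNull h h0 hA hB hz)
    rwa [sub_sub_cancel] at h2

/-- The same equivalence read backwards, so the classes are transported by the end of the
deformation. -/
theorem IsRelBasis.deformation {J : Type*} {τ : J → SingChain Y} (hτ : IsRelBasis A' B' τ) :
    IsRelBasis A B (fun j => push (atTime h 1) (τ j)) := by
  refine hτ.map (push (atTime h 1)) (fun z hz => push_mem_relCycles (f := atTime h 1) h1A h1B hz)
    (fun z hz => push_mem_relNull (f := atTime h 1) h1A h1B hz) (fun z hz => ?_) (fun z hz hz0 => ?_)
  · refine ⟨z, relCycles_mono hAA' hBB' hz, ?_⟩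
    rw [← neg_sub]
    exact neg_mem (push_sub_self_mem_relNull h h0 hA hB hz)
  · have h2 := sub_mem (relNull_mono hAA' hBB' hz0) (push_sub_self_mem_relNull h h0 hA' hB' hz)
    rwa [sub_sub_cancel] at h2

end Deformation

/-! ### Transport of relative bases along embeddings. -/

section Embedding

variable {A : Set Y} {f : C(Y, Z)} {g : Z → Y} (hg : ContinuousOn g (f '' A))
  (hgf : ∀ y ∈ A, g (f y) = y)

include hg hgf

theorem exists_push_eq {B : Set Y} (hBA : B ⊆ A) {c : SingChain Z} (hc : c ∈ sub (f '' B)) :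
    ∃ c' ∈ sub B, push f c' = c := by
  suffices h : sub (f '' B) ≤ (sub B).map (push f) by simpa using h hc
  refine sub_le_iff.mpr fun k σ hσ => ?_
  have hgB (t) : g (σ t) ∈ B := by
    obtain ⟨y, hy, hyt⟩ := hσ ⟨t, rfl⟩
    rw [← hyt, hgf y (hBA hy)]
    exact hy
  have hc : Continuous fun t => g (σ t) :=
    hg.comp_continuous σ.continuous fun t => Set.image_mono hBA (hσ ⟨t, rfl⟩)
  refine ⟨sx ⟨_, hc⟩, sx_mem_sub ?_, ?_⟩
  · rintro _ ⟨t, rfl⟩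
    exact hgB t
  · rw [push_sx]
    congr 1
    ext t
    obtain ⟨y, hy, hyt⟩ := hσ ⟨t, rfl⟩
    change f (g (σ t)) = σ t
    rw [← hyt, hgf y (hBA hy)]

omit hg in
theorem push_injOn {c : SingChain Y} (hc : c ∈ sub A) (h0 : push f c = 0) : c = 0 := by
  have hinj : Set.InjOn (fun x : Σ k, C(stdSimplex ℝ (Fin k), Y) =>
      (⟨x.1, f.comp x.2⟩ : Σ k, C(stdSimplex ℝ (Fin k), Z))) {x | Set.range x.2 ⊆ A} := by
    rintro ⟨k, σ⟩ hσ ⟨l, σ'⟩ hσ' hh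
    obtain rfl : k = l := congrArg Sigma.fst hh
    have hh' : f.comp σ = f.comp σ' := by simpa using hh
    congr 1
    ext t
    rw [← hgf _ (hσ ⟨t, rfl⟩), ← hgf _ (hσ' ⟨t, rfl⟩)]
    exact congrArg g (DFunLike.congr_fun hh' t)
  have hpush : push f c = Finsupp.mapDomain (fun x => ⟨x.1, f.comp x.2⟩) c := by
    suffices h : push f = Finsupp.lmapDomain ℤ ℤ (fun x => ⟨x.1, f.comp x.2⟩) from
      LinearMap.congr_fun h c
    refine hom_ext fun k σ => ?_
    rw [push_sx, sx, sx, Finsupp.lmapDomain_apply, Finsupp.mapDomain_single]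
  refine Finsupp.mapDomain_injOn _ hinj (Finsupp.mem_supported ℤ c |>.mp hc) (by simp) ?_
  rw [← hpush, h0, Finsupp.mapDomain_zero]

/-- Since `f` has a continuous inverse on the image of `A`, it induces bijections from the chains of
`A` and of `B` to those of their images. -/
theorem IsRelBasis.image {J : Type*} {B : Set Y} (hBA : B ⊆ A) {τ : J → SingChain Y}
    (hτ : IsRelBasis A B τ) : IsRelBasis (f '' A) (f '' B) (fun j => push f (τ j)) := by
  have key : ∀ c ∈ sub A, push f c ∈ sub (f '' B) → c ∈ sub B := by
    intro c hc hfc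
    obtain ⟨c', hc', hcc'⟩ := exists_push_eq hg hgf hBA hfc
    have : c - c' = 0 := push_injOn hgf (sub_mem hc (sub_mono hBA hc'))
      (by rw [map_sub, hcc', sub_self])
    rwa [sub_eq_zero.mp this]
  refine hτ.map (push f)
    (fun z hz => push_mem_relCycles (Set.mapsTo_image f A) (Set.mapsTo_image f B) hz)
    (fun z hz => push_mem_relNull (Set.mapsTo_image f A) (Set.mapsTo_image f B) hz)
    (fun z hz => ?_) (fun z hz hz0 => ?_)
  · obtain ⟨z', hz', rfl⟩ := exists_push_eq hg hgf subset_rfl hz.1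
    have h2 : bd (push f z') ∈ sub (f '' B) := hz.2
    rw [← push_bd] at h2
    exact ⟨z', ⟨hz', key _ (bd_mem hz') h2⟩, by simp⟩
  · obtain ⟨w, hw, b, hb, hwb⟩ := mem_relNull.mp hz0
    obtain ⟨w', hw', rfl⟩ := exists_push_eq hg hgf subset_rfl hw
    have : z - bd w' ∈ sub B := by
      refine key _ (sub_mem hz.1 (bd_mem hw')) ?_
      rw [map_sub, push_bd, ← hwb]
      simpa using hb
    simpa using bd_add_mem_relNull hw' this

end Embedding

/-! ### Excision -/

/-- Nonempty simplices of different summands lie in disjoint sets and cannot cancel, so each one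
survives in the sum. -/
theorem mem_sub_of_sum_mem {J : Type*} {V : J → Set Y} (hV : Pairwise (Function.onFun Disjoint V))
    {U : Set Y} {x : J → SingChain Y} (hx : ∀ j, x j ∈ sub (V j)) {S : Finset J}
    (hS : ∑ j ∈ S, x j ∈ sub U) {j : J} (hj : j ∈ S) : x j ∈ sub U := by
  rw [sub, Finsupp.mem_supported] at hS ⊢
  intro ς hς
  -- A point of the simplex is fixed before disjointness is used, because the empty simplex lies in
  -- all the sets at once.
  rintro _ ⟨t, rfl⟩
  have h0 : ∀ i ∈ S, i ≠ j → x i ς = 0 := by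
    intro i _ hij
    by_contra hne
    have hi : Set.range ς.2 ⊆ V i := (Finsupp.mem_supported ℤ _).mp (hx i) (by simpa using hne)
    have hj : Set.range ς.2 ⊆ V j := (Finsupp.mem_supported ℤ _).mp (hx j) hς
    exact (hV hij).le_bot ⟨hi ⟨t, rfl⟩, hj ⟨t, rfl⟩⟩
  refine hS (a := ς) ?_ ⟨t, rfl⟩
  rw [Finset.mem_coe, Finsupp.mem_support_iff, Finsupp.finsetSum_apply,
    Finset.sum_eq_single j h0 (fun h => absurd hj h)]
  simpa using hς

/-- Excision for a cover by an open set `U` and disjoint open sets `V j`. -/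
theorem IsRelBasis.excision {J : Type*} {V : J → Set Y} {U : Set Y} (hU : IsOpen U)
    (hVo : ∀ j, IsOpen (V j)) (hV : Pairwise (Function.onFun Disjoint V)) {τ : J → SingChain Y}
    (hτ : ∀ j, IsRelBasis (V j) (V j ∩ U) fun _ : Unit => τ j) :
    IsRelBasis (U ∪ ⋃ j, V j) U τ := by
  classical
  set A := U ∪ ⋃ j, V j with hA
  have hVA (j) : V j ⊆ A := fun x hx => Or.inr (Set.mem_iUnion.mpr ⟨j, hx⟩)
  -- Indexing the cover by `Option J` separates the part in `U` from finitely many parts in the sets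
  -- `V j`.
  have hsmall : ∀ c ∈ sub A, ∃ m, ∃ u ∈ sub U, ∃ v : J →₀ SingChain Y, (∀ j, v j ∈ sub (V j)) ∧
      sd^[m] c = u + ∑ j ∈ v.support, v j := by
    intro c hc
    have hA' : A = ⋃ i : Option J, i.elim U V := by
      rw [Set.iUnion_option]; rfl
    rw [hA'] at hc
    obtain ⟨m, hm⟩ := exists_iterate_sd_mem (U := fun i : Option J => i.elim U V)
      (fun i => by cases i <;> simp [hU, hVo]) hc
    rw [iSup_option, Submodule.mem_sup] at hm
    obtain ⟨u, hu, v, hv, huv⟩ := hm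
    obtain ⟨f, hf, rfl⟩ := (Submodule.mem_iSup_iff_exists_finsupp _ _).mp hv
    exact ⟨m, u, hu, f, hf, huv.symm⟩
  have hunit (j : J) (c : Unit →₀ ℤ) :
      Finsupp.linearCombination ℤ (fun _ : Unit => τ j) c = c () • τ j := by
    simp [Finsupp.linearCombination_apply, Finsupp.sum_fintype]
  have hτV (j) : τ j ∈ sub (V j) := ((hτ j).mem ()).1
  refine ⟨fun j => relCycles_mono (hVA j) Set.inter_subset_right ((hτ j).mem ()), ?_, ?_⟩
  · intro z hz
    obtain ⟨m, u, hu, v, hv, huv⟩ := hsmall z hz.1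
    obtain ⟨T, hT, hTA⟩ := exists_iterate_sdHomotopy (Y := Y) m
    have h1 : z - sd^[m] z ∈ relNull A U := by
      rw [← hT]
      exact bd_add_mem_relNull (hTA A _ hz.1) (hTA U _ hz.2)
    have h2 : ∑ j ∈ v.support, bd (v j) ∈ sub U := by
      have : ∑ j ∈ v.support, bd (v j) = sd^[m] (bd z) - bd u := by
        rw [iterate_sd_bd, huv, map_add, map_sum]
        abel
      rw [this]
      exact sub_mem (iterate_sd_mem hz.2 m) (bd_mem hu)
    -- Only the sum of the boundaries is known to lie in `U`; disjointness of the sets `V j` gives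
    -- this for each summand.
    have h3 : ∀ j, v j ∈ relCycles (V j) (V j ∩ U) := by
      intro j
      by_cases hj : j ∈ v.support
      · exact ⟨hv j, mem_sub_inter (bd_mem (hv j))
          (mem_sub_of_sum_mem hV (fun j => bd_mem (hv j)) h2 hj)⟩
      · rw [Finsupp.notMem_support_iff.mp hj]
        exact zero_mem _
    choose c hc using fun j => (hτ j).span (v j) (h3 j)
    -- The chosen coefficients may be nonzero even where `v j = 0`, so they are cut off to be
    -- finitely supported.
    refine ⟨Finsupp.onFinset v.support (fun j => if j ∈ v.support then c j () else 0)
      (fun j hj => by by_contra h; simp [h] at hj), ?_⟩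
    rw [Finsupp.linearCombination_apply, Finsupp.onFinset_sum _ (by simp)]
    have h4 : z - ∑ j ∈ v.support, (if j ∈ v.support then c j () else 0) • τ j =
        (z - sd^[m] z) + u + ∑ j ∈ v.support, (v j - c j () • τ j) := by
      rw [huv, Finset.sum_sub_distrib]
      rw [Finset.sum_congr rfl fun j hj => by rw [if_pos hj]]
      abel
    rw [h4]
    refine add_mem (add_mem h1 (by simpa using bd_add_mem_relNull (zero_mem (sub A)) hu))
      (Submodule.sum_mem _ fun j _ => relNull_mono (B := V j ∩ U) (hVA j) Set.inter_subset_right ?_)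
    simpa only [hunit] using hc j
  · intro c hc
    obtain ⟨w, hw, u, hu, hwu⟩ := mem_relNull.mp hc
    obtain ⟨m, u', hu', v, hv, huv⟩ := hsmall w hw
    obtain ⟨T, hT, hTA⟩ := exists_iterate_sdHomotopy (Y := Y) m
    set S := c.support ∪ v.support with hS
    have hcS : Finsupp.linearCombination ℤ τ c = ∑ j ∈ S, c j • τ j := by
      rw [Finsupp.linearCombination_apply]
      exact Finsupp.sum_of_support_subset _ Finset.subset_union_left _ (by simp)
    have hvS : ∑ j ∈ v.support, v j = ∑ j ∈ S, v j :=
      Finset.sum_subset Finset.subset_union_right fun j _ hj => Finsupp.notMem_support_iff.mp hj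
    have e1 : bd w = bd (sd^[m] w) + bd (T (bd w)) := by
      have := congrArg bd (hT w)
      rw [map_add, bd_bd, zero_add, map_sub] at this
      rw [this]; abel
    have e2 : bd w = ∑ j ∈ S, c j • τ j - u := by rw [← hcS, ← hwu]; abel
    -- Subdividing `w` alters its boundary by the boundary of `T (bd w)`. Distributing this
    -- correction as `c j • T (τ j)` over the pieces `v j` compares the given combination, rather
    -- than its subdivision, with boundaries inside the sets `V j`.
    have e3 : ∑ j ∈ S, (c j • τ j - bd (v j + c j • T (τ j))) = u + bd u' - bd (T u) := by
      have e4 : bd (T (bd w)) = ∑ j ∈ S, bd (c j • T (τ j)) - bd (T u) := by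
        rw [e2]
        simp only [map_sub, map_sum, map_zsmul]
      have e5 : bd (sd^[m] w) = bd u' + ∑ j ∈ S, bd (v j) := by rw [huv, hvS, map_add, map_sum]
      have e6 : ∑ j ∈ S, c j • τ j = u + bd w := by rw [e2]; abel
      simp only [map_add, Finset.sum_sub_distrib, Finset.sum_add_distrib]
      rw [e6, e1, e4, e5]
      abel
    have e7 : ∑ j ∈ S, (c j • τ j - bd (v j + c j • T (τ j))) ∈ sub U := by
      rw [e3]
      exact sub_mem (add_mem hu (bd_mem hu')) (bd_mem (hTA U _ hu))
    have hw' : ∀ j, v j + c j • T (τ j) ∈ sub (V j) := fun j =>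
      add_mem (hv j) (Submodule.smul_mem _ _ (hTA _ _ (hτV j)))
    have e8 : ∀ j, c j • τ j - bd (v j + c j • T (τ j)) ∈ sub (V j) := fun j =>
      sub_mem (Submodule.smul_mem _ _ (hτV j)) (bd_mem (hw' j))
    ext j
    by_cases hj : j ∈ S
    · have h1 := mem_sub_inter (e8 j) (mem_sub_of_sum_mem hV e8 e7 hj)
      have h2 := bd_add_mem_relNull (hw' j) h1
      rw [add_sub_cancel] at h2
      have h3 := (hτ j).indep (Finsupp.single () (c j)) (by rw [hunit]; simpa using h2)
      simpa using DFunLike.congr_fun h3 ()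
    · have : j ∉ c.support := fun h => hj (Finset.mem_union_left _ h)
      simpa using this

end SingChain

end

end Bredon

namespace Bredon

noncomputable section

namespace SingChain

/-! ### The homology of a ball relative to its outer part -/

section Point

variable {Y : Type*} [TopologicalSpace Y] [Inhabited Y] [Subsingleton Y]

/-- The cone operator for a one-point space. -/
def pointCone : SingChain Y →ₗ[ℤ] SingChain Y :=
  lift fun k _ => sx (ContinuousMap.const (stdSimplex ℝ (Fin (k + 1))) default)

/-- All simplices of a one-point space are constant, so adding a vertex contracts the augmented
complex. -/
theorem bd_pointCone (c : SingChain Y) : bd (pointCone c) + pointCone (bd c) = c := by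
  suffices h : bd ∘ₗ pointCone + pointCone ∘ₗ bd =
    (LinearMap.id : SingChain Y →ₗ[ℤ] SingChain Y) from LinearMap.congr_fun h c
  refine hom_ext fun k σ => ?_
  have hsub {l : ℕ} (σ' : C(stdSimplex ℝ (Fin l), Y)) : σ' = ContinuousMap.const _ default :=
    ContinuousMap.ext fun _ => Subsingleton.elim _ _
  simp only [LinearMap.add_apply, LinearMap.comp_apply, LinearMap.id_apply]
  cases k with
  | zero =>
    rw [bd_sx_zero, pointCone, lift_sx, bd_sx_succ, hsub σ]
    simp [hsub]
  | succ k =>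
    rw [bd_sx_succ, pointCone, lift_sx, bd_sx_succ, Fin.sum_univ_succ]
    simp only [map_sum, map_zsmul, lift_sx, Fin.val_succ, pow_succ, Fin.val_zero, pow_zero]
    simp only [mul_neg, mul_one, one_smul, neg_smul, Finset.sum_neg_distrib]
    rw [hsub σ]
    exact neg_add_cancel_right _ _

/-- The chains of the empty set are the multiples of the empty simplex, so passing to the pair with
`∅` undoes the augmentation. The contraction makes a relative cycle homologous to the cone over its
boundary, a multiple of the point. The coefficient is detected by the boundary, since that of the
point is the empty simplex. -/
theorem isRelBasis_point : IsRelBasis (Set.univ : Set Y) ∅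
    fun _ : Unit => sx (ContinuousMap.const (stdSimplex ℝ (Fin 1)) default) := by
  set τ : SingChain Y := sx (ContinuousMap.const (stdSimplex ℝ (Fin 1)) default) with hτ
  have hempty : ∀ k (σ : C(stdSimplex ℝ (Fin k), Y)), Set.range σ ⊆ ∅ → k = 0 := by
    intro k σ hσ
    by_contra hk
    obtain ⟨l, rfl⟩ := Nat.exists_eq_succ_of_ne_zero hk
    exact hσ ⟨stdSimplex.vertex 0, rfl⟩
  have hbd : ∀ b : SingChain Y, b ∈ sub ∅ → bd b = 0 := fun b hb => by
    have : bd b ∈ (⊥ : Submodule ℤ (SingChain Y)) := map_mem_of_mem_sub (fun k σ hσ => by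
      obtain rfl := hempty k σ hσ
      rw [bd_sx_zero]
      exact zero_mem _) hb
    simpa using this
  have hcone : ∀ b : SingChain Y, b ∈ sub ∅ → pointCone b ∈ Submodule.span ℤ {τ} := fun b hb =>
    map_mem_of_mem_sub (fun k σ hσ => by
      obtain rfl := hempty k σ hσ
      rw [pointCone, lift_sx]
      exact Submodule.mem_span_singleton_self _) hb
  have hbdτ : bd τ = sx (ContinuousMap.const (stdSimplex ℝ (Fin 0)) default) := by
    rw [hτ, bd_sx_succ]
    simp only [Nat.reduceAdd, Finset.univ_unique, Finset.sum_singleton, Fin.default_eq_zero,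
      Fin.val_zero, pow_zero, one_smul]
    rfl
  have hunit (c : Unit →₀ ℤ) :
      Finsupp.linearCombination ℤ (fun _ : Unit => τ) c = c () • τ := by
    simp [Finsupp.linearCombination_apply, Finsupp.sum_fintype]
  refine ⟨fun _ => ⟨mem_sub_univ _, ?_⟩, fun z hz => ?_, fun c hc => ?_⟩
  · change bd τ ∈ sub ∅
    rw [hbdτ]
    refine sx_mem_sub ?_
    rintro _ ⟨t, rfl⟩
    simpa using stdSimplex.sum_eq_one t
  · obtain ⟨a, ha⟩ := Submodule.mem_span_singleton.mp (hcone _ hz.2)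
    refine ⟨Finsupp.single () a, ?_⟩
    rw [hunit, Finsupp.single_eq_same, ha]
    have := bd_add_mem_relNull (mem_sub_univ (pointCone z)) (zero_mem (sub (∅ : Set Y)))
    convert this using 1
    rw [add_zero]
    nth_rewrite 1 [← bd_pointCone z]
    rw [add_sub_cancel_right]
  · obtain ⟨w, -, b, hb, hwb⟩ := mem_relNull.mp hc
    rw [hunit] at hwb
    have h := congrArg bd hwb
    rw [map_add, bd_bd, hbd b hb, map_zsmul, hbdτ, add_zero] at h
    ext
    by_contra hne
    have h' := DFunLike.congr_fun h ⟨0, ContinuousMap.const (stdSimplex ℝ (Fin 0)) default⟩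
    simp only [sx, Finsupp.smul_apply, Finsupp.single_eq_same] at h'
    exact hne (by simpa using h'.symm)

end Point

/-! ### The homology of `ℝⁿ` relative to the complement of a cube. -/

theorem lt_norm_iff {n : ℕ} {r : ℝ} (hr : 0 ≤ r) (x : Fin (n + 1) → ℝ) :
    r < ‖x‖ ↔ r < ‖Fin.tail x‖ ∨ r < |x 0| := by
  rw [← not_iff_not]
  push Not
  rw [pi_norm_le_iff_of_nonneg hr, pi_norm_le_iff_of_nonneg hr, Fin.forall_fin_succ, and_comm]
  rfl

/-- If the homology of `R` relative to `V` vanishes, then the boundary identifies the homology of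
`R` relative to `P` with the homology of `P` relative to `V`. -/
theorem IsRelBasis.of_triple {Y J : Type*} [TopologicalSpace Y] {R P V : Set Y} (hPR : P ⊆ R)
    (hVP : V ⊆ P) (h0 : relCycles R V ≤ relNull R V) {τ : J → SingChain Y}
    (hτ : IsRelBasis P V τ) {w : J → SingChain Y} (hw : ∀ j, w j ∈ sub R)
    (hwτ : ∀ j, τ j - bd (w j) ∈ sub V) : IsRelBasis R P w := by
  have hcomb (c : J →₀ ℤ) : Finsupp.linearCombination ℤ τ c -
      bd (Finsupp.linearCombination ℤ w c) ∈ sub V := by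
    simp only [Finsupp.linearCombination_apply, Finsupp.sum, map_sum, map_zsmul,
      ← Finset.sum_sub_distrib, ← smul_sub]
    exact Submodule.sum_mem _ fun j _ => Submodule.smul_mem _ _ (hwτ j)
  have hcw (c : J →₀ ℤ) : Finsupp.linearCombination ℤ w c ∈ sub R := by
    rw [Finsupp.linearCombination_apply]
    exact Submodule.sum_mem _ fun j _ => Submodule.smul_mem _ _ (hw j)
  have hsub (z : SingChain Y) (hz : z ∈ sub R) (hz' : bd z ∈ relNull P V) : z ∈ relNull R P := by
    obtain ⟨p, hp, a, ha, hpa⟩ := mem_relNull.mp hz'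
    have h1 : z - p ∈ relCycles R V := by
      refine ⟨sub_mem hz (sub_mono hPR hp), ?_⟩
      have : bd (z - p) ∈ sub V := by
        rw [map_sub, ← hpa, add_sub_cancel_left]
        exact ha
      exact this
    have h2 := relNull_mono subset_rfl hVP (h0 h1)
    have h3 : p ∈ relNull R P := by simpa using bd_add_mem_relNull (zero_mem (sub R)) hp
    simpa using add_mem h2 h3
  refine ⟨fun j => ⟨hw j, ?_⟩, fun z hz => ?_, fun c hc => ?_⟩
  · have : bd (w j) ∈ sub P := by
      simpa using sub_mem (hτ.mem j).1 (sub_mono hVP (hwτ j))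
    exact this
  · obtain ⟨c, hc⟩ := hτ.span (bd z) ⟨hz.2, by
      have : bd (bd z) ∈ sub V := by rw [bd_bd]; exact zero_mem _
      exact this⟩
    refine ⟨c, hsub _ (sub_mem hz.1 (hcw c)) ?_⟩
    have h1 : Finsupp.linearCombination ℤ τ c - bd (Finsupp.linearCombination ℤ w c) ∈
        relNull P V := by simpa using bd_add_mem_relNull (zero_mem (sub P)) (hcomb c)
    rw [map_sub]
    simpa using add_mem hc h1
  · obtain ⟨v, hv, p, hp, hvp⟩ := mem_relNull.mp hc
    refine hτ.indep c ?_
    have h1 : bd (Finsupp.linearCombination ℤ w c) = bd p := by rw [← hvp, map_add, bd_bd, zero_add]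
    have h2 := bd_add_mem_relNull hp (hcomb c)
    rwa [h1, add_sub_cancel] at h2

theorem continuous_finCons {T : Type*} [TopologicalSpace T] {n : ℕ} {f : T → ℝ}
    {g : T → Fin n → ℝ} (hf : Continuous f) (hg : Continuous g) :
    Continuous fun t => (Fin.cons (f t) (g t) : Fin (n + 1) → ℝ) :=
  continuous_pi fun i => Fin.cases hf (fun i => (continuous_apply i).comp hg) i

theorem continuous_finTail (n : ℕ) :
    Continuous (Fin.tail : (Fin (n + 1) → ℝ) → Fin n → ℝ) :=
  continuous_pi fun i => continuous_apply i.succ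

/-- The translation upwards which moves the whole space into the upper part. -/
def liftUp (n : ℕ) : C((Fin (n + 1) → ℝ) × unitInterval, Fin (n + 1) → ℝ) :=
  ⟨fun p => Fin.cons (p.1 0 + p.2 * (1 + |p.1 0|)) (Fin.tail p.1),
    continuous_finCons (by fun_prop) ((continuous_finTail n).comp continuous_fst)⟩

/-- The upward translation preserves the upper part and ends inside it, because `x 0 + 1 + |x 0|` is
at least one. Hence the homology of the whole space relative to the upper part vanishes. -/
theorem relCycles_le_relNull_upper (n : ℕ) :
    relCycles Set.univ {x : Fin (n + 1) → ℝ | 1 / 2 < ‖Fin.tail x‖ ∨ 1 / 2 < x 0} ≤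
      relNull Set.univ {x | 1 / 2 < ‖Fin.tail x‖ ∨ 1 / 2 < x 0} := by
  set V : Set (Fin (n + 1) → ℝ) := {x | 1 / 2 < ‖Fin.tail x‖ ∨ 1 / 2 < x 0} with hV
  have hk0 (x a) : liftUp n (x, a) 0 = x 0 + (a : ℝ) * (1 + |x 0|) := rfl
  have hk1 (x a) : Fin.tail (liftUp n (x, a)) = Fin.tail x := Fin.tail_cons _ _
  have hid (x) : liftUp n (x, 0) = x := by
    rw [← Fin.cons_self_tail (liftUp n (x, 0)), hk0, hk1]
    simp
  have hmem : ∀ x ∈ V, ∀ a, liftUp n (x, a) ∈ V := by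
    intro x hx a
    obtain hx | hx := hx
    · exact Or.inl (by rwa [hk1])
    · refine Or.inr ?_
      rw [hk0]
      have h1 : 0 ≤ (a : ℝ) * (1 + |x 0|) := mul_nonneg a.2.1 (by positivity)
      linarith
  have h1mem (x) : liftUp n (x, 1) ∈ V := by
    refine Or.inr ?_
    rw [hk0]
    have := neg_abs_le (x 0)
    simp only [Set.Icc.coe_one]
    linarith
  intro z hz
  have e1 := push_sub_self_mem_relNull (liftUp n) hid (A := Set.univ) (B := V)
    (fun _ _ _ => trivial) hmem hz
  have e2 : push (atTime (liftUp n) 1) z ∈ sub V := push_mem (fun x _ => h1mem x) hz.1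
  have e3 : push (atTime (liftUp n) 1) z ∈ relNull Set.univ V := by
    simpa using bd_add_mem_relNull (zero_mem (sub Set.univ)) e2
  simpa using sub_mem e3 e1

/-- In the supremum norm the outer region of `ℝⁿ⁺¹` is the union of a lower part `U` and an upper
part `V`, which meet where the last `n` coordinates are already outside. The pair `(U, U ∩ V)`
deforms to a slice that is a copy of the pair one dimension lower. Excision passes from there to `(U
∪ V, V)`. As the homology of the whole space relative to `V` vanishes, the boundary of the triple
raises the degree by one. -/
theorem exists_isRelBasis_outer (n : ℕ) : ∃ τ : SingChain (Fin n → ℝ), τ ∈ deg (n + 1) ∧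
    IsRelBasis Set.univ {x : Fin n → ℝ | 1 / 2 < ‖x‖} fun _ : Unit => τ := by
  induction n with
  | zero =>
    refine ⟨sx (ContinuousMap.const (stdSimplex ℝ (Fin 1)) default), sx_mem_deg _, ?_⟩
    have h : {x : Fin 0 → ℝ | 1 / 2 < ‖x‖} = ∅ := by
      refine Set.eq_empty_of_forall_notMem fun x (hx : 1 / 2 < ‖x‖) => ?_
      rw [Subsingleton.elim x 0, norm_zero] at hx
      linarith
    rw [h]
    exact isRelBasis_point (Y := Fin 0 → ℝ)
  | succ n ih =>
    obtain ⟨τ, hτd, hτ⟩ := ih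
    set W : Set (Fin n → ℝ) := {x | 1 / 2 < ‖x‖} with hW
    set U : Set (Fin (n + 1) → ℝ) := {x | 1 / 2 < ‖Fin.tail x‖ ∨ x 0 < -(1 / 2)} with hU
    set V : Set (Fin (n + 1) → ℝ) := {x | 1 / 2 < ‖Fin.tail x‖ ∨ 1 / 2 < x 0} with hV
    have htail := continuous_finTail n
    have hUo : IsOpen U := (isOpen_lt continuous_const htail.norm).union
      (isOpen_lt (continuous_apply 0) continuous_const)
    have hVo : IsOpen V := (isOpen_lt continuous_const htail.norm).union
      (isOpen_lt continuous_const (continuous_apply 0))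
    have hUV : {x : Fin (n + 1) → ℝ | 1 / 2 < ‖x‖} = V ∪ ⋃ _ : Unit, U := by
      rw [Set.iUnion_const]
      ext x
      simp only [Set.mem_ofPred_eq, Set.mem_union, hU, hV, lt_norm_iff (by norm_num : (0 : ℝ) ≤ 1 / 2),
        lt_abs, lt_neg]
      tauto
    have hint (x : Fin (n + 1) → ℝ) : x ∈ U ∩ V ↔ 1 / 2 < ‖Fin.tail x‖ := by
      simp only [Set.mem_inter_iff, Set.mem_ofPred_eq, hU, hV]
      constructor
      · rintro ⟨h | h, h' | h'⟩ <;> first | assumption | linarith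
      · exact fun h => ⟨Or.inl h, Or.inl h⟩
    -- Any height below `-1/2` would put the slice inside `U`.
    let s : C(Fin n → ℝ, Fin (n + 1) → ℝ) := ⟨fun x => Fin.cons (-1) x,
      continuous_finCons continuous_const continuous_id⟩
    have hs0 (x) : s x 0 = -1 := rfl
    have hs1 (x) : Fin.tail (s x) = x := Fin.tail_cons _ _
    have h1 : IsRelBasis (s '' Set.univ) (s '' W) fun _ : Unit => push s τ :=
      hτ.image htail.continuousOn (fun x _ => hs1 x) (Set.subset_univ _)
    let h : C((Fin (n + 1) → ℝ) × unitInterval, Fin (n + 1) → ℝ) :=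
      ⟨fun p => Fin.cons ((1 - p.2) * p.1 0 - p.2) (Fin.tail p.1),
        continuous_finCons (by fun_prop) (htail.comp continuous_fst)⟩
    have hh0 (x a) : h (x, a) 0 = (1 - a) * x 0 - a := rfl
    have hh1 (x a) : Fin.tail (h (x, a)) = Fin.tail x := Fin.tail_cons _ _
    have hhs (x a) : h (s x, a) = s x := by
      refine (Fin.cons_self_tail (h (s x, a))).symm.trans ?_
      rw [hh0, hh1, hs1, hs0]
      change (Fin.cons _ x : Fin (n + 1) → ℝ) = Fin.cons (-1) x
      congr 1
      ring
    have h2 : IsRelBasis U (U ∩ V) fun _ : Unit => push s τ := by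
      refine h1.of_deformation h (fun x => ?_) ?_ ?_ ?_ ?_ (fun x hx a => ?_) ?_ ?_ ?_
      · refine (Fin.cons_self_tail (h (x, 0))).symm.trans ?_
        rw [hh0, hh1]
        simp
      · rintro _ ⟨x, -, rfl⟩
        exact Or.inr (by rw [hs0]; norm_num)
      · rintro _ ⟨x, hx, rfl⟩
        rw [hint, hs1]
        exact hx
      · rintro _ ⟨x, -, rfl⟩ a
        rw [hhs]
        exact ⟨x, trivial, rfl⟩
      · rintro _ ⟨x, hx, rfl⟩ a
        rw [hhs]
        exact ⟨x, hx, rfl⟩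
      · obtain hx | hx := hx
        · exact Or.inl (by rwa [hh1])
        · refine Or.inr ?_
          rw [hh0]
          have h0 := a.2.1
          have h1 := a.2.2
          have h2 : (1 - (a : ℝ)) * x 0 ≤ (1 - a) * -(1 / 2) :=
            mul_le_mul_of_nonneg_left hx.le (by linarith)
          rcases eq_or_lt_of_le h0 with h0 | h0
          · rw [← h0]; linarith
          · linarith
      · intro x hx a
        rw [hint] at hx ⊢
        rwa [hh1]
      · intro x _
        refine ⟨Fin.tail x, trivial, ?_⟩
        rw [← Fin.cons_self_tail (h (x, 1)), hh0, hh1]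
        change (Fin.cons (-1) _ : Fin (n + 1) → ℝ) = _
        congr 1
        simp
      · intro x hx
        rw [hint] at hx
        refine ⟨Fin.tail x, hx, ?_⟩
        rw [← Fin.cons_self_tail (h (x, 1)), hh0, hh1]
        change (Fin.cons (-1) _ : Fin (n + 1) → ℝ) = _
        congr 1
        simp
    have h3 := IsRelBasis.excision (V := fun _ : Unit => U) hVo (fun _ => hUo)
      (fun i j hij => absurd (Subsingleton.elim i j) hij) (fun _ => h2)
    rw [← hUV] at h3
    have h4 := relCycles_le_relNull_upper n
    have hVP : V ⊆ {x : Fin (n + 1) → ℝ | 1 / 2 < ‖x‖} := hUV ▸ Set.subset_union_left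
    obtain ⟨w, -, b, hb, hwb⟩ := mem_relNull.mp
      (h4 (relCycles_mono (Set.subset_univ _) subset_rfl (h3.mem ())))
    -- The chain `w` may have mixed degrees. Because `τ` is homogeneous, the component of `w` with
    -- `n + 2` vertices still has the right boundary modulo `V`.
    refine ⟨proj (n + 1 + 1) w, proj_mem_deg _ _, h3.of_triple (Set.subset_univ _) hVP h4
      (fun _ => mem_sub_univ _) fun _ => ?_⟩
    rw [bd_proj]
    nth_rewrite 1 [← proj_of_mem_deg (push_mem_deg s hτd)]
    rw [← hwb, ← map_sub, add_sub_cancel_left]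
    exact proj_mem_sub _ hb

/-- The factor of the radial map which squeezes the space into the open unit ball. -/
theorem squeeze_bounds {r a : ℝ} (ha : a ∈ Set.Icc (0 : ℝ) 1) :
    0 ≤ (1 - a) + a / max 1 (r + 1 / 2) ∧ (1 - a) + a / max 1 (r + 1 / 2) ≤ 1 ∧
    (1 / 2 < r → 1 / 2 < ((1 - a) + a / max 1 (r + 1 / 2)) * r) := by
  obtain ⟨h0, h1⟩ := ha
  set m := max 1 (r + 1 / 2) with hm
  have hm1 : 1 ≤ m := le_max_left _ _
  have hdiv : a / m ≤ a := div_le_self h0 hm1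
  have hdiv0 : 0 ≤ a / m := by positivity
  refine ⟨by linarith, by linarith, fun hr2 => ?_⟩
  have hm2 : m = r + 1 / 2 := max_eq_right (by linarith)
  have h3 : 1 / 2 < r / m := by
    rw [hm2, div_lt_div_iff₀ (by norm_num) (by linarith)]
    linarith
  have h4 : (1 - a + a / m) * r = (1 - a) * r + a * (r / m) := by ring
  rw [h4]
  rcases eq_or_lt_of_le h0 with rfl | h0
  · simpa using hr2
  · nlinarith

/-- Dividing `x` gradually by `max 1 (‖x‖ + 1 / 2)` squeezes the whole space into the open unit
ball, preserving the ball and the outer region throughout. -/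
theorem exists_isRelBasis_ball (n : ℕ) : ∃ τ : SingChain (Fin n → ℝ), τ ∈ deg (n + 1) ∧
    IsRelBasis (Metric.ball 0 1) (Metric.ball 0 1 ∩ {x : Fin n → ℝ | 1 / 2 < ‖x‖})
      fun _ : Unit => τ := by
  obtain ⟨τ, hd, hτ⟩ := exists_isRelBasis_outer n
  let h : C((Fin n → ℝ) × unitInterval, Fin n → ℝ) :=
    ⟨fun p => ((1 - (p.2 : ℝ)) + p.2 / max 1 (‖p.1‖ + 1 / 2)) • p.1, by
      have : ∀ p : (Fin n → ℝ) × unitInterval, max 1 (‖p.1‖ + 1 / 2) ≠ 0 := fun p =>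
        (lt_of_lt_of_le one_pos (le_max_left _ _)).ne'
      have h1 : Continuous fun p : (Fin n → ℝ) × unitInterval =>
        (p.2 : ℝ) / max 1 (‖p.1‖ + 1 / 2) := Continuous.div (by fun_prop) (by fun_prop) this
      fun_prop⟩
  have hh (x a) : ‖h (x, a)‖ = ((1 - (a : ℝ)) + a / max 1 (‖x‖ + 1 / 2)) * ‖x‖ := by
    change ‖((1 - (a : ℝ)) + a / max 1 (‖x‖ + 1 / 2)) • x‖ = _
    rw [norm_smul, Real.norm_of_nonneg (squeeze_bounds (r := ‖x‖) a.2).1]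
  have hball : ∀ x ∈ Metric.ball (0 : Fin n → ℝ) 1, ∀ a, h (x, a) ∈ Metric.ball 0 1 := by
    intro x hx a
    rw [mem_ball_zero_iff] at hx ⊢
    rw [hh]
    have := (squeeze_bounds (r := ‖x‖) a.2).2.1
    have := norm_nonneg x
    nlinarith
  have hout : ∀ x ∈ {x : Fin n → ℝ | 1 / 2 < ‖x‖}, ∀ a, h (x, a) ∈ {x | 1 / 2 < ‖x‖} := by
    intro x hx a
    rw [Set.mem_ofPred_eq, hh]
    exact (squeeze_bounds (r := ‖x‖) a.2).2.2 hx
  have h1 : ∀ x, h (x, 1) ∈ Metric.ball 0 1 := by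
    intro x
    rw [mem_ball_zero_iff, hh]
    have hm : ‖x‖ + 1 / 2 ≤ max 1 (‖x‖ + 1 / 2) := le_max_right _ _
    have hm1 : 1 ≤ max 1 (‖x‖ + 1 / 2) := le_max_left _ _
    simp only [Set.Icc.coe_one, sub_self, zero_add]
    rw [div_mul_eq_mul_div, one_mul, div_lt_one (by linarith)]
    linarith
  refine ⟨_, push_mem_deg (atTime h 1) hd, hτ.deformation h (fun x => ?_) (Set.subset_univ _)
    Set.inter_subset_right hball (fun x hx a => ⟨hball x hx.1 a, hout x hx.2 a⟩)
    (fun _ _ _ => trivial) hout (fun x _ => h1 x) (fun x hx => ⟨h1 x, hout x hx 1⟩)⟩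
  change ((1 - ((0 : unitInterval) : ℝ)) + (0 : unitInterval) / _) • x = x
  simp

/-! ### Attaching cells -/

/-- Scaling by two. -/
def double (n : ℕ) : C(Fin n → ℝ, Fin n → ℝ) := ⟨fun x => (2 : ℝ) • x, by fun_prop⟩

/-- A generator of the homology of `ℝⁿ` relative to the complement of the open unit ball. -/
def cellChain (n : ℕ) : SingChain (Fin n → ℝ) :=
  push (double n) (exists_isRelBasis_ball n).choose

theorem cellChain_mem_deg (n : ℕ) : cellChain n ∈ deg (n + 1) :=
  push_mem_deg _ (exists_isRelBasis_ball n).choose_spec.1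

/-- A family of maps which exhibits a space as obtained from a closed subset by attaching
`n`-cells. The characteristic maps of the cells are extended from the closed unit ball to the
whole space. -/
structure IsCellAttachment {Y J : Type*} [TopologicalSpace Y] (B : Set Y) {n : ℕ}
    (χ : J → C(Fin n → ℝ, Y)) : Prop where
  isClosed : IsClosed B
  isClosed_of : ∀ C : Set Y, IsClosed (C ∩ B) →
    (∀ j, IsClosed (χ j ⁻¹' C ∩ Metric.closedBall 0 1)) → IsClosed C
  smul_eq : ∀ j x (a : ℝ), 1 ≤ ‖x‖ → 1 ≤ a → χ j (a • x) = χ j x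
  mem : ∀ j x, 1 ≤ ‖x‖ → χ j x ∈ B
  notMem : ∀ j x, ‖x‖ < 1 → χ j x ∉ B
  inj : ∀ i j x y, ‖x‖ < 1 → ‖y‖ < 1 → χ i x = χ j y → i = j ∧ x = y
  surj : ∀ y ∉ B, ∃ j x, ‖x‖ < 1 ∧ χ j x = y

namespace IsCellAttachment

variable {Y J : Type*} [TopologicalSpace Y] {B : Set Y} {n : ℕ} {χ : J → C(Fin n → ℝ, Y)}
  (h : IsCellAttachment B χ)

include h

/-- Closedness of the complement is tested on `B` and on the cells. The complement contains `B` and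
every other cell, and in the cell `j` it is the complement of `O`. -/
theorem isOpen_image {j : J} {O : Set (Fin n → ℝ)} (hO : IsOpen O)
    (hO1 : O ⊆ Metric.ball 0 1) : IsOpen (χ j '' O) := by
  rw [← isClosed_compl_iff]
  refine h.isClosed_of _ ?_ fun i => ?_
  · have : (χ j '' O)ᶜ ∩ B = B := Set.inter_eq_right.mpr fun y hy ⟨x, hx, hxy⟩ =>
      h.notMem j x (by simpa using hO1 hx) (hxy ▸ hy)
    rw [this]
    exact h.isClosed
  · by_cases hij : i = j
    · subst hij
      have : χ i ⁻¹' (χ i '' O)ᶜ ∩ Metric.closedBall 0 1 = Oᶜ ∩ Metric.closedBall 0 1 := by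
        ext x
        simp only [Set.mem_inter_iff, Set.mem_preimage, Set.mem_compl_iff, and_congr_left_iff,
          not_iff_not]
        refine fun _ => ⟨fun ⟨y, hy, hyx⟩ => ?_, fun hx => ⟨x, hx, rfl⟩⟩
        have hy1 : ‖y‖ < 1 := by simpa using hO1 hy
        by_cases hx1 : ‖x‖ < 1
        · rwa [← (h.inj _ _ _ _ hy1 hx1 hyx).2]
        · exact absurd (hyx ▸ h.mem i x (not_lt.mp hx1)) (h.notMem i y hy1)
      rw [this]
      exact hO.isClosed_compl.inter Metric.isClosed_closedBall
    · have : χ i ⁻¹' (χ j '' O)ᶜ ∩ Metric.closedBall 0 1 = Metric.closedBall 0 1 := by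
        refine Set.inter_eq_right.mpr fun x _ => ?_
        rintro ⟨y, hy, hyx⟩
        have hy1 : ‖y‖ < 1 := by simpa using hO1 hy
        by_cases hx1 : ‖x‖ < 1
        · exact hij (h.inj _ _ _ _ hy1 hx1 hyx).1.symm
        · exact absurd (hyx ▸ h.mem i x (not_lt.mp hx1)) (h.notMem j y hy1)
      rw [this]
      exact Metric.isClosed_closedBall

theorem exists_inverse (j : J) : ∃ g : Y → Fin n → ℝ,
    ContinuousOn g (χ j '' Metric.ball 0 1) ∧ ∀ x ∈ Metric.ball (0 : Fin n → ℝ) 1, g (χ j x) = x := by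
  have hinj : Set.InjOn (χ j) (Metric.ball 0 1) := fun x hx y hy hxy =>
    (h.inj j j x y (by simpa using hx) (by simpa using hy) hxy).2
  have hg := hinj.leftInvOn_invFunOn
  refine ⟨Function.invFunOn (χ j) (Metric.ball 0 1), continuousOn_iff'.mpr fun O hO => ?_, hg⟩
  refine ⟨χ j '' (O ∩ Metric.ball 0 1),
    h.isOpen_image (hO.inter Metric.isOpen_ball) Set.inter_subset_right, ?_⟩
  ext y
  constructor
  · rintro ⟨hy, x, hx, rfl⟩
    rw [Set.mem_preimage, hg hx] at hy
    exact ⟨⟨x, ⟨hy, hx⟩, rfl⟩, x, hx, rfl⟩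
  · rintro ⟨⟨x, hx, rfl⟩, h2⟩
    refine ⟨?_, h2⟩
    rw [Set.mem_preimage, hg hx.2]
    exact hx.1

/-- The expansion of the cells by factors between one and two. -/
theorem exists_expansion : ∃ H : C(Y × unitInterval, Y), (∀ y ∈ B, ∀ a, H (y, a) = y) ∧
    ∀ j x a, H (χ j x, a) = χ j ((1 + (a : ℝ)) • x) := by
  classical
  -- Currying turns the homotopy into a map from `Y` to its path space. Continuity can then be
  -- tested on `B` and the cells directly, with no need to know the topology of `Y × unitInterval`
  -- in terms of cells.
  let P (j : J) : C(Fin n → ℝ, C(unitInterval, Y)) :=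
    ContinuousMap.curry ⟨fun p => χ j ((1 + (p.2 : ℝ)) • p.1), by fun_prop⟩
  have hP (j x a) : P j x a = χ j ((1 + (a : ℝ)) • x) := rfl
  choose J' X' hX' using h.surj
  let K (y : Y) : C(unitInterval, Y) :=
    if hy : y ∈ B then ContinuousMap.const _ y else P (J' y hy) (X' y hy)
  have hKB (y) (hy : y ∈ B) : K y = ContinuousMap.const _ y := dif_pos hy
  have hKχ (j x) : K (χ j x) = P j x := by
    by_cases hx : ‖x‖ < 1
    · have hn := h.notMem j x hx
      have h1 := hX' _ hn
      obtain ⟨e1, e2⟩ := h.inj _ _ _ _ h1.1 hx h1.2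
      have h2 : K (χ j x) = P (J' _ hn) (X' _ hn) := dif_neg hn
      rw [h2, e2, e1]
    -- Outside the open ball the characteristic map is constant along rays, so the expanding path is
    -- constant and agrees with the one prescribed on `B`.
    · rw [hKB _ (h.mem j x (not_lt.mp hx))]
      ext a
      rw [hP]
      exact (h.smul_eq j x _ (not_lt.mp hx) (by linarith [a.2.1])).symm
  have hK : Continuous K := by
    refine continuous_iff_isClosed.mpr fun C hC => h.isClosed_of _ ?_ fun j => ?_
    · have : K ⁻¹' C ∩ B = (fun y => ContinuousMap.const _ y) ⁻¹' C ∩ B := by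
        ext y
        simp only [Set.mem_inter_iff, Set.mem_preimage, and_congr_left_iff]
        intro hy
        rw [hKB y hy]
      rw [this]
      exact (hC.preimage ContinuousMap.continuous_const').inter h.isClosed
    · rw [← Set.preimage_comp]
      have : K ∘ χ j = P j := funext (hKχ j)
      rw [this]
      exact (hC.preimage (P j).continuous).inter Metric.isClosed_closedBall
  refine ⟨⟨fun p => K p.1 p.2, by fun_prop⟩, fun y hy a => ?_, fun j x a => ?_⟩
  · change K y a = y
    rw [hKB y hy]
    rfl
  · change K (χ j x) a = _
    rw [hKχ, hP]

/-- Let `U` be the complement of the closed cells of half size. Excision with the disjoint open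
cells computes the homology relative to `U` from the ball, and the expansion pushes `U` into `B`. At
its end each cell is precomposed with doubling, which explains the doubling in `cellChain`. -/
theorem isRelBasis : IsRelBasis Set.univ B fun j => push (χ j) (cellChain n) := by
  obtain ⟨-, hτ⟩ := (exists_isRelBasis_ball n).choose_spec
  set τ := (exists_isRelBasis_ball n).choose with hτdef
  set U : Set Y := (⋃ j, χ j '' Metric.closedBall 0 (1 / 2))ᶜ with hU
  have hUmem (j x) : χ j x ∈ U ↔ 1 / 2 < ‖x‖ := by
    rw [hU, Set.mem_compl_iff, Set.mem_iUnion, ← not_le, not_iff_not]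
    refine ⟨?_, fun hx => ⟨j, x, by simpa using hx, rfl⟩⟩
    rintro ⟨i, y, hy, hyx⟩
    have hy' : ‖y‖ ≤ 1 / 2 := by simpa using hy
    have hy1 : ‖y‖ < 1 := by linarith
    by_cases hx : ‖x‖ < 1
    · rwa [← (h.inj _ _ _ _ hy1 hx hyx).2]
    · exact absurd (hyx ▸ h.mem j x (not_lt.mp hx)) (h.notMem i y hy1)
  have hBU : B ⊆ U := by
    rintro y hy ⟨_, ⟨j, rfl⟩, x, hx, rfl⟩
    have hx' : ‖x‖ ≤ 1 / 2 := by simpa using hx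
    exact h.notMem j x (by linarith) hy
  have hUo : IsOpen U := by
    rw [← isClosed_compl_iff]
    refine h.isClosed_of _ ?_ fun j => ?_
    · have : Uᶜ ∩ B = ∅ := by
        rw [← Set.disjoint_iff_inter_eq_empty, Set.disjoint_compl_left_iff_subset]
        exact hBU
      rw [this]
      exact isClosed_empty
    · have : χ j ⁻¹' Uᶜ = Metric.closedBall 0 (1 / 2) := by
        ext x
        rw [Set.mem_preimage, Set.mem_compl_iff, hUmem]
        simp
      rw [this]
      exact Metric.isClosed_closedBall.inter Metric.isClosed_closedBall
  have hVo (j) : IsOpen (χ j '' Metric.ball 0 1) := h.isOpen_image Metric.isOpen_ball subset_rfl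
  have hdisj : Pairwise (Function.onFun Disjoint fun j => χ j '' Metric.ball 0 1) := by
    intro i j hij
    rw [Function.onFun, Set.disjoint_left]
    rintro _ ⟨x, hx, rfl⟩ ⟨y, hy, hxy⟩
    exact hij (h.inj _ _ _ _ (by simpa using hy) (by simpa using hx) hxy).1.symm
  have hcover : U ∪ ⋃ j, χ j '' Metric.ball 0 1 = Set.univ := by
    refine Set.eq_univ_of_forall fun y => ?_
    by_cases hy : y ∈ B
    · exact Or.inl (hBU hy)
    · obtain ⟨j, x, hx, rfl⟩ := h.surj y hy
      exact Or.inr (Set.mem_iUnion.mpr ⟨j, x, by simpa using hx, rfl⟩)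
  have h1 : ∀ j, IsRelBasis (χ j '' Metric.ball 0 1) (χ j '' Metric.ball 0 1 ∩ U)
      fun _ : Unit => push (χ j) τ := by
    intro j
    obtain ⟨g, hg, hgχ⟩ := h.exists_inverse j
    have := hτ.image hg hgχ Set.inter_subset_left
    convert this using 1
    ext y
    constructor
    · rintro ⟨⟨x, hx, rfl⟩, hy⟩
      exact ⟨x, ⟨hx, (hUmem j x).mp hy⟩, rfl⟩
    · rintro ⟨x, ⟨hx, hx'⟩, rfl⟩
      exact ⟨⟨x, hx, rfl⟩, (hUmem j x).mpr hx'⟩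
  have h2 := IsRelBasis.excision hUo hVo hdisj h1
  rw [hcover] at h2
  obtain ⟨H, HB, Hχ⟩ := h.exists_expansion
  have hcases (y : Y) : y ∈ B ∨ ∃ j x, ‖x‖ < 1 ∧ χ j x = y := by
    by_cases hy : y ∈ B
    · exact Or.inl hy
    · exact Or.inr (h.surj y hy)
  have hscale (x : Fin n → ℝ) (a : unitInterval) : ‖(1 + (a : ℝ)) • x‖ = (1 + a) * ‖x‖ := by
    rw [norm_smul, Real.norm_of_nonneg (by linarith [a.2.1])]
  have h3 := h2.deformation (A := Set.univ) (B := B) H (fun y => ?_) subset_rfl hBU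
    (fun _ _ _ => trivial) (fun y hy a => by rwa [HB y hy]) (fun _ _ _ => trivial)
    (fun y hy a => ?_) (fun _ _ => trivial) (fun y hy => ?_)
  · convert h3 using 2 with j
    rw [cellChain, ← hτdef, push_push, push_push]
    congr 2
    ext1 x
    change χ j ((2 : ℝ) • x) = H (χ j x, 1)
    rw [Hχ]
    norm_num
  · obtain hy | ⟨j, x, -, rfl⟩ := hcases y
    · exact HB y hy 0
    · rw [Hχ]; simp
  · obtain hy' | ⟨j, x, -, rfl⟩ := hcases y
    · rwa [HB y hy']
    · rw [hUmem] at hy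
      rw [Hχ, hUmem, hscale]
      nlinarith [a.2.1]
  · obtain hy' | ⟨j, x, -, rfl⟩ := hcases y
    · rwa [HB y hy']
    · rw [hUmem] at hy
      rw [Hχ]
      refine h.mem _ _ ?_
      rw [hscale]
      simp only [Set.Icc.coe_one]
      linarith

end IsCellAttachment

end SingChain

end

end Bredon

namespace Bredon

noncomputable section

/-! ### Homology classes in complexes of modules -/

section HomologyClass

variable {R : Type*} [CommRing R] {ι : Type*} {c : ComplexShape ι}
  (K : HomologicalComplex (ModuleCat.{u} R) c) (i : ι)

/-- The homology class of a cycle. -/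
def homologyClass : LinearMap.ker (K.d i (c.next i)).hom →ₗ[R] K.homology i :=
  (K.liftCycles (ModuleCat.ofHom (LinearMap.ker (K.d i (c.next i)).hom).subtype) (c.next i) rfl
    (by ext x; exact x.2) ≫ K.homologyπ i).hom

theorem homologyClass_surjective : Function.Surjective (homologyClass K i) := by
  intro y
  obtain ⟨z, rfl⟩ := (ModuleCat.epi_iff_surjective (K.homologyπ i)).mp inferInstance y
  have hz : (K.iCycles i).hom z ∈ LinearMap.ker (K.d i (c.next i)).hom :=
    congrArg (fun f : K.cycles i ⟶ K.X (c.next i) => f.hom z) (K.iCycles_d i (c.next i))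
  refine ⟨⟨(K.iCycles i).hom z, hz⟩, ?_⟩
  · refine congrArg (K.homologyπ i).hom ?_
    refine (ModuleCat.mono_iff_injective (K.iCycles i)).mp inferInstance ?_
    exact congrArg (fun f => f.hom (⟨(K.iCycles i).hom z, hz⟩ :
      LinearMap.ker (K.d i (c.next i)).hom)) (K.liftCycles_i (ModuleCat.ofHom
        (LinearMap.ker (K.d i (c.next i)).hom).subtype) (c.next i) rfl (by ext x; exact x.2))

theorem homologyClass_eq_zero_iff (x : LinearMap.ker (K.d i (c.next i)).hom) :
    homologyClass K i x = 0 ↔ ∃ y, (K.d (c.prev i) i).hom y = x := by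
  have hi := congrArg (fun f => f.hom x) (K.liftCycles_i (ModuleCat.ofHom
        (LinearMap.ker (K.d i (c.next i)).hom).subtype) (c.next i) rfl (by ext x; exact x.2))
  set z := (K.liftCycles (ModuleCat.ofHom (LinearMap.ker (K.d i (c.next i)).hom).subtype)
    (c.next i) rfl (by ext x; exact x.2)).hom x with hz
  replace hi : (K.iCycles i).hom z = x := hi
  have hto (y) : (K.iCycles i).hom ((K.toCycles (c.prev i) i).hom y) = (K.d (c.prev i) i).hom y :=
    congrArg (fun f => f.hom y) (K.toCycles_i (c.prev i) i)
  change (K.homologyπ i).hom z = 0 ↔ _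
  constructor
  · intro h
    have hex := ShortComplex.exact_of_g_is_cokernel
      (ShortComplex.mk _ _ (K.toCycles_comp_homologyπ (c.prev i) i))
      (K.homologyIsCokernel (c.prev i) i rfl)
    obtain ⟨y, hy⟩ := (ShortComplex.moduleCat_exact_iff _).mp hex z h
    refine ⟨y, ?_⟩
    rw [← hto, ← hi]
    exact congrArg (K.iCycles i).hom hy
  · rintro ⟨y, hy⟩
    have : z = (K.toCycles (c.prev i) i).hom y :=
      (ModuleCat.mono_iff_injective (K.iCycles i)).mp inferInstance
        (hi.trans (hy.symm.trans (hto y).symm))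
    rw [this]
    exact congrArg (fun f => f.hom y) (K.toCycles_comp_homologyπ (c.prev i) i)

variable {K} {L : HomologicalComplex (ModuleCat.{u} R) c} (f : K ⟶ L)

theorem d_f_eq_zero (x : LinearMap.ker (K.d i (c.next i)).hom) :
    (L.d i (c.next i)).hom ((f.f i).hom x) = 0 := by
  have h : (L.d i (c.next i)).hom ((f.f i).hom x) =
      (f.f (c.next i)).hom ((K.d i (c.next i)).hom x) :=
    congrArg (fun g => g.hom x.1) (f.comm i (c.next i))
  rw [h, x.2, map_zero]

theorem homologyMap_homologyClass (x : LinearMap.ker (K.d i (c.next i)).hom) :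
    (HomologicalComplex.homologyMap f i).hom (homologyClass K i x) =
      homologyClass L i ⟨(f.f i).hom x, d_f_eq_zero i f x⟩ := by
  have h1 := congrArg (fun g => g.hom ((K.liftCycles (ModuleCat.ofHom
    (LinearMap.ker (K.d i (c.next i)).hom).subtype) (c.next i) rfl
      (by ext x; exact x.2)).hom x)) (HomologicalComplex.homologyπ_naturality f i)
  refine h1.trans (congrArg (L.homologyπ i).hom ?_)
  refine (ModuleCat.mono_iff_injective (L.iCycles i)).mp inferInstance ?_
  have h2 := congrArg (fun g => g.hom x) (HomologicalComplex.liftCycles_comp_cyclesMap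
    (ModuleCat.ofHom (LinearMap.ker (K.d i (c.next i)).hom).subtype) (c.next i) rfl
      (by ext x; exact x.2) f)
  refine (congrArg (L.iCycles i).hom h2).trans ?_
  refine (congrArg (fun g => g.hom x) (L.liftCycles_i (ModuleCat.ofHom
    (LinearMap.ker (K.d i (c.next i)).hom).subtype ≫ f.f i) (c.next i) rfl
      (by ext x; exact d_f_eq_zero i f x))).trans ?_
  exact (congrArg (fun g => g.hom (⟨(f.f i).hom x, d_f_eq_zero i f x⟩ :
    LinearMap.ker (L.d i (c.next i)).hom)) (L.liftCycles_i (ModuleCat.ofHom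
        (LinearMap.ker (L.d i (c.next i)).hom).subtype) (c.next i) rfl
          (by ext x; exact x.2))).symm

end HomologyClass

/-! ### Comparison with Mathlib's singular chains -/

section Comparison

open SingChain

variable (Y Z : TopCat.{u})

/-- The simplex of the singular simplicial set given by a continuous map. -/
def toSimplex {n : ℕ} (σ : C(stdSimplex ℝ (Fin (n + 1)), Y)) :
    (TopCat.toSSet.obj Y).obj (Opposite.op (SimplexCategory.mk n)) :=
  (TopCat.toSSetObjEquiv Y (Opposite.op (SimplexCategory.mk n))).symm σ

variable {Y Z}

/-- A singular simplex as an element of Mathlib's singular chain complex. -/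
def singularSimplex {n : ℕ} (σ : C(stdSimplex ℝ (Fin (n + 1)), Y)) : (singularChains.obj Y).X n :=
  (SSet.ιChainComplex (R := ModuleCat.of ℤ (ULift.{u} ℤ)) _ (toSimplex Y σ)).hom (ULift.up 1)

/-- The comparison map to Mathlib's singular chain complex. -/
def toSing (Y : TopCat.{u}) (n : ℕ) : SingChain Y →ₗ[ℤ] (singularChains.obj Y).X n :=
  lift fun k σ => if h : k = n + 1 then singularSimplex (h ▸ σ) else 0

theorem toSing_sx {n : ℕ} (σ : C(stdSimplex ℝ (Fin (n + 1)), Y)) :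
    toSing Y n (sx σ) = singularSimplex σ := by simp [toSing]

theorem toSing_sx_of_ne {n k : ℕ} (h : k ≠ n + 1) (σ : C(stdSimplex ℝ (Fin k), Y)) :
    toSing Y n (sx σ) = 0 := by simp [toSing, h]

theorem map_toSing (f : Y ⟶ Z) (n : ℕ) (c : SingChain Y) :
    ((singularChains.map f).f n).hom (toSing Y n c) = toSing Z n (push f.hom c) := by
  suffices h : ((singularChains.map f).f n).hom ∘ₗ toSing Y n = toSing Z n ∘ₗ push f.hom from
    LinearMap.congr_fun h c
  refine hom_ext fun k σ => ?_
  simp only [LinearMap.comp_apply, push_sx]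
  by_cases h : k = n + 1
  · subst h
    rw [toSing_sx, toSing_sx]
    exact congrArg (fun g : ModuleCat.of ℤ (ULift.{u} ℤ) ⟶ (singularChains.obj Z).X n =>
      g.hom (ULift.up 1)) (SSet.ι_chainComplexMap_f (f := TopCat.toSSet.map f)
      (R := ModuleCat.of ℤ (ULift.{u} ℤ)) (x := toSimplex Y σ))
  · rw [toSing_sx_of_ne h, toSing_sx_of_ne h, map_zero]

theorem d_toSing (n : ℕ) (c : SingChain Y) :
    ((singularChains.obj Y).d (n + 1) n).hom (toSing Y (n + 1) c) = toSing Y n (bd c) := by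
  suffices h : ((singularChains.obj Y).d (n + 1) n).hom ∘ₗ toSing Y (n + 1) =
      toSing Y n ∘ₗ bd from LinearMap.congr_fun h c
  refine hom_ext fun k σ => ?_
  simp only [LinearMap.comp_apply]
  by_cases h : k = n + 1 + 1
  · subst h
    rw [toSing_sx, bd_sx_succ, map_sum]
    simp only [map_zsmul, toSing_sx]
    let ev : (ModuleCat.of ℤ (ULift.{u} ℤ) ⟶ (singularChains.obj Y).X n) →+
        (singularChains.obj Y).X n :=
      { toFun g := g.hom (ULift.up 1), map_zero' := rfl, map_add' _ _ := rfl }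
    refine (congrArg ev (SSet.ιChainComplex_d (X := TopCat.toSSet.obj Y)
      (R := ModuleCat.of ℤ (ULift.{u} ℤ)) (x := toSimplex Y σ))).trans ?_
    refine (map_sum ev _ _).trans (Finset.sum_congr rfl fun i _ => ?_)
    exact map_zsmul ev _ _
  · rw [toSing_sx_of_ne h, map_zero]
    cases k with
    | zero => rw [bd_sx_zero, map_zero]
    | succ k =>
      rw [bd_sx_succ, map_sum]
      simp only [map_zsmul]
      refine (Finset.sum_eq_zero fun i _ => ?_).symm
      rw [toSing_sx_of_ne (by omega)]
      exact zsmul_zero _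

variable (Y) in
/-- The comparison map from Mathlib's singular chain complex. -/
def fromSing (n : ℕ) : (singularChains.obj Y).X n →ₗ[ℤ] SingChain Y :=
  ModuleCat.Hom.hom (B := ModuleCat.of ℤ (SingChain Y))
    ((SSet.isColimitChainComplexXCofan (TopCat.toSSet.obj Y)
      (ModuleCat.of ℤ (ULift.{u} ℤ)) n).desc (Limits.Cofan.mk (ModuleCat.of ℤ (SingChain Y))
        fun x => ModuleCat.ofHom ((LinearMap.toSpanSingleton ℤ (SingChain Y)
          (sx (TopCat.toSSetObjEquiv Y (Opposite.op (SimplexCategory.mk n)) x))).comp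
            ULift.moduleEquiv.toLinearMap)))

theorem fromSing_singularSimplex {n : ℕ} (σ : C(stdSimplex ℝ (Fin (n + 1)), Y)) :
    fromSing Y n (singularSimplex σ) = sx σ := by
  have h := (SSet.isColimitChainComplexXCofan (TopCat.toSSet.obj Y)
    (ModuleCat.of ℤ (ULift.{u} ℤ)) n).fac (Limits.Cofan.mk (ModuleCat.of ℤ (SingChain Y))
      fun x => ModuleCat.ofHom ((LinearMap.toSpanSingleton ℤ (SingChain Y)
        (sx (TopCat.toSSetObjEquiv Y (Opposite.op (SimplexCategory.mk n)) x))).comp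
          ULift.moduleEquiv.toLinearMap)) ⟨toSimplex Y σ⟩
  refine (LinearMap.congr_fun (congrArg ModuleCat.Hom.hom h) (ULift.up 1)).trans ?_
  exact one_smul ℤ (sx σ)

theorem toSing_fromSing (n : ℕ) (x : (singularChains.obj Y).X n) :
    toSing Y n (fromSing Y n x) = x := by
  suffices h : ModuleCat.ofHom (toSing Y n ∘ₗ fromSing Y n) = 𝟙 ((singularChains.obj Y).X n) from
    congrArg (fun g : (singularChains.obj Y).X n ⟶ (singularChains.obj Y).X n => g.hom x) h
  refine SSet.chainComplex_hom_ext (X := TopCat.toSSet.obj Y)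
    (R := ModuleCat.of ℤ (ULift.{u} ℤ)) fun s => ?_
  obtain ⟨σ, rfl⟩ := (TopCat.toSSetObjEquiv Y (Opposite.op (SimplexCategory.mk n))).symm.surjective s
  refine ModuleCat.hom_ext (LinearMap.ext fun r => ?_)
  have hr : r = r.down • ULift.up (1 : ℤ) := ULift.ext _ _ (mul_one r.down).symm
  rw [hr, map_zsmul, map_zsmul]
  congr 1
  change toSing Y n (fromSing Y n (singularSimplex σ)) = singularSimplex σ
  rw [fromSing_singularSimplex, toSing_sx]

theorem fromSing_toSing (n : ℕ) (c : SingChain Y) :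
    fromSing Y n (toSing Y n c) = proj (n + 1) c := by
  suffices h : fromSing Y n ∘ₗ toSing Y n = proj (n + 1) from LinearMap.congr_fun h c
  refine hom_ext fun k σ => ?_
  rw [LinearMap.comp_apply]
  by_cases h : k = n + 1
  · subst h
    rw [toSing_sx, fromSing_singularSimplex, proj_of_mem_deg (sx_mem_deg σ)]
  · rw [toSing_sx_of_ne h, map_zero]
    rw [proj, lift_sx, if_neg h]

theorem toSing_injOn {n : ℕ} {c : SingChain Y} (hc : c ∈ deg (n + 1)) (h : toSing Y n c = 0) :
    c = 0 := by
  rw [← proj_of_mem_deg hc, ← fromSing_toSing, h, map_zero]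

theorem fromSing_mem_deg (n : ℕ) (x : (singularChains.obj Y).X n) :
    fromSing Y n x ∈ deg (n + 1) := by
  rw [← toSing_fromSing n x, fromSing_toSing]
  exact proj_mem_deg _ _

end Comparison

end

end Bredon

namespace Bredon

noncomputable section

open SingChain

/-! ### Relative homology classes -/

section ChainComplexIndices

variable {R : Type*} [CommRing R] (K : ChainComplex (ModuleCat.{u} R) ℕ) (n : ℕ)

theorem d_next_eq_zero_iff (x : K.X n) :
    (K.d n ((ComplexShape.down ℕ).next n)).hom x = 0 ↔ ∀ m, m + 1 = n → (K.d n m).hom x = 0 := by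
  cases n with
  | zero =>
    refine ⟨fun _ m hm => by omega, fun _ => ?_⟩
    rw [K.shape 0 _ (by simp)]
    rfl
  | succ n =>
    rw [ChainComplex.next_nat_succ]
    refine ⟨fun h m hm => ?_, fun h => h n rfl⟩
    obtain rfl : m = n := by omega
    exact h

theorem exists_d_prev_eq_iff (x : K.X n) :
    (∃ y, (K.d ((ComplexShape.down ℕ).prev n) n).hom y = x) ↔
      ∃ y, (K.d (n + 1) n).hom y = x := by
  rw [ChainComplex.prev]

end ChainComplexIndices

theorem SingChain.exists_push_eq_of_isEmbedding {Y Z : Type*} [TopologicalSpace Y]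
    [TopologicalSpace Z] {f : C(Y, Z)} (hf : IsEmbedding f) {c : SingChain Z}
    (hc : c ∈ sub (Set.range f)) : ∃ c', push f c' = c := by
  suffices h : sub (Set.range f) ≤ LinearMap.range (push f) from h hc
  refine sub_le_iff.mpr fun k σ hσ => ?_
  choose s hs using fun t => hσ ⟨t, rfl⟩
  have hcont : Continuous s := hf.continuous_iff.mpr (by
    convert σ.continuous using 1
    exact funext hs)
  refine ⟨sx ⟨s, hcont⟩, ?_⟩
  rw [push_sx]
  congr 1
  exact ContinuousMap.ext hs

theorem SingChain.push_mem_range {Y Z : Type*} [TopologicalSpace Y]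
    [TopologicalSpace Z] (f : C(Y, Z)) (c : SingChain Y) : push f c ∈ sub (Set.range f) :=
  push_mem (fun x (_ : x ∈ Set.univ) => Set.mem_range_self x) (mem_sub_univ c)

theorem SingChain.mem_sub_of_mem_deg_zero {Y : Type*} [TopologicalSpace Y] (A : Set Y)
    {c : SingChain Y} (hc : c ∈ deg 0) : c ∈ sub A := by
  refine map_mem_of_mem_deg (f := LinearMap.id) (fun σ => sx_mem_sub ?_) hc
  rintro _ ⟨t, rfl⟩
  have := t.2.2
  simp at this

section Relative

variable (P : TopPair.{u}) (n : ℕ)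

/-- The image of `Y` in the pair `P`. -/
abbrev pairSub : Set P.fst := Set.range P.map

/-- The chain map from the chains of the space to the relative chains. -/
abbrev relProj : singularChains.obj P.fst ⟶ (pairSequence.obj P).X₃ := (pairSequence.obj P).g

theorem relProj_surjective : Function.Surjective ((relProj P).f n).hom :=
  (ModuleCat.epi_iff_surjective _).mp
    ((pairSequence_shortExact P).map_of_exact (HomologicalComplex.eval _ _ n)).epi_g

theorem relProj_eq_zero_iff (x : (singularChains.obj P.fst).X n) :
    ((relProj P).f n).hom x = 0 ↔
      ∃ a : (singularChains.obj P.snd).X n, ((singularChains.map P.map).f n).hom a = x := by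
  have hS := (pairSequence_shortExact P).map_of_exact (HomologicalComplex.eval _ _ n)
  refine ⟨(ShortComplex.moduleCat_exact_iff _).mp hS.exact x, ?_⟩
  rintro ⟨a, rfl⟩
  exact LinearMap.congr_fun (congrArg ModuleCat.Hom.hom
    ((pairSequence.obj P).map (HomologicalComplex.eval _ _ n)).zero) a

/-- The quotient kills the chains coming from the subspace. As the structure map is an embedding,
these are the chains whose simplices lie in its image. -/
theorem relProj_toSing_eq_zero_iff {c : SingChain P.fst} (hc : c ∈ deg (n + 1)) :
    ((relProj P).f n).hom (toSing P.fst n c) = 0 ↔ c ∈ sub (pairSub P) := by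
  rw [relProj_eq_zero_iff]
  constructor
  · rintro ⟨a, ha⟩
    have h1 : toSing P.fst n c = toSing P.fst n (push P.map.hom (fromSing P.snd n a)) := by
      rw [← map_toSing, toSing_fromSing]
      exact ha.symm
    have h2 : c - push P.map.hom (fromSing P.snd n a) = 0 :=
      toSing_injOn (sub_mem hc (push_mem_deg _ (fromSing_mem_deg n a)))
        (by rw [map_sub, h1, sub_self])
    rw [sub_eq_zero.mp h2]
    exact push_mem_range _ _
  · intro h
    obtain ⟨c', rfl⟩ := exists_push_eq_of_isEmbedding (f := P.map.hom) P.isEmbedding_map h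
    exact ⟨_, map_toSing P.map n c'⟩

theorem d_relProj_toSing (c : SingChain P.fst) :
    ((pairSequence.obj P).X₃.d (n + 1) n).hom (((relProj P).f (n + 1)).hom
      (toSing P.fst (n + 1) c)) = ((relProj P).f n).hom (toSing P.fst n (bd c)) := by
  rw [← d_toSing]
  exact LinearMap.congr_fun (congrArg ModuleCat.Hom.hom ((relProj P).comm (n + 1) n))
    (toSing P.fst (n + 1) c)

theorem bd_mem_deg {Y : Type*} [TopologicalSpace Y] {k : ℕ} {c : SingChain Y}
    (hc : c ∈ deg (k + 1)) : bd c ∈ deg k := by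
  rw [← proj_of_mem_deg hc, bd_proj]
  exact proj_mem_deg _ _

/-- A singular `n`-chain is a relative cycle if and only if its class in the quotient complex
is a cycle. -/
theorem bd_mem_sub_iff {c : SingChain P.fst} (hc : c ∈ deg (n + 1)) :
    ((pairSequence.obj P).X₃.d n ((ComplexShape.down ℕ).next n)).hom
      (((relProj P).f n).hom (toSing P.fst n c)) = 0 ↔ bd c ∈ sub (pairSub P) := by
  rw [d_next_eq_zero_iff]
  cases n with
  -- In degree zero the augmented boundary is a multiple of the empty simplex, which lies in every
  -- subset, so the augmentation imposes no condition.
  | zero => exact ⟨fun _ => mem_sub_of_mem_deg_zero _ (bd_mem_deg hc), fun _ m hm => by omega⟩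
  | succ n =>
    constructor
    · intro h
      have h1 := h n rfl
      rw [d_relProj_toSing] at h1
      exact (relProj_toSing_eq_zero_iff P n (bd_mem_deg hc)).mp h1
    · intro h m hm
      obtain rfl : m = n := by omega
      rw [d_relProj_toSing]
      exact (relProj_toSing_eq_zero_iff P m (bd_mem_deg hc)).mpr h

/-- The relative cycles of degree `n` of a pair. -/
def pairCycles : Submodule ℤ (SingChain P.fst) := deg (n + 1) ⊓ relCycles Set.univ (pairSub P)

theorem mem_pairCycles {P : TopPair.{u}} {n : ℕ} {c : SingChain P.fst} :
    c ∈ pairCycles P n ↔ c ∈ deg (n + 1) ∧ bd c ∈ sub (pairSub P) :=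
  ⟨fun h => ⟨h.1, h.2.2⟩, fun h => ⟨h.1, mem_sub_univ c, h.2⟩⟩

/-- The relative homology class of a relative cycle. -/
def relClass : pairCycles P n →ₗ[ℤ] (relHomology n).obj P :=
  homologyClass (pairSequence.obj P).X₃ n ∘ₗ
    (((relProj P).f n).hom ∘ₗ toSing P.fst n ∘ₗ (pairCycles P n).subtype).codRestrict _
      fun c => (bd_mem_sub_iff P n (mem_pairCycles.mp c.2).1).mpr (mem_pairCycles.mp c.2).2

theorem relClass_surjective : Function.Surjective (relClass P n) := by
  intro y
  obtain ⟨⟨x, hx⟩, rfl⟩ := homologyClass_surjective (pairSequence.obj P).X₃ n y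
  obtain ⟨c, rfl⟩ := relProj_surjective P n x
  refine ⟨⟨fromSing P.fst n c, mem_pairCycles.mpr ⟨fromSing_mem_deg n c, ?_⟩⟩, ?_⟩
  · refine (bd_mem_sub_iff P n (fromSing_mem_deg n c)).mp ?_
    rw [toSing_fromSing]
    exact hx
  · refine congrArg (homologyClass (pairSequence.obj P).X₃ n) (Subtype.ext ?_)
    exact congrArg ((relProj P).f n).hom (toSing_fromSing n c)

theorem relClass_eq_zero_iff (z : pairCycles P n) :
    relClass P n z = 0 ↔ z.1 ∈ relNull Set.univ (pairSub P) := by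
  have hz := (mem_pairCycles.mp z.2).1
  refine (homologyClass_eq_zero_iff (pairSequence.obj P).X₃ n _).trans ?_
  refine (exists_d_prev_eq_iff _ n _).trans ?_
  constructor
  · rintro ⟨y, hy⟩
    obtain ⟨w, rfl⟩ := relProj_surjective P (n + 1) y
    have hw : toSing P.fst (n + 1) (fromSing P.fst (n + 1) w) = w := toSing_fromSing (n + 1) w
    rw [← hw, d_relProj_toSing] at hy
    have h := (relProj_toSing_eq_zero_iff P n (sub_mem hz
      (bd_mem_deg (fromSing_mem_deg (n + 1) w)))).mp (by
        rw [map_sub, map_sub, hy]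
        exact sub_self _)
    exact mem_relNull.mpr ⟨_, mem_sub_univ _, _, h, add_sub_cancel _ _⟩
  · intro h
    obtain ⟨w, -, b, hb, hwb⟩ := mem_relNull.mp h
    -- The witnesses may have mixed degrees; their components in the right degrees suffice because
    -- `z` is homogeneous.
    have h1 : bd (proj (n + 2) w) + proj (n + 1) b = z.1 := by
      rw [bd_proj, ← map_add, hwb, proj_of_mem_deg hz]
    refine ⟨((relProj P).f (n + 1)).hom (toSing P.fst (n + 1) (proj (n + 2) w)), ?_⟩
    rw [d_relProj_toSing]
    have h2 := (relProj_toSing_eq_zero_iff P n (proj_mem_deg (n + 1) b)).mpr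
      (proj_mem_sub (n + 1) hb)
    change _ = ((relProj P).f n).hom (toSing P.fst n z.1)
    rw [← h1, map_add, map_add, h2]
    exact (add_zero _).symm

variable {P n} {Q : TopPair.{u}}

theorem push_mem_pairCycles (f : P ⟶ Q) {c : SingChain P.fst} (hc : c ∈ pairCycles P n) :
    push (TopPair.Hom.fst f).hom c ∈ pairCycles Q n := by
  refine ⟨push_mem_deg _ hc.1, push_mem_relCycles (Set.mapsTo_univ _ _) ?_ hc.2⟩
  rintro _ ⟨x, rfl⟩
  exact ⟨TopPair.Hom.snd f x, TopPair.Hom.w_apply f x⟩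

theorem relHomology_map_relClass (f : P ⟶ Q) (z : pairCycles P n) :
    ((relHomology n).map f).hom (relClass P n z) =
      relClass Q n ⟨push (TopPair.Hom.fst f).hom z, push_mem_pairCycles f z.2⟩ := by
  refine (homologyMap_homologyClass n (pairSequence.map f).τ₃ _).trans ?_
  refine congrArg (homologyClass (pairSequence.obj Q).X₃ n) (Subtype.ext ?_)
  have h := LinearMap.congr_fun (congrArg (fun g => ModuleCat.Hom.hom (HomologicalComplex.Hom.f g n))
    (pairSequence.map f).comm₂₃) (toSing P.fst n z.1)
  refine h.symm.trans ?_
  exact congrArg ((relProj Q).f n).hom (map_toSing (TopPair.Hom.fst f) n z.1)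

end Relative

end

end Bredon

namespace Bredon

noncomputable section

open SingChain

/-! ### Characteristic maps and orbits of cells -/

/-- The generator for the ball has its boundary beyond radius `1/2`, and doubling moves that beyond
radius one, where characteristic maps land in the lower skeleton. -/
theorem bd_cellChain_mem (n : ℕ) : bd (cellChain n) ∈ sub {x : Fin n → ℝ | 1 ≤ ‖x‖} := by
  rw [cellChain, ← push_bd]
  refine push_mem ?_ ((exists_isRelBasis_ball n).choose_spec.2.mem ()).2
  rintro x ⟨-, hx : 1 / 2 < ‖x‖⟩
  change 1 ≤ ‖(2 : ℝ) • x‖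
  rw [norm_smul]
  norm_num
  linarith

section Cells

variable {G : Type u} [Group G] {X : Type u} [TopologicalSpace X]
  [CWComplex (Set.univ : Set X)]

/-- The retraction of `ℝⁿ` onto the closed unit ball. -/
def ballRetraction (n : ℕ) : C(Fin n → ℝ, Fin n → ℝ) where
  toFun x := (max 1 ‖x‖)⁻¹ • x
  continuous_toFun := by
    refine Continuous.smul (Continuous.inv₀ (continuous_const.max continuous_norm) fun x => ?_)
      continuous_id
    exact (lt_of_lt_of_le one_pos (le_max_left _ _)).ne'

theorem ballRetraction_of_le {n : ℕ} {x : Fin n → ℝ} (hx : ‖x‖ ≤ 1) : ballRetraction n x = x := by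
  simp [ballRetraction, max_eq_left hx]

theorem norm_ballRetraction {n : ℕ} {x : Fin n → ℝ} (hx : 1 ≤ ‖x‖) : ‖ballRetraction n x‖ = 1 := by
  have : ‖x‖ ≠ 0 := by linarith
  simp [ballRetraction, max_eq_right hx, norm_smul, this]

theorem ballRetraction_mem {n : ℕ} (x : Fin n → ℝ) :
    ballRetraction n x ∈ Metric.closedBall 0 1 := by
  rw [mem_closedBall_zero_iff]
  rcases le_total ‖x‖ 1 with hx | hx
  · rwa [ballRetraction_of_le hx]
  · rw [norm_ballRetraction hx]

theorem ballRetraction_smul {n : ℕ} {x : Fin n → ℝ} {a : ℝ} (hx : 1 ≤ ‖x‖) (ha : 1 ≤ a) :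
    ballRetraction n (a • x) = ballRetraction n x := by
  have hx0 : ‖x‖ ≠ 0 := by linarith
  have ha0 : a ≠ 0 := by linarith
  have h : ‖a • x‖ = a * ‖x‖ := by rw [norm_smul, Real.norm_of_nonneg (by linarith)]
  have h1 : 1 ≤ a * ‖x‖ := by nlinarith
  simp only [ballRetraction, ContinuousMap.coe_mk]
  rw [h, max_eq_right h1, max_eq_right hx, smul_smul]
  congr 1
  field_simp

variable {n : ℕ}

/-- The characteristic map of a cell, extended radially to all of `ℝⁿ`. -/
def charMap (e : RelCWComplex.cell (Set.univ : Set X) n) : C(Fin n → ℝ, X) where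
  toFun x := RelCWComplex.map n e (ballRetraction n x)
  continuous_toFun := (RelCWComplex.continuousOn n e).comp_continuous
    (ballRetraction n).continuous ballRetraction_mem

theorem charMap_of_le (e : RelCWComplex.cell (Set.univ : Set X) n) {x : Fin n → ℝ}
    (hx : ‖x‖ ≤ 1) : charMap e x = RelCWComplex.map n e x := by
  simp [charMap, ballRetraction_of_le hx]

theorem charMap_smul (e : RelCWComplex.cell (Set.univ : Set X) n) {x : Fin n → ℝ} {a : ℝ}
    (hx : 1 ≤ ‖x‖) (ha : 1 ≤ a) : charMap e (a • x) = charMap e x := by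
  simp [charMap, ballRetraction_smul hx ha]

theorem charMap_mem_closedCell (e : RelCWComplex.cell (Set.univ : Set X) n) (x : Fin n → ℝ) :
    charMap e x ∈ RelCWComplex.closedCell n e := ⟨_, ballRetraction_mem x, rfl⟩

theorem charMap_mem_cellSet (e : RelCWComplex.cell (Set.univ : Set X) n) {x : Fin n → ℝ}
    (hx : ‖x‖ < 1) : charMap e x ∈ cellSet X n e :=
  ⟨x, mem_ball_zero_iff.mpr hx, (charMap_of_le e hx.le).symm⟩

theorem exists_charMap_eq (e : RelCWComplex.cell (Set.univ : Set X) n) {y : X}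
    (hy : y ∈ cellSet X n e) : ∃ x, ‖x‖ < 1 ∧ charMap e x = y := by
  obtain ⟨x, hx, rfl⟩ := hy
  rw [mem_ball_zero_iff] at hx
  exact ⟨x, hx, charMap_of_le e hx.le⟩

theorem charMap_image_closedBall (e : RelCWComplex.cell (Set.univ : Set X) n) :
    charMap e '' Metric.closedBall 0 1 = RelCWComplex.closedCell n e := by
  refine Set.image_congr fun x hx => ?_
  exact charMap_of_le e (by simpa using hx)

theorem charMap_mem_skeletonLT [T2Space X] (e : RelCWComplex.cell (Set.univ : Set X) n)
    {x : Fin n → ℝ} (hx : 1 ≤ ‖x‖) :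
    charMap e x ∈ RelCWComplex.skeletonLT (Set.univ : Set X) n :=
  RelCWComplex.cellFrontier_subset_skeletonLT n e
    ⟨_, by rw [mem_sphere_zero_iff_norm]; exact norm_ballRetraction hx, rfl⟩

theorem charMap_injOn (e : RelCWComplex.cell (Set.univ : Set X) n) {x y : Fin n → ℝ}
    (hx : ‖x‖ < 1) (hy : ‖y‖ < 1) (h : charMap e x = charMap e y) : x = y := by
  rw [charMap_of_le e hx.le, charMap_of_le e hy.le] at h
  refine (RelCWComplex.map n e).injOn ?_ ?_ h <;> rw [RelCWComplex.source_eq] <;> simpa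

theorem cell_eq_of_mem {e e' : RelCWComplex.cell (Set.univ : Set X) n} {y : X}
    (h : y ∈ cellSet X n e) (h' : y ∈ cellSet X n e') : e = e' := by
  have := RelCWComplex.eq_of_not_disjoint_openCell (Set.not_disjoint_iff.mpr ⟨y, h, h'⟩)
  simpa using this

/-! ### Orbits and stabilizers of cells. -/

variable [MulAction G X]

variable (G X n) in
/-- Two cells are equivalent if they belong to the same orbit. -/
def cellSetoid : Setoid (RelCWComplex.cell (Set.univ : Set X) n) where
  r e e' := ∃ g : G, cellSet X n e = g • cellSet X n e'
  iseqv := ⟨fun e => ⟨1, (one_smul _ _).symm⟩, fun ⟨g, h⟩ => ⟨g⁻¹, by rw [h, inv_smul_smul]⟩,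
    fun ⟨g, h⟩ ⟨g', h'⟩ => ⟨g * g', by rw [h, h', mul_smul]⟩⟩

variable (G X n) in
/-- The type of orbits of `n`-cells. -/
def CellOrbit : Type u := Quotient (cellSetoid G X n)

theorem finite_cellOrbit (h : IsFiniteGCW G X) : Finite (CellOrbit G X n) := by
  obtain ⟨S, hS, hcov⟩ := h
  have hT : {e : RelCWComplex.cell (Set.univ : Set X) n | ⟨n, e⟩ ∈ S}.Finite :=
    hS.preimage (Function.Injective.injOn sigma_mk_injective)
  refine Set.finite_univ_iff.mp ((hT.image (Quotient.mk (cellSetoid G X n))).subset ?_)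
  rintro q -
  induction q using Quotient.inductionOn with
  | h e =>
    obtain ⟨e₀, he₀, g, hg⟩ := hcov n e
    exact ⟨e₀, he₀, (Quotient.sound ⟨g, hg⟩ : (⟦e⟧ : Quotient (cellSetoid G X n)) = ⟦e₀⟧).symm⟩

/-- A representative of an orbit of cells. -/
def CellOrbit.cell (i : CellOrbit G X n) : RelCWComplex.cell (Set.univ : Set X) n :=
  Quotient.out (s := cellSetoid G X n) i

theorem CellOrbit.exists_eq_smul (e : RelCWComplex.cell (Set.univ : Set X) n) :
    ∃ (i : CellOrbit G X n) (g : G), g • cellSet X n i.cell = cellSet X n e := by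
  obtain ⟨g, hg⟩ := Quotient.mk_out (s := cellSetoid G X n) e
  exact ⟨Quotient.mk (cellSetoid G X n) e, g⁻¹, inv_smul_eq_iff.mpr hg⟩

theorem CellOrbit.eq_of_smul_eq {i j : CellOrbit G X n} {g : G}
    (h : cellSet X n i.cell = g • cellSet X n j.cell) : i = j :=
  Quotient.out_equiv_out.mp (⟨g, h⟩ : (cellSetoid G X n).r i.cell j.cell)

variable [IsGCWComplex G X]

theorem smul_cellSet_eq_of_mem {e e' : RelCWComplex.cell (Set.univ : Set X) n} {g : G} {y : X}
    (h : y ∈ g • cellSet X n e) (h' : y ∈ cellSet X n e') : g • cellSet X n e = cellSet X n e' := by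
  obtain ⟨e'', he''⟩ := IsGCWComplex.exists_smul_cell_eq (X := X) g n e
  rw [he''] at h ⊢
  rw [cell_eq_of_mem h h']

/-- The stabilizer of an interior point of a cell. -/
abbrev cellStabilizer (G : Type u) [Group G] [MulAction G X]
    (e : RelCWComplex.cell (Set.univ : Set X) n) : Subgroup G :=
  MulAction.stabilizer G (RelCWComplex.map n e 0)

/-- A translate that contains the centre of the cell is the cell itself, by disjointness of open
cells; conversely a preserved cell is fixed pointwise. Hence the stabilizer of the cell is an
isotropy group of a point. -/
theorem mem_cellStabilizer_iff {e : RelCWComplex.cell (Set.univ : Set X) n} {g : G} :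
    g ∈ cellStabilizer G e ↔ g • cellSet X n e = cellSet X n e := by
  have h0 : RelCWComplex.map n e 0 ∈ cellSet X n e := RelCWComplex.map_zero_mem_openCell n e
  constructor
  · intro hg
    refine smul_cellSet_eq_of_mem (y := RelCWComplex.map n e 0) ?_ h0
    exact ⟨_, h0, hg⟩
  · intro hg
    exact IsGCWComplex.smul_eq_of_smul_cell_eq g n e hg _ h0

/-- The fixed set of `g` is closed in a Hausdorff space, so it contains the closure of the open cell
along with the cell. -/
theorem smul_eq_of_mem_closedCell [T2Space X] {e : RelCWComplex.cell (Set.univ : Set X) n} {g : G}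
    (hg : g ∈ cellStabilizer G e) {y : X} (hy : y ∈ RelCWComplex.closedCell n e) : g • y = y := by
  rw [← RelCWComplex.closure_openCell_eq_closedCell] at hy
  have hcl : IsClosed {y : X | g • y = y} := isClosed_eq (continuous_const_smul g) continuous_id
  exact hcl.closure_subset_iff.mpr (fun z hz =>
    IsGCWComplex.smul_eq_of_smul_cell_eq g n e (mem_cellStabilizer_iff.mp hg) z hz) hy

theorem closedCell_eq_smul [T2Space X] {e e' : RelCWComplex.cell (Set.univ : Set X) n} {g : G}
    (h : g • cellSet X n e = cellSet X n e') :
    RelCWComplex.closedCell n e' = g • RelCWComplex.closedCell n e := by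
  rw [← RelCWComplex.closure_openCell_eq_closedCell, ← RelCWComplex.closure_openCell_eq_closedCell]
  change closure (cellSet X n e') = g • closure (cellSet X n e)
  rw [← h]
  exact ((Homeomorph.smul g).image_closure _).symm

end Cells

end

end Bredon

namespace Bredon

noncomputable section

open SingChain

/-! ### Bases of relative homology -/

/-- A relative basis concerns chains of all degrees at once. If its members are homogeneous of
degree `n`, it gives a basis in that degree because `relClass` is surjective with the null chains as
kernel. -/
theorem SingChain.IsRelBasis.exists_basis {P : TopPair.{u}} {n : ℕ} {J : Type*} {τ : J → SingChain P.fst}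
    (h : IsRelBasis Set.univ (pairSub P) τ) (hτ : ∀ j, τ j ∈ pairCycles P n) :
    ∃ b : Module.Basis J ℤ ((relHomology n).obj P), ∀ j, b j = relClass P n ⟨τ j, hτ j⟩ := by
  have hcomb (c : J →₀ ℤ) :
      ((Finsupp.linearCombination ℤ (fun j => (⟨τ j, hτ j⟩ : pairCycles P n)) c :
        pairCycles P n) : SingChain P.fst) = Finsupp.linearCombination ℤ τ c := by
    simp [Finsupp.linearCombination_apply, Finsupp.sum]
  have hcl (c : J →₀ ℤ) : Finsupp.linearCombination ℤ (fun j => relClass P n ⟨τ j, hτ j⟩) c =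
      relClass P n (Finsupp.linearCombination ℤ (fun j => (⟨τ j, hτ j⟩ : pairCycles P n)) c) :=
    (Finsupp.apply_linearCombination ℤ (relClass P n) _ c).symm
  have hli : LinearIndependent ℤ fun j => relClass P n ⟨τ j, hτ j⟩ := by
    refine linearIndependent_iff.mpr fun c hc => h.indep c ?_
    rw [hcl, relClass_eq_zero_iff, hcomb] at hc
    exact hc
  have hspan : ⊤ ≤ Submodule.span ℤ (Set.range fun j => relClass P n ⟨τ j, hτ j⟩) := by
    rintro y -
    obtain ⟨z, rfl⟩ := relClass_surjective P n y
    obtain ⟨c, hc⟩ := h.span z.1 z.2.2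
    rw [← hcomb, ← Submodule.coe_sub, ← relClass_eq_zero_iff, map_sub, sub_eq_zero] at hc
    rw [hc, ← hcl]
    exact (Finsupp.mem_span_range_iff_exists_finsupp).mpr ⟨c, rfl⟩
  exact ⟨Module.Basis.mk hli hspan, fun j => Module.Basis.mk_apply hli hspan j⟩

/-! ### The cellular chains as free functors -/

section Free

variable {G : Type u} [Group G] {F : Set (Subgroup G)} {X : Type u} [TopologicalSpace X] [T2Space X]
  [CWComplex (Set.univ : Set X)] [MulAction G X] [IsGCWComplex G X] {n : ℕ}

theorem OrbitCat.hom_ext {H K : OrbitCat F} {φ ψ : H ⟶ K}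
    (h : (QuotientGroup.mk (OrbitCat.Hom.rep φ) : G ⧸ K.subgroup) =
      QuotientGroup.mk (OrbitCat.Hom.rep ψ)) : φ = ψ := by
  rw [OrbitCat.Hom.mk_rep, OrbitCat.Hom.mk_rep] at h
  refine MulActionHom.ext fun x => ?_
  induction x using QuotientGroup.induction_on with
  | H g =>
    have hg : (QuotientGroup.mk g : G ⧸ H.subgroup) = g • QuotientGroup.mk 1 := by
      change _ = (QuotientGroup.mk (g * 1) : G ⧸ H.subgroup)
      rw [mul_one]
    change OrbitCat.Hom.toMap φ _ = OrbitCat.Hom.toMap ψ _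
    rw [hg, map_smul, map_smul, h]

/-- A coset `gK` which is fixed by `H` is the image of `eH` under a morphism `G/H ⟶ G/K`. -/
theorem OrbitCat.exists_hom {H K : OrbitCat F} {g : G}
    (h : ∀ a ∈ H.subgroup, g⁻¹ * a * g ∈ K.subgroup) :
    ∃ φ : H ⟶ K, (QuotientGroup.mk (OrbitCat.Hom.rep φ) : G ⧸ K.subgroup) =
      QuotientGroup.mk g := by
  let f : (G ⧸ H.subgroup) →[G] (G ⧸ K.subgroup) :=
    { toFun := Quotient.lift (fun x => (QuotientGroup.mk (x * g) : G ⧸ K.subgroup))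
        fun x y hxy => by
          rw [← Quotient.eq_iff_equiv] at hxy
          have hxy' : x⁻¹ * y ∈ H.subgroup := QuotientGroup.eq.mp hxy
          refine QuotientGroup.eq.mpr ?_
          convert h _ hxy' using 1
          group
      map_smul' := fun a x => by
        induction x using QuotientGroup.induction_on with
        | H x => exact congrArg QuotientGroup.mk (mul_assoc a x g) }
  refine ⟨f, (OrbitCat.Hom.mk_rep (F := F) (H := H) (K := K) f).trans ?_⟩
  exact congrArg QuotientGroup.mk (one_mul g)

variable (hF : ∀ x : X, MulAction.stabilizer G x ∈ F)

/-- The orbit `G/G_e` of a cell `e`. -/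
def cellOrbit (i : CellOrbit G X n) : OrbitCat F := ⟨cellStabilizer G i.cell, hF _⟩

theorem closedCell_subset_fixedSkeletonLT (e : RelCWComplex.cell (Set.univ : Set X) n) :
    RelCWComplex.closedCell n e ⊆ fixedSkeletonLT X (cellStabilizer G e) (n + 1) := fun y hy =>
  ⟨fun g => smul_eq_of_mem_closedCell g.2 hy, by
    have := RelCWComplex.closedCell_subset_skeletonLT n e hy
    exact_mod_cast this⟩

/-- The characteristic map of a cell as a map to the fixed points of its stabilizer. -/
def fixedCharMap (i : CellOrbit G X n) :
    C(Fin n → ℝ, ((fixedPair F X n).obj (Opposite.op (cellOrbit hF i))).fst) where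
  toFun x := (⟨charMap i.cell x,
    closedCell_subset_fixedSkeletonLT i.cell (charMap_mem_closedCell i.cell x)⟩ :
      fixedSkeletonLT X (cellStabilizer G i.cell) (n + 1))
  continuous_toFun := Continuous.subtype_mk (charMap i.cell).continuous _

/-- The translate of a characteristic map by a morphism of the orbit category. -/
def translatedCharMap (H : OrbitCat F) (j : Σ i : CellOrbit G X n, H ⟶ cellOrbit hF i) :
    C(Fin n → ℝ, ((fixedPair F X n).obj (Opposite.op H)).fst) :=
  (TopPair.Hom.fst ((fixedPair F X n).map j.2.op)).hom.comp (fixedCharMap hF j.1)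

theorem translatedCharMap_val (H : OrbitCat F) (j : Σ i : CellOrbit G X n, H ⟶ cellOrbit hF i)
    (x : Fin n → ℝ) : (translatedCharMap hF H j x : fixedSkeletonLT X H.subgroup (n + 1)).1 =
      OrbitCat.Hom.rep j.2 • charMap j.1.cell x := rfl

theorem mem_pairSub_fixedPair {H : OrbitCat F}
    (y : ((fixedPair F X n).obj (Opposite.op H)).fst) :
    y ∈ pairSub ((fixedPair F X n).obj (Opposite.op H)) ↔
      (y : fixedSkeletonLT X H.subgroup (n + 1)).1 ∈ RelCWComplex.skeletonLT (Set.univ : Set X) n := by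
  constructor
  · rintro ⟨a, rfl⟩
    exact (a : fixedSkeletonLT X H.subgroup n).2.2
  · intro h
    exact ⟨(⟨y.1, y.2.1, h⟩ : fixedSkeletonLT X H.subgroup n), rfl⟩

/-- The cells of `X^H` are the translates of the chosen cells by the morphisms of the orbit
category. -/
theorem exists_translate {H : OrbitCat F} {e : RelCWComplex.cell (Set.univ : Set X) n} {y : X}
    (hy : y ∈ cellSet X n e) (hfix : y ∈ MulAction.fixedPoints H.subgroup X) :
    ∃ j : Σ i : CellOrbit G X n, H ⟶ cellOrbit hF i,
      OrbitCat.Hom.rep j.2 • cellSet X n j.1.cell = cellSet X n e := by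
  obtain ⟨i, g, hg⟩ := CellOrbit.exists_eq_smul (G := G) e
  -- Each element of `H` fixes a point of the cell and therefore preserves the cell; conjugation by
  -- `g` moves it into the stabilizer of the representative.
  have key : ∀ a ∈ H.subgroup, g⁻¹ * a * g ∈ (cellOrbit hF i).subgroup := by
    intro a ha
    refine mem_cellStabilizer_iff.mpr ?_
    have h1 : a • cellSet X n e = cellSet X n e :=
      smul_cellSet_eq_of_mem ⟨y, hy, hfix ⟨a, ha⟩⟩ hy
    rw [mul_smul, mul_smul, hg, h1, ← hg, inv_smul_smul]
  obtain ⟨φ, hφ⟩ := OrbitCat.exists_hom key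
  refine ⟨⟨i, φ⟩, ?_⟩
  have h2 : g⁻¹ * OrbitCat.Hom.rep φ ∈ cellStabilizer G i.cell := QuotientGroup.eq.mp hφ.symm
  rw [mem_cellStabilizer_iff, mul_smul, inv_smul_eq_iff, hg] at h2
  exact h2

theorem isClosed_fixedSkeletonLT (H : Subgroup G) (k : ℕ) :
    IsClosed (fixedSkeletonLT X H k) := by
  refine IsClosed.inter ?_ (RelCWComplex.skeletonLT (Set.univ : Set X) k).closed
  have : MulAction.fixedPoints H X = ⋂ h : H, {x : X | (h : G) • x = x} := by
    ext x
    simp only [MulAction.mem_fixedPoints, Set.mem_iInter, Set.mem_ofPred_eq]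
    rfl
  change IsClosed (MulAction.fixedPoints H X)
  rw [this]
  exact isClosed_iInter fun h => isClosed_eq (continuous_const_smul _) continuous_id

/-- The fixed part of the skeleton is closed in `X`, so its topology is tested on the closed cells
of `X`: lower cells are absorbed by the subspace, an `n`-cell is missed or is a translate of a
representative, and higher open cells are missed. Two translates that meet come from the same orbit
and from group elements in the same coset, that is, from the same morphism. -/
theorem isCellAttachment_fixedPair (H : OrbitCat F) :
    IsCellAttachment (pairSub ((fixedPair F X n).obj (Opposite.op H)))
      (translatedCharMap (n := n) hF H) where
  isClosed := by
    have : IsClosed {y : fixedSkeletonLT X H.subgroup (n + 1) |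
        y.1 ∈ RelCWComplex.skeletonLT (Set.univ : Set X) n} :=
      (RelCWComplex.skeletonLT (Set.univ : Set X) n).closed.preimage continuous_subtype_val
    have heq : pairSub ((fixedPair F X n).obj (Opposite.op H)) =
        {y : fixedSkeletonLT X H.subgroup (n + 1) |
          y.1 ∈ RelCWComplex.skeletonLT (Set.univ : Set X) n} :=
      Set.ext (mem_pairSub_fixedPair (F := F) (X := X) (n := n) (H := H))
    rw [heq]
    exact this
  isClosed_of C hCB hC := by
    have hY : IsClosedEmbedding (Subtype.val : fixedSkeletonLT X H.subgroup (n + 1) → X) :=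
      (isClosed_fixedSkeletonLT H.subgroup (n + 1)).isClosedEmbedding_subtypeVal
    refine hY.isClosed_iff_image_isClosed.mpr ?_
    refine RelCWComplex.isClosed_of_disjoint_openCell_or_isClosed_inter_closedCell
      (C := (Set.univ : Set X)) (Set.subset_univ _) (by simp) fun m _ e => ?_
    rcases lt_trichotomy m n with hm | rfl | hm
    · right
      have h1 : Subtype.val '' C ∩ RelCWComplex.closedCell m e =
          Subtype.val '' (C ∩ pairSub ((fixedPair F X n).obj (Opposite.op H))) ∩
            RelCWComplex.closedCell m e := by
        ext x
        refine and_congr_left fun hx => ⟨?_, ?_⟩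
        · rintro ⟨y, hy, rfl⟩
          refine ⟨y, ⟨hy, (mem_pairSub_fixedPair y).mpr ?_⟩, rfl⟩
          exact RelCWComplex.skeletonLT_mono (by exact_mod_cast hm)
            (RelCWComplex.closedCell_subset_skeletonLT m e hx)
        · rintro ⟨y, hy, rfl⟩
          exact ⟨y, hy.1, rfl⟩
      rw [h1]
      exact (hY.isClosedMap _ hCB).inter RelCWComplex.isClosed_closedCell
    · rw [or_iff_not_imp_left]
      intro hne
      obtain ⟨_, ⟨y, hy, rfl⟩, hye⟩ := Set.not_disjoint_iff.mp hne
      obtain ⟨j, hj⟩ := exists_translate hF hye y.2.1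
      have h1 : Subtype.val '' C ∩ RelCWComplex.closedCell m e =
          (fun x => OrbitCat.Hom.rep j.2 • charMap j.1.cell x) ''
            (translatedCharMap hF H j ⁻¹' C ∩ Metric.closedBall 0 1) := by
        rw [closedCell_eq_smul hj, ← charMap_image_closedBall]
        ext x
        constructor
        · rintro ⟨⟨y, hy, rfl⟩, _, ⟨x, hx, rfl⟩, hxy⟩
          refine ⟨x, ⟨?_, hx⟩, hxy⟩
          have : translatedCharMap hF H j x = y := Subtype.ext hxy
          rw [Set.mem_preimage, this]
          exact hy
        · rintro ⟨x, ⟨hx, hx1⟩, rfl⟩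
          exact ⟨⟨_, hx, rfl⟩, _, ⟨x, hx1, rfl⟩, rfl⟩
      rw [h1]
      refine (IsCompact.image ?_ ?_).isClosed
      · exact (isCompact_closedBall 0 1).of_isClosed_subset (hC j) Set.inter_subset_right
      · exact (charMap j.1.cell).continuous.const_smul _
    · left
      refine Set.disjoint_left.mpr ?_
      rintro _ ⟨y, hy, rfl⟩ hye
      refine Set.disjoint_left.mp (RelCWComplex.disjoint_skeletonLT_openCell (n := (n + 1 : ℕ))
        (by exact_mod_cast hm)) y.2.2 hye
  smul_eq j x a hx ha := Subtype.ext (by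
    rw [translatedCharMap_val, translatedCharMap_val, charMap_smul _ hx ha])
  mem j x hx := (mem_pairSub_fixedPair _).mpr (by
    rw [translatedCharMap_val]
    exact smul_mem_skeletonLT _ _ (charMap_mem_skeletonLT _ hx))
  notMem j x hx h := by
    have h1 := (mem_pairSub_fixedPair _).mp h
    rw [translatedCharMap_val] at h1
    have h2 := smul_mem_skeletonLT (OrbitCat.Hom.rep j.2)⁻¹ _ h1
    rw [inv_smul_smul] at h2
    exact Set.disjoint_left.mp (RelCWComplex.disjoint_skeletonLT_openCell (n := (n : ℕ)) le_rfl) h2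
      (charMap_mem_cellSet j.1.cell hx)
  inj i j x y hx hy h := by
    have h1 : OrbitCat.Hom.rep i.2 • charMap i.1.cell x =
        OrbitCat.Hom.rep j.2 • charMap j.1.cell y := congrArg Subtype.val h
    obtain ⟨i, φ⟩ := i
    obtain ⟨j, ψ⟩ := j
    change OrbitCat.Hom.rep φ • charMap i.cell x = OrbitCat.Hom.rep ψ • charMap j.cell y at h1
    have h2 : ((OrbitCat.Hom.rep φ)⁻¹ * OrbitCat.Hom.rep ψ) • charMap j.cell y =
        charMap i.cell x := by rw [mul_smul, ← h1, inv_smul_smul]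
    have h3 : ((OrbitCat.Hom.rep φ)⁻¹ * OrbitCat.Hom.rep ψ) • cellSet X n j.cell =
        cellSet X n i.cell :=
      smul_cellSet_eq_of_mem ⟨_, charMap_mem_cellSet j.cell hy, h2⟩ (charMap_mem_cellSet i.cell hx)
    obtain rfl := CellOrbit.eq_of_smul_eq h3.symm
    have h4 : (OrbitCat.Hom.rep φ)⁻¹ * OrbitCat.Hom.rep ψ ∈ cellStabilizer G i.cell :=
      mem_cellStabilizer_iff.mpr h3
    obtain rfl : φ = ψ := OrbitCat.hom_ext (QuotientGroup.eq.mpr h4)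
    exact ⟨rfl, charMap_injOn i.cell hx hy (smul_left_cancel _ h1)⟩
  surj y hy := by
    rw [mem_pairSub_fixedPair] at hy
    obtain ⟨m, hm, e, he⟩ := CWComplex.mem_skeletonLT_iff.mp
      (y : fixedSkeletonLT X H.subgroup (n + 1)).2.2
    obtain rfl : m = n := by
      refine le_antisymm (Nat.lt_succ_iff.mp (by exact_mod_cast hm)) (not_lt.mp fun h => hy ?_)
      exact CWComplex.mem_skeletonLT_iff.mpr ⟨m, by exact_mod_cast h, e, he⟩
    obtain ⟨j, hj⟩ := exists_translate hF he y.2.1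
    change (y : fixedSkeletonLT X H.subgroup (m + 1)).1 ∈ cellSet X m e at he
    rw [← hj] at he
    obtain ⟨z, hz, hzy⟩ := he
    obtain ⟨x, hx, rfl⟩ := exists_charMap_eq _ hz
    exact ⟨j, x, hx, Subtype.ext hzy⟩

/-- The chain of a cell is a relative cycle. -/
theorem push_fixedCharMap_mem (i : CellOrbit G X n) :
    push (fixedCharMap hF i) (cellChain n) ∈
      pairCycles ((fixedPair F X n).obj (Opposite.op (cellOrbit hF i))) n := by
  refine mem_pairCycles.mpr ⟨push_mem_deg _ (cellChain_mem_deg n), ?_⟩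
  rw [← push_bd]
  refine push_mem (fun x hx => ?_) (bd_cellChain_mem n)
  exact (mem_pairSub_fixedPair (F := F) (X := X) (n := n) (H := cellOrbit hF i) _).mpr
    (charMap_mem_skeletonLT i.cell hx)

/-- The class of a cell in the cellular chains of the fixed points of its stabilizer. -/
def cellClass (i : CellOrbit G X n) :
    (cellularChains F X n).obj (Opposite.op (cellOrbit hF i)) :=
  relClass ((fixedPair F X n).obj (Opposite.op (cellOrbit hF i))) n ⟨_, push_fixedCharMap_mem hF i⟩

/-- The functor of cellular `n`-chains is free on the classes of the cells. -/
theorem cellularChains_exists_basis (H : OrbitCat F) :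
    ∃ b : Module.Basis (Σ i : CellOrbit G X n, H ⟶ cellOrbit hF i) ℤ
        ((cellularChains F X n).obj (Opposite.op H)),
      ∀ j, b j = ((cellularChains F X n).map j.2.op).hom (cellClass hF j.1) := by
  have heq (j : Σ i : CellOrbit G X n, H ⟶ cellOrbit hF i) :
      push (translatedCharMap hF H j) (cellChain n) =
        push (TopPair.Hom.fst ((fixedPair F X n).map j.2.op)).hom
          (push (fixedCharMap hF j.1) (cellChain n)) := (push_push _ _ _).symm
  have hmem (j : Σ i : CellOrbit G X n, H ⟶ cellOrbit hF i) :
      push (translatedCharMap hF H j) (cellChain n) ∈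
        pairCycles ((fixedPair F X n).obj (Opposite.op H)) n := by
    rw [heq]
    exact push_mem_pairCycles _ (push_fixedCharMap_mem hF j.1)
  obtain ⟨b, hb⟩ := (isCellAttachment_fixedPair hF H).isRelBasis.exists_basis hmem
  refine ⟨b, fun j => (hb j).trans ?_⟩
  refine Eq.trans ?_ (relHomology_map_relClass ((fixedPair F X n).map j.2.op)
    ⟨_, push_fixedCharMap_mem hF j.1⟩).symm
  exact congrArg (relClass ((fixedPair F X n).obj (Opposite.op H)) n) (Subtype.ext (heq j))

end Free

end

end Bredon

namespace Bredon

noncomputable section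

/-! ### Maps out of the tensor product over the orbit category -/

section TensorLift

variable {R : Type} [CommRing R] {G : Type u} [Group G] {F : Set (Subgroup G)}
  {C C' : (OrbitCat F)ᵒᵖ ⥤ ModuleCat.{u} R} {N : OrbitCat F ⥤ ModuleCat.{u} R}
  {A : Type*} [AddCommGroup A] [Module R A]

variable (C N) in
open Classical in
/-- The elementary tensors over the orbit category. -/
def tensorMk (H : OrbitCat F) :
    C.obj (Opposite.op H) →ₗ[R] N.obj H →ₗ[R] (tensorFunctor N).obj C :=
  (TensorProduct.mk R (C.obj (Opposite.op H)) (N.obj H)).compr₂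
    ((tensorRel C N).mkQ ∘ₗ
      DirectSum.lof R _ (fun H => C.obj (Opposite.op H) ⊗[R] N.obj H) H)

theorem tensorMk_map {H K : OrbitCat F} (φ : H ⟶ K) (c : C.obj (Opposite.op K)) (m : N.obj H) :
    tensorMk C N H ((C.map φ.op).hom c) m = tensorMk C N K c ((N.map φ).hom m) := by
  refine (Submodule.Quotient.eq _).mpr (Submodule.subset_span ?_)
  exact ⟨H, K, φ, c, m, rfl⟩

open Classical in
theorem tensor_hom_ext {f g : (tensorFunctor N).obj C →ₗ[R] A}
    (h : ∀ H c m, f (tensorMk C N H c m) = g (tensorMk C N H c m)) : f = g := by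
  refine Submodule.linearMap_qext _ (DirectSum.linearMap_ext _ fun H => ?_)
  apply TensorProduct.ext'
  intro c m
  exact h H c m

open Classical in
/-- The linear map out of the tensor product given by a compatible family of bilinear maps. -/
def tensorLift (f : ∀ H : OrbitCat F, C.obj (Opposite.op H) →ₗ[R] N.obj H →ₗ[R] A)
    (hf : ∀ (H K : OrbitCat F) (φ : H ⟶ K) (c : C.obj (Opposite.op K)) (m : N.obj H),
      f H ((C.map φ.op).hom c) m = f K c ((N.map φ).hom m)) :
    (tensorFunctor N).obj C →ₗ[R] A :=
  (tensorRel C N).liftQ (DirectSum.toModule R _ A fun H => TensorProduct.lift (f H)) (by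
    refine Submodule.span_le.mpr ?_
    rintro _ ⟨H, K, φ, c, m, rfl⟩
    simp [hf])

theorem tensorLift_mk (f : ∀ H : OrbitCat F, C.obj (Opposite.op H) →ₗ[R] N.obj H →ₗ[R] A) (hf)
    (H : OrbitCat F) (c : C.obj (Opposite.op H)) (m : N.obj H) :
    tensorLift f hf (tensorMk C N H c m) = f H c m := by
  classical
  refine (Submodule.liftQ_apply _ _ _).trans ?_
  refine (DirectSum.toModule_lof R H (M := fun H => C.obj (Opposite.op H) ⊗[R] N.obj H) _).trans ?_
  exact TensorProduct.lift.tmul _ _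

theorem tensorFunctor_map_mk (f : C ⟶ C') (H : OrbitCat F) (c : C.obj (Opposite.op H))
    (m : N.obj H) : ((tensorFunctor N).map f).hom (tensorMk C N H c m) =
      tensorMk C' N H ((f.app (Opposite.op H)).hom c) m := by
  classical
  refine congrArg (Submodule.Quotient.mk (p := tensorRel C' N)) ?_
  simp [tensorPreMap]

end TensorLift

/-! ### Free functors on the orbit category -/

section FreeFunctor

variable {R : Type} [CommRing R] {G : Type u} [Group G] {F : Set (Subgroup G)}
  {C : (OrbitCat F)ᵒᵖ ⥤ ModuleCat.{u} R} {I : Type u} {O : I → OrbitCat F}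

/-- The functor `C` is free on the elements `u i ∈ C(G/H_i)`. -/
def IsFreeFunctor (u : ∀ i, C.obj (Opposite.op (O i))) : Prop :=
  ∀ H : OrbitCat F, ∃ b : Module.Basis (Σ i, H ⟶ O i) R (C.obj (Opposite.op H)),
    ∀ j, b j = (C.map j.2.op).hom (u j.1)

namespace IsFreeFunctor

variable {u : ∀ i, C.obj (Opposite.op (O i))} (h : IsFreeFunctor u)

/-- The basis of the values of a free functor. -/
def basis (H : OrbitCat F) : Module.Basis (Σ i, H ⟶ O i) R (C.obj (Opposite.op H)) := (h H).choose

theorem basis_apply (H : OrbitCat F) (j : Σ i, H ⟶ O i) :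
    h.basis H j = (C.map j.2.op).hom (u j.1) := (h H).choose_spec j

theorem map_basis {H K : OrbitCat F} (φ : H ⟶ K) (j : Σ i, K ⟶ O i) :
    (C.map φ.op).hom (h.basis K j) = h.basis H ⟨j.1, φ ≫ j.2⟩ := by
  rw [basis_apply, basis_apply]
  exact (LinearMap.congr_fun (congrArg ModuleCat.Hom.hom (C.map_comp j.2.op φ.op)) (u j.1)).symm

theorem basis_id (i : I) : h.basis (O i) ⟨i, 𝟙 _⟩ = u i := by
  rw [basis_apply]
  exact LinearMap.congr_fun (congrArg ModuleCat.Hom.hom (C.map_id (Opposite.op (O i)))) (u i)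

variable {M : (OrbitCat F)ᵒᵖ ⥤ ModuleCat.{u} R}

include h in
theorem hom_ext {θ η : C ⟶ M} (hθ : ∀ i, (θ.app (Opposite.op (O i))).hom (u i) =
    (η.app (Opposite.op (O i))).hom (u i)) : θ = η := by
  refine NatTrans.ext (funext fun H => ModuleCat.hom_ext ((h.basis H.unop).ext fun j => ?_))
  rw [basis_apply]
  have h1 := LinearMap.congr_fun (congrArg ModuleCat.Hom.hom (θ.naturality j.2.op)) (u j.1)
  have h2 := LinearMap.congr_fun (congrArg ModuleCat.Hom.hom (η.naturality j.2.op)) (u j.1)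
  exact h1.trans ((congrArg (M.map j.2.op).hom (hθ j.1)).trans h2.symm)

/-- The natural transformation out of a free functor with given values on the generators. -/
def homOf (m : ∀ i, M.obj (Opposite.op (O i))) : C ⟶ M where
  app H := ModuleCat.ofHom ((h.basis H.unop).constr R fun j => (M.map j.2.op).hom (m j.1))
  naturality H K φ := by
    refine ModuleCat.hom_ext ((h.basis H.unop).ext fun j => ?_)
    refine (congrArg ((h.basis K.unop).constr R fun j => (M.map j.2.op).hom (m j.1))
      (h.map_basis φ.unop j)).trans ?_
    refine ((h.basis K.unop).constr_basis R _ _).trans ?_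
    refine Eq.trans ?_ (congrArg (M.map φ).hom ((h.basis H.unop).constr_basis R _ _)).symm
    exact LinearMap.congr_fun (congrArg ModuleCat.Hom.hom (M.map_comp j.2.op φ)) (m j.1)

theorem homOf_apply (m : ∀ i, M.obj (Opposite.op (O i))) (i : I) :
    ((h.homOf m).app (Opposite.op (O i))).hom (u i) = m i := by
  rw [← h.basis_id i]
  refine ((h.basis (O i)).constr_basis R _ _).trans ?_
  exact LinearMap.congr_fun (congrArg ModuleCat.Hom.hom (M.map_id (Opposite.op (O i)))) (m i)

variable {N : OrbitCat F ⥤ ModuleCat.{u} R}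

include h in
-- A basis element is the pullback of a generator along a morphism, and the tensor relation moves
-- that morphism to the other factor.
theorem tensor_induction {A : Type*} [AddCommGroup A] [Module R A]
    {f g : (tensorFunctor N).obj C →ₗ[R] A}
    (hfg : ∀ i m, f (tensorMk C N (O i) (u i) m) = g (tensorMk C N (O i) (u i) m)) : f = g := by
  refine tensor_hom_ext fun H c m => ?_
  suffices hs : f ∘ₗ (tensorMk C N H).flip m = g ∘ₗ (tensorMk C N H).flip m from
    LinearMap.congr_fun hs c
  refine (h.basis H).ext fun j => ?_
  rw [basis_apply]
  change f (tensorMk C N H ((C.map j.2.op).hom (u j.1)) m) =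
    g (tensorMk C N H ((C.map j.2.op).hom (u j.1)) m)
  rw [tensorMk_map, hfg]

variable (N)

/-- The coordinates on the tensor product of a free functor with `N`. -/
def tensorCoords [DecidableEq I] : (tensorFunctor N).obj C →ₗ[R] (∀ i, N.obj (O i)) :=
  tensorLift (fun H => (h.basis H).constr R fun j =>
    LinearMap.single R (fun i => N.obj (O i)) j.1 ∘ₗ (N.map j.2).hom) fun H K φ c m => by
  suffices hs : ((h.basis H).constr R fun j =>
      LinearMap.single R (fun i => N.obj (O i)) j.1 ∘ₗ (N.map j.2).hom).flip m ∘ₗ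
        (C.map φ.op).hom = ((h.basis K).constr R fun j =>
      LinearMap.single R (fun i => N.obj (O i)) j.1 ∘ₗ (N.map j.2).hom).flip
        ((N.map φ).hom m) from LinearMap.congr_fun hs c
  refine (h.basis K).ext fun j => ?_
  simp only [LinearMap.comp_apply, LinearMap.flip_apply]
  rw [map_basis, Module.Basis.constr_basis, Module.Basis.constr_basis]
  exact congrArg (LinearMap.single R (fun i => N.obj (O i)) j.1)
    (LinearMap.congr_fun (congrArg ModuleCat.Hom.hom (N.map_comp φ j.2)) m)

theorem tensorCoords_mk [DecidableEq I] (i : I) (m : N.obj (O i)) :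
    h.tensorCoords N (tensorMk C N (O i) (u i) m) = Pi.single i m := by
  refine (tensorLift_mk (A := ∀ i, N.obj (O i)) _ _ (O i) (u i) m).trans ?_
  have h1 := (h.basis (O i)).constr_basis R (fun j =>
    LinearMap.single R (fun i => N.obj (O i)) j.1 ∘ₗ (N.map j.2).hom) ⟨i, 𝟙 _⟩
  rw [basis_id] at h1
  refine (LinearMap.congr_fun h1 m).trans ?_
  exact congrArg (LinearMap.single R (fun i => N.obj (O i)) i)
    (LinearMap.congr_fun (congrArg ModuleCat.Hom.hom (N.map_id (O i))) m)

/-- The tensor product of a free functor with `N` is the direct sum of the values of `N` at the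
generators. -/
def tensorEquiv [Fintype I] [DecidableEq I] : (tensorFunctor N).obj C ≃ₗ[R] (∀ i, N.obj (O i)) := by
  refine LinearEquiv.ofLinearMap (h.tensorCoords N)
    (∑ i, tensorMk C N (O i) (u i) ∘ₗ LinearMap.proj i) ?_ ?_
  · refine LinearMap.pi_ext fun i m => ?_
    rw [LinearMap.comp_apply, LinearMap.sum_apply, map_sum, Finset.sum_eq_single i]
    · rw [LinearMap.comp_apply, tensorCoords_mk, LinearMap.proj_apply, Pi.single_eq_same]
      rfl
    · intro j _ hj
      rw [LinearMap.comp_apply, LinearMap.proj_apply, Pi.single_eq_of_ne hj, map_zero, map_zero]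
    · exact fun hi => absurd (Finset.mem_univ i) hi
  · refine h.tensor_induction fun i m => ?_
    rw [LinearMap.comp_apply, tensorCoords_mk, LinearMap.sum_apply, Finset.sum_eq_single i]
    · rw [LinearMap.comp_apply, LinearMap.proj_apply, Pi.single_eq_same]
      rfl
    · intro j _ hj
      rw [LinearMap.comp_apply, LinearMap.proj_apply, Pi.single_eq_of_ne hj, map_zero]
    · exact fun hi => absurd (Finset.mem_univ i) hi

include h in
theorem tensor_finite [Finite I] [∀ H, Module.Finite R (N.obj H)] :
    Module.Finite R ((tensorFunctor N).obj C) := by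
  classical
  have := Fintype.ofFinite I
  exact Module.Finite.equiv (h.tensorEquiv N).symm

include h in
theorem tensor_free [Finite I] [∀ H, Module.Free R (N.obj H)] :
    Module.Free R ((tensorFunctor N).obj C) := by
  classical
  have := Fintype.ofFinite I
  exact Module.Free.of_equiv (h.tensorEquiv N).symm

end IsFreeFunctor

end FreeFunctor

/-! ### The duality between natural transformations and the tensor product -/

section Duality

variable {R : Type} [CommRing R] {G : Type u} [Group G] {F : Set (Subgroup G)}
  {C C' : (OrbitCat F)ᵒᵖ ⥤ ModuleCat.{u} R} {M : (OrbitCat F)ᵒᵖ ⥤ ModuleCat.{u} R}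
  {N : OrbitCat F ⥤ ModuleCat.{u} R} (hMN : DualBases M N)

namespace DualBases

/-- The isomorphism `N(G/H) ≃ Hom(M(G/H), R)`. -/
def pairing (H : OrbitCat F) : N.obj H ≃ₗ[R] Module.Dual R (M.obj (Opposite.op H)) :=
  have := hMN.finite_β H
  hMN.b H ≪≫ₗ dualityIso (hMN.β H) ≪≫ₗ (hMN.a H).dualMap

/-- This is where the compatibility of the bases enters. It is exactly the condition for the
pairings to respect the relations of the tensor product. -/
theorem pairing_map {H K : OrbitCat F} (φ : H ⟶ K) (x : M.obj (Opposite.op K)) (m : N.obj H) :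
    hMN.pairing H m ((M.map φ.op).hom x) = hMN.pairing K ((N.map φ).hom m) x :=
  LinearMap.congr_fun (LinearMap.congr_fun (hMN.comm H K φ) m) x

include hMN in
theorem free_left (H : OrbitCat F) : Module.Free R (M.obj (Opposite.op H)) :=
  Module.Free.of_equiv (hMN.a H).symm

include hMN in
theorem finite_left (H : OrbitCat F) : Module.Finite R (M.obj (Opposite.op H)) :=
  have := hMN.finite_β H
  Module.Finite.equiv (hMN.a H).symm

include hMN in
theorem free_right (H : OrbitCat F) : Module.Free R (N.obj H) :=
  Module.Free.of_equiv (hMN.b H).symm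

include hMN in
theorem finite_right (H : OrbitCat F) : Module.Finite R (N.obj H) :=
  have := hMN.finite_β H
  Module.Finite.equiv (hMN.b H).symm

theorem pairing_eq_zero {H : OrbitCat F} {x : M.obj (Opposite.op H)}
    (hx : ∀ m, hMN.pairing H m x = 0) : x = 0 := by
  have := hMN.free_left H
  refine (Module.forall_dual_apply_eq_zero_iff R x).mp fun f => ?_
  rw [← (hMN.pairing H).apply_symm_apply f]
  exact hx _

/-- Finite free modules are reflexive, so the identification of `N` with the dual of `M` also
exhibits `M` as the dual of `N`. -/
theorem exists_pairing_eq {H : OrbitCat F} (f : N.obj H →ₗ[R] R) :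
    ∃ x, ∀ m, hMN.pairing H m x = f m := by
  have := hMN.free_left H
  have := hMN.finite_left H
  refine ⟨(Module.evalEquiv R (M.obj (Opposite.op H))).symm (f ∘ₗ (hMN.pairing H).symm), fun m => ?_⟩
  rw [Module.apply_evalEquiv_symm_apply]
  simp

/-- The linear form on `C ⊗ N` given by a natural transformation `C ⟶ M`. -/
def form (θ : C ⟶ M) : (tensorFunctor N).obj C →ₗ[R] R :=
  tensorLift (fun H => (hMN.pairing H).toLinearMap.flip ∘ₗ (θ.app (Opposite.op H)).hom)
    fun H K φ c m => by
      have h1 := LinearMap.congr_fun (congrArg ModuleCat.Hom.hom (θ.naturality φ.op)) c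
      exact (congrArg (hMN.pairing H m) h1).trans (hMN.pairing_map φ _ m)

theorem form_mk (θ : C ⟶ M) (H : OrbitCat F) (c : C.obj (Opposite.op H)) (m : N.obj H) :
    hMN.form θ (tensorMk C N H c m) = hMN.pairing H m ((θ.app (Opposite.op H)).hom c) :=
  tensorLift_mk (A := R) _ _ H c m

/-- The map sending a natural transformation `C ⟶ M` to a linear form on `C ⊗ N`. -/
def formOf : (C ⟶ M) →+ ((tensorFunctor N).obj C →ₗ[R] R) where
  toFun := hMN.form
  map_zero' := tensor_hom_ext fun H c m => by
    rw [form_mk]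
    exact map_zero (hMN.pairing H m)
  map_add' θ η := tensor_hom_ext fun H c m => by
    rw [LinearMap.add_apply, form_mk, form_mk, form_mk]
    exact map_add (hMN.pairing H m) _ _

theorem formOf_mk (θ : C ⟶ M) (H : OrbitCat F) (c : C.obj (Opposite.op H)) (m : N.obj H) :
    hMN.formOf θ (tensorMk C N H c m) = hMN.pairing H m ((θ.app (Opposite.op H)).hom c) :=
  hMN.form_mk θ H c m

theorem formOf_comp (f : C ⟶ C') (θ : C' ⟶ M) :
    hMN.formOf (f ≫ θ) = hMN.formOf θ ∘ₗ ((tensorFunctor N).map f).hom :=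
  tensor_hom_ext fun H c m => by
    rw [formOf_mk, LinearMap.comp_apply, tensorFunctor_map_mk, formOf_mk]
    rfl

variable {I : Type u} {O : I → OrbitCat F} {u : ∀ i, C.obj (Opposite.op (O i))}

/-- On the generators, a natural transformation is an arbitrary family of elements of `M`, and a
form on the tensor product is an arbitrary family of forms on `N`. The pairing matches the two. -/
theorem formOf_bijective (h : IsFreeFunctor u) :
    Function.Bijective (hMN.formOf : (C ⟶ M) →+ ((tensorFunctor N).obj C →ₗ[R] R)) := by
  constructor
  · refine (injective_iff_map_eq_zero _).mpr fun θ hθ => ?_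
    refine h.hom_ext fun i => ?_
    refine (hMN.pairing_eq_zero fun m => ?_).trans (LinearMap.zero_apply (u i)).symm
    rw [← formOf_mk, hθ, LinearMap.zero_apply]
  · intro f
    choose x hx using fun i => hMN.exists_pairing_eq (f ∘ₗ tensorMk C N (O i) (u i))
    refine ⟨h.homOf x, h.tensor_induction fun i m => ?_⟩
    rw [formOf_mk, h.homOf_apply, hx, LinearMap.comp_apply]

end DualBases

end Duality

end

end Bredon

namespace Bredon

noncomputable section

/-! ### The universal coefficient theorem -/

theorem exists_addMonoidHom_lift {A B C : Type*} [AddCommGroup A] [AddCommGroup B] [AddCommGroup C]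
    (π : A →+ B) (hπ : Function.Surjective π) (f : A →+ C) (h : ∀ a, π a = 0 → f a = 0) :
    ∃ g : B →+ C, ∀ a, g (π a) = f a :=
  ⟨AddMonoidHom.liftOfSurjective π hπ ⟨f, h⟩,
    fun a => AddMonoidHom.liftOfRightInverse_comp_apply π _ _ ⟨f, h⟩ a⟩

theorem exists_linearMap_lift {R A B C : Type*} [CommRing R] [AddCommGroup A] [AddCommGroup B]
    [AddCommGroup C] [Module R A] [Module R B] [Module R C]
    (π : A →ₗ[R] B) (hπ : Function.Surjective π) (f : A →ₗ[R] C) (h : ∀ a, π a = 0 → f a = 0) :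
    ∃ g : B →ₗ[R] C, ∀ a, g (π a) = f a := by
  refine ⟨(LinearMap.ker π).liftQ f (fun a ha => h a ha) ∘ₗ
    (π.quotKerEquivOfSurjective hπ).symm, fun a => ?_⟩
  have : (π.quotKerEquivOfSurjective hπ).symm (π a) = (LinearMap.ker π).mkQ a :=
    (LinearEquiv.symm_apply_eq _).mpr rfl
  rw [LinearMap.comp_apply, LinearEquiv.coe_coe, this]
  exact (LinearMap.ker π).liftQ_apply f a

/-! ### Splitting off cycles over a principal ideal domain. -/

section PID

variable {R : Type} [CommRing R] [IsDomain R] [IsPrincipalIdealRing R]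

/-- The range of `d` is a submodule of a finite free module over a principal ideal domain, hence
projective. A section of `d` onto its range yields a projection of `D` onto the kernel, along which
`f` extends. -/
theorem exists_extend_of_free {D D' C : Type*} [AddCommGroup D] [AddCommGroup D'] [AddCommGroup C]
    [Module R D] [Module R D'] [Module R C] [Module.Free R D'] [Module.Finite R D']
    (d : D →ₗ[R] D') (f : LinearMap.ker d →ₗ[R] C) :
    ∃ g : D →ₗ[R] C, ∀ z : LinearMap.ker d, g z = f z := by
  obtain ⟨s, hs⟩ := Module.projective_lifting_property d.rangeRestrict LinearMap.id
    d.surjective_rangeRestrict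
  have hs' (x : D) : d (s (d.rangeRestrict x)) = d x :=
    congrArg Subtype.val (LinearMap.congr_fun hs (d.rangeRestrict x))
  refine ⟨f ∘ₗ (LinearMap.id - s ∘ₗ d.rangeRestrict).codRestrict (LinearMap.ker d) (fun x => ?_),
    fun z => ?_⟩
  on_goal 2 =>
    rw [LinearMap.mem_ker]
    simp [hs']
  · refine congrArg f (Subtype.ext ?_)
    have : d.rangeRestrict z = 0 := Subtype.ext z.2
    simp [this]

end PID

/-! ### Ext from a projective presentation. -/

section Ext

variable {R : Type} [CommRing R]

/-- The connecting homomorphism to `Ext¹` of a presentation `Z ⟶ A` with `Z` projective. -/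
theorem exists_ext_connecting {Z A : ModuleCat.{u} R} [Projective Z] (π : Z →ₗ[R] A)
    (hπ : Function.Surjective π) :
    ∃ δ : (LinearMap.ker π →ₗ[R] R) →+ Abelian.Ext.{u} A (ModuleCat.of R (ULift.{u} R)) 1,
      Function.Surjective δ ∧
        ∀ μ, δ μ = 0 ↔ ∃ ν : Z →ₗ[R] R, ∀ b : LinearMap.ker π, ν b = μ b := by
  let S : ShortComplex (ModuleCat.{u} R) :=
    ShortComplex.mk (ModuleCat.ofHom (LinearMap.ker π).subtype) (ModuleCat.ofHom π)
      (ModuleCat.hom_ext (LinearMap.ext fun b => b.2))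
  have hS : S.ShortExact :=
    { exact := (ShortComplex.moduleCat_exact_iff _).mpr fun x hx => ⟨⟨x, hx⟩, rfl⟩
      mono_f := (ModuleCat.mono_iff_injective _).mpr (LinearMap.ker π).injective_subtype
      epi_g := (ModuleCat.epi_iff_surjective _).mpr hπ }
  let Y : ModuleCat.{u} R := ModuleCat.of R (ULift.{u} R)
  let hom (B : ModuleCat.{u} R) (μ : B →ₗ[R] R) : B ⟶ Y :=
    ModuleCat.ofHom (ULift.moduleEquiv.symm.toLinearMap ∘ₗ μ)
  have hhom (B : ModuleCat.{u} R) (k : B ⟶ Y) :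
      ∃ μ, hom B μ = k := ⟨ULift.moduleEquiv.toLinearMap ∘ₗ k.hom, rfl⟩
  let δ : (LinearMap.ker π →ₗ[R] R) →+ Abelian.Ext.{u} A Y 1 :=
    { toFun μ := hS.extClass.comp (Abelian.Ext.mk₀ (hom S.X₁ μ)) (add_zero 1)
      map_zero' := by
        have : hom S.X₁ 0 = 0 := rfl
        rw [this, Abelian.Ext.mk₀_zero, Abelian.Ext.comp_zero]
      map_add' μ ν := by
        have : hom S.X₁ (μ + ν) = hom S.X₁ μ + hom S.X₁ ν := rfl
        rw [this, Abelian.Ext.mk₀_add, Abelian.Ext.comp_add] }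
  refine ⟨δ, fun x => ?_, fun μ => ⟨fun h => ?_, ?_⟩⟩
  -- Every class comes from a form on the kernel, since `Ext¹` of the projective middle term
  -- vanishes.
  · have : Projective S.X₂ := inferInstanceAs (Projective Z)
    obtain ⟨x₁, hx₁⟩ := Abelian.Ext.contravariant_sequence_exact₃ hS Y x
      (Abelian.Ext.eq_zero_of_projective _) (add_zero 1)
    obtain ⟨k, rfl⟩ := Abelian.Ext.homEquiv₀.symm.surjective x₁
    obtain ⟨μ, rfl⟩ := hhom _ k
    exact ⟨μ, hx₁⟩
  · obtain ⟨x₂, hx₂⟩ := Abelian.Ext.contravariant_sequence_exact₁ hS Y _ (add_zero 1) h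
    obtain ⟨k, rfl⟩ := Abelian.Ext.homEquiv₀.symm.surjective x₂
    obtain ⟨ν, rfl⟩ := hhom _ k
    refine ⟨ν, fun b => ?_⟩
    have h1 : Abelian.Ext.mk₀ (S.f ≫ hom S.X₂ ν) = Abelian.Ext.mk₀ (hom S.X₁ μ) := by
      rw [← Abelian.Ext.mk₀_comp_mk₀]
      exact hx₂
    have h2 := Abelian.Ext.homEquiv₀.symm.injective h1
    exact congrArg ULift.down (LinearMap.congr_fun (congrArg ModuleCat.Hom.hom h2) b)
  · rintro ⟨ν, hν⟩
    have h1 : hom S.X₁ μ = S.f ≫ hom S.X₂ ν :=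
      ModuleCat.hom_ext (LinearMap.ext fun b => ULift.ext _ _ (hν b).symm)
    change hS.extClass.comp (Abelian.Ext.mk₀ (hom S.X₁ μ)) (add_zero 1) = 0
    rw [h1, ← Abelian.Ext.mk₀_comp_mk₀]
    exact hS.extClass_comp_assoc _

end Ext

section CochainComplexIndices

variable {R : Type*} [CommRing R] (K : CochainComplex (ModuleCat.{u} R) ℕ) (n : ℕ)

theorem cochain_d_next_eq_zero_iff (x : K.X n) :
    (K.d n ((ComplexShape.up ℕ).next n)).hom x = 0 ↔ (K.d n (n + 1)).hom x = 0 := by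
  rw [CochainComplex.next]

theorem cochain_exists_d_prev_eq_iff (x : K.X (n + 1)) :
    (∃ y, (K.d ((ComplexShape.up ℕ).prev (n + 1)) (n + 1)).hom y = x) ↔
      ∃ y, (K.d n (n + 1)).hom y = x := by
  rw [CochainComplex.prev_nat_succ]

theorem cochain_exists_d_prev_zero_iff (x : K.X 0) :
    (∃ y, (K.d ((ComplexShape.up ℕ).prev 0) 0).hom y = x) ↔ x = 0 := by
  rw [K.shape _ 0 (by simp)]
  exact ⟨fun ⟨y, hy⟩ => hy.symm, fun h => ⟨0, h.symm⟩⟩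

end CochainComplexIndices

/-! ### Evaluation on homology and its kernel. -/

section UniversalCoefficients

variable {R : Type} [CommRing R] [IsDomain R] [IsPrincipalIdealRing R]
  {D : ChainComplex (ModuleCat.{u} R) ℕ} {E : CochainComplex (ModuleCat.{u} R) ℕ}
  [∀ n, Module.Free R (D.X n)] [∀ n, Module.Finite R (D.X n)]
  (e : ∀ n, E.X n ≃+ (D.X n →ₗ[R] R))
  (he : ∀ n θ x, e (n + 1) ((E.d n (n + 1)).hom θ) x = e n θ ((D.d (n + 1) n).hom x))

include he

/-- Evaluation of cohomology classes on homology classes. -/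
theorem exists_evaluation (n : ℕ) : ∃ g : E.homology n →+ (D.homology n →ₗ[R] R),
    Function.Surjective g ∧
      (∀ θ z, g (homologyClass E n θ) (homologyClass D n z) = e n θ z) := by
  have hcoc (θ : LinearMap.ker (E.d n ((ComplexShape.up ℕ).next n)).hom) (x : D.X (n + 1)) :
      e n θ ((D.d (n + 1) n).hom x) = 0 := by
    rw [← he, (cochain_d_next_eq_zero_iff E n θ.1).mp θ.2, map_zero, LinearMap.zero_apply]
  have hex (θ : LinearMap.ker (E.d n ((ComplexShape.up ℕ).next n)).hom) :
      ∃ γ : D.homology n →ₗ[R] R, ∀ z, γ (homologyClass D n z) = e n θ z := by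
    refine exists_linearMap_lift (homologyClass D n) (homologyClass_surjective D n)
      (e n θ ∘ₗ (LinearMap.ker (D.d n ((ComplexShape.down ℕ).next n)).hom).subtype) fun z hz => ?_
    obtain ⟨y, hy⟩ := (exists_d_prev_eq_iff D n z.1).mp ((homologyClass_eq_zero_iff D n z).mp hz)
    change e n θ z.1 = 0
    rw [← hy, hcoc]
  choose γ hγ using hex
  have hγext (θ) (γ' : D.homology n →ₗ[R] R) (h : ∀ z, γ' (homologyClass D n z) = e n θ.1 z) :
      γ θ = γ' := by
    refine LinearMap.ext fun x => ?_
    obtain ⟨z, rfl⟩ := homologyClass_surjective D n x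
    rw [h, hγ]
  obtain ⟨g, hg⟩ := exists_addMonoidHom_lift (homologyClass E n).toAddMonoidHom
    (homologyClass_surjective E n)
    { toFun := γ
      map_zero' := hγext 0 0 fun z => by
        change 0 = e n 0 z.1
        rw [map_zero]
        rfl
      map_add' := fun θ η => hγext _ _ fun z => by
        rw [LinearMap.add_apply, hγ, hγ]
        change _ = e n (θ.1 + η.1) z.1
        rw [map_add]
        rfl } (fun θ hθ => hγext θ 0 fun z => by
      cases n with
      | zero =>
        have h0 := (cochain_exists_d_prev_zero_iff E θ.1).mp ((homologyClass_eq_zero_iff E 0 θ).mp hθ)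
        rw [h0, map_zero]
        rfl
      | succ n =>
        obtain ⟨η, hη⟩ := (cochain_exists_d_prev_eq_iff E n θ.1).mp
          ((homologyClass_eq_zero_iff E (n + 1) θ).mp hθ)
        rw [← hη, he, (d_next_eq_zero_iff D (n + 1) z.1).mp z.2 n rfl, map_zero]
        rfl)
  have hg' (θ z) : g (homologyClass E n θ) (homologyClass D n z) = e n θ z :=
    (LinearMap.congr_fun (hg θ) _).trans (hγ θ z)
  refine ⟨g, fun f => ?_, hg'⟩
  -- A form on homology is a form on cycles vanishing on boundaries. Any extension to all chains
  -- still vanishes on boundaries and is thus a cocycle.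
  obtain ⟨k, hk⟩ := exists_extend_of_free (D.d n ((ComplexShape.down ℕ).next n)).hom
    (f ∘ₗ homologyClass D n)
  have hθ : (e n).symm k ∈ LinearMap.ker (E.d n ((ComplexShape.up ℕ).next n)).hom := by
    refine (cochain_d_next_eq_zero_iff E n _).mpr ((e (n + 1)).injective ?_)
    rw [map_zero]
    refine LinearMap.ext fun x => ?_
    have hx : (D.d (n + 1) n).hom x ∈ LinearMap.ker (D.d n ((ComplexShape.down ℕ).next n)).hom :=
      LinearMap.congr_fun (congrArg ModuleCat.Hom.hom (D.d_comp_d (n + 1) n _)) x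
    rw [he, (e n).apply_symm_apply]
    refine (hk ⟨_, hx⟩).trans ?_
    have h0 : homologyClass D n ⟨_, hx⟩ = 0 := (homologyClass_eq_zero_iff D n _).mpr
      ((exists_d_prev_eq_iff D n _).mpr ⟨x, rfl⟩)
    rw [LinearMap.comp_apply, h0, map_zero]
    rfl
  refine ⟨homologyClass E n ⟨_, hθ⟩, LinearMap.ext fun y => ?_⟩
  obtain ⟨z, rfl⟩ := homologyClass_surjective D n y
  rw [hg', (e n).apply_symm_apply, hk]
  rfl

/-- The universal coefficient theorem in degree zero. -/
theorem exists_evaluation_bijective :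
    ∃ g : E.homology 0 →+ (D.homology 0 →ₗ[R] R), Function.Bijective g := by
  obtain ⟨g, hg, hge⟩ := exists_evaluation e he 0
  refine ⟨g, (injective_iff_map_eq_zero g).mpr fun x hx => ?_, hg⟩
  obtain ⟨θ, rfl⟩ := homologyClass_surjective E 0 x
  -- In degree zero every chain is a cycle, so a cocycle that evaluates trivially on homology is
  -- zero.
  have h0 : θ = 0 := by
    refine Subtype.ext ((e 0).injective (LinearMap.ext fun z => ?_))
    have hz : z ∈ LinearMap.ker (D.d 0 ((ComplexShape.down ℕ).next 0)).hom :=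
      (d_next_eq_zero_iff D 0 z).mpr fun m hm => by omega
    rw [← hge θ ⟨z, hz⟩, hx]
    change 0 = e 0 0 z
    rw [map_zero]
    rfl
  rw [h0, map_zero]

/-- The universal coefficient theorem in positive degrees. -/
theorem exists_universalCoefficients (m : ℕ) :
    ∃ (f : Abelian.Ext.{u} (D.homology m) (ModuleCat.of R (ULift.{u} R)) 1 →+ E.homology (m + 1))
      (g : E.homology (m + 1) →+ (D.homology (m + 1) →ₗ[R] R)),
      Function.Injective f ∧ Function.Exact f g ∧ Function.Surjective g := by
  obtain ⟨g, hg, hge⟩ := exists_evaluation e he (m + 1)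
  -- The cycles are free, and the kernel of their map to homology consists of the boundaries. This
  -- is the presentation that computes `Ext¹` of the homology.
  let Z := LinearMap.ker (D.d m ((ComplexShape.down ℕ).next m)).hom
  have hproj : Projective (ModuleCat.of R Z) := ModuleCat.projective_of_free (Module.Free.chooseBasis R Z)
  let π : ModuleCat.of R Z →ₗ[R] D.homology m := homologyClass D m
  obtain ⟨δ, hδ, hδ0⟩ := exists_ext_connecting (Z := ModuleCat.of R Z) π
    (homologyClass_surjective D m)
  have hd (x : D.X (m + 1)) : (D.d (m + 1) m).hom x ∈ Z :=
    LinearMap.congr_fun (congrArg ModuleCat.Hom.hom (D.d_comp_d (m + 1) m _)) x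
  let d : D.X (m + 1) →ₗ[R] LinearMap.ker π :=
    ((D.d (m + 1) m).hom.codRestrict Z hd).codRestrict (LinearMap.ker π) fun x =>
      (homologyClass_eq_zero_iff D m _).mpr ((exists_d_prev_eq_iff D m _).mpr ⟨x, rfl⟩)
  have hdsurj : Function.Surjective d := by
    rintro ⟨z, hz⟩
    obtain ⟨y, hy⟩ := (exists_d_prev_eq_iff D m _).mp ((homologyClass_eq_zero_iff D m z).mp hz)
    exact ⟨y, Subtype.ext (Subtype.ext hy)⟩
  have hcoc (μ : LinearMap.ker π →ₗ[R] R) :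
      (e (m + 1)).symm (μ ∘ₗ d) ∈ LinearMap.ker (E.d (m + 1) ((ComplexShape.up ℕ).next (m + 1))).hom := by
    refine (cochain_d_next_eq_zero_iff E (m + 1) _).mpr ((e (m + 1 + 1)).injective ?_)
    rw [map_zero]
    refine LinearMap.ext fun x => ?_
    rw [he, (e (m + 1)).apply_symm_apply]
    have h0 : d ((D.d (m + 1 + 1) (m + 1)).hom x) = 0 := Subtype.ext (Subtype.ext
      (LinearMap.congr_fun (congrArg ModuleCat.Hom.hom (D.d_comp_d (m + 1 + 1) (m + 1) m)) x))
    rw [LinearMap.comp_apply, h0, map_zero]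
    rfl
  let h : (LinearMap.ker π →ₗ[R] R) →+ E.homology (m + 1) :=
    (homologyClass E (m + 1)).toAddMonoidHom.comp
      { toFun μ := ⟨_, hcoc μ⟩
        map_zero' := Subtype.ext
          ((congrArg (e (m + 1)).symm (LinearMap.zero_comp d)).trans (map_zero (e (m + 1)).symm))
        map_add' μ ν := Subtype.ext ((congrArg (e (m + 1)).symm (LinearMap.add_comp d ν μ)).trans
          (map_add (e (m + 1)).symm _ _)) }
  have hh (μ) : h μ = homologyClass E (m + 1) ⟨_, hcoc μ⟩ := rfl
  -- A form on the boundaries gives a coboundary exactly if it extends to the cycles, because forms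
  -- on cycles extend further to all chains. The kernel of `δ` is described by the same condition,
  -- so `h` descends along `δ` to an injective map.
  have hh0 (μ) : h μ = 0 ↔ δ μ = 0 := by
    rw [hh, homologyClass_eq_zero_iff, hδ0]
    refine (cochain_exists_d_prev_eq_iff E m _).trans ⟨?_, ?_⟩
    · rintro ⟨θ, hθ⟩
      refine ⟨e m θ ∘ₗ Z.subtype, fun b => ?_⟩
      obtain ⟨x, rfl⟩ := hdsurj b
      change e m θ ((D.d (m + 1) m).hom x) = μ (d x)
      rw [← he, hθ, (e (m + 1)).apply_symm_apply]
      rfl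
    · rintro ⟨ν, hν⟩
      obtain ⟨k, hk⟩ := exists_extend_of_free (D.d m ((ComplexShape.down ℕ).next m)).hom ν
      refine ⟨(e m).symm k, (e (m + 1)).injective (LinearMap.ext fun x => ?_)⟩
      rw [he, (e m).apply_symm_apply, (e (m + 1)).apply_symm_apply]
      exact (hk ⟨_, hd x⟩).trans (hν (d x))
  obtain ⟨f, hf⟩ := exists_addMonoidHom_lift δ hδ h fun μ hμ => (hh0 μ).mpr hμ
  refine ⟨f, g, (injective_iff_map_eq_zero f).mpr fun x hx => ?_, fun y => ⟨fun hy => ?_, ?_⟩, hg⟩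
  · obtain ⟨μ, rfl⟩ := hδ x
    rw [hf] at hx
    exact (hh0 μ).mp hx
  · obtain ⟨θ, rfl⟩ := homologyClass_surjective E (m + 1) y
    -- A cocycle that evaluates to zero on homology vanishes on all cycles, so it factors through
    -- the boundary map.
    have hθ (z : D.X (m + 1)) (hz : d z = 0) : e (m + 1) θ z = 0 := by
      have hz' : z ∈ LinearMap.ker (D.d (m + 1) ((ComplexShape.down ℕ).next (m + 1))).hom := by
        refine (d_next_eq_zero_iff D (m + 1) z).mpr fun k hk => ?_
        obtain rfl : k = m := by omega
        exact congrArg (fun b : LinearMap.ker π => (b.1 : Z).1) hz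
      rw [← hge θ ⟨z, hz'⟩, hy]
      rfl
    obtain ⟨μ, hμ⟩ := exists_linearMap_lift d hdsurj (e (m + 1) θ) hθ
    refine ⟨δ μ, ?_⟩
    rw [hf, hh]
    refine congrArg (homologyClass E (m + 1)) (Subtype.ext ((e (m + 1)).injective
      (LinearMap.ext fun x => ?_)))
    rw [(e (m + 1)).apply_symm_apply]
    exact hμ x
  · rintro ⟨x, rfl⟩
    obtain ⟨μ, rfl⟩ := hδ x
    rw [hf, hh]
    refine LinearMap.ext fun y => ?_
    obtain ⟨z, rfl⟩ := homologyClass_surjective D (m + 1) y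
    rw [hge, (e (m + 1)).apply_symm_apply]
    have h0 : d z.1 = 0 := Subtype.ext (Subtype.ext
      ((d_next_eq_zero_iff D (m + 1) z.1).mp z.2 m rfl))
    rw [LinearMap.comp_apply, h0, map_zero]
    rfl

end UniversalCoefficients

end

end Bredon

namespace Bredon

noncomputable section

/-! ### Bredon cohomology of finite complexes -/

section Main

variable {G : Type u} [Group G] {F : Set (Subgroup G)} {X : Type u} [TopologicalSpace X] [T2Space X]
  [CWComplex (Set.univ : Set X)] [MulAction G X] [IsGCWComplex G X]
  {M : (OrbitCat F)ᵒᵖ ⥤ ModuleCat.{u} ℤ} {N : OrbitCat F ⥤ ModuleCat.{u} ℤ}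
  (hF : ∀ x : X, MulAction.stabilizer G x ∈ F) (hMN : DualBases M N)

theorem isFreeFunctor_cellularChains (n : ℕ) :
    IsFreeFunctor (C := cellularChains F X n) fun i => cellClass (n := n) hF i :=
  cellularChains_exists_basis hF

include hF hMN in
theorem chainComplex_free (hfinite : IsFiniteGCW G X) (n : ℕ) :
    Module.Free ℤ ((chainComplex X N).X n) :=
  have := hMN.free_right
  have := finite_cellOrbit (n := n) hfinite
  (isFreeFunctor_cellularChains hF n).tensor_free N

include hF hMN in
theorem chainComplex_finite (hfinite : IsFiniteGCW G X) (n : ℕ) :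
    Module.Finite ℤ ((chainComplex X N).X n) :=
  have := hMN.finite_right
  have := finite_cellOrbit (n := n) hfinite
  (isFreeFunctor_cellularChains hF n).tensor_finite N

variable (X) in
/-- The Bredon cochain complex is dual to the Bredon chain complex. -/
def cochainEquiv (n : ℕ) : (cochainComplex X M).X n ≃+ ((chainComplex X N).X n →ₗ[ℤ] ℤ) :=
  AddEquiv.ofBijective (hMN.formOf (C := cellularChains F X n))
    (hMN.formOf_bijective (isFreeFunctor_cellularChains hF n))

theorem cochainEquiv_d (n : ℕ) (θ : (cochainComplex X M).X n) (x : (chainComplex X N).X (n + 1)) :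
    cochainEquiv X hF hMN (n + 1) (((cochainComplex X M).d n (n + 1)).hom θ) x =
      cochainEquiv X hF hMN n θ (((chainComplex X N).d (n + 1) n).hom x) :=
  LinearMap.congr_fun (hMN.formOf_comp ((cellularComplex F X).d (n + 1) n) θ) x

/-- Linear forms over the integers are the same as additive maps. -/
def intDualEquiv (A : ModuleCat.{u} ℤ) : (A →ₗ[ℤ] ℤ) ≃+ (A →+ ℤ) where
  toFun f := f.toAddMonoidHom
  -- The module structure carried by `A` is compared with the canonical action of the integers on
  -- its additive group.
  invFun f := { f with map_smul' := fun n a =>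
    (congrArg f (int_smul_eq_zsmul A.isModule n a)).trans (map_zsmul f n a) }
  left_inv _ := rfl
  right_inv _ := rfl
  map_add' _ _ := rfl

/-- The zero module is projective. This disposes of the `Ext` term whenever `n - 1` is negative. -/
instance : Subsingleton (Abelian.Ext.{u} (ModuleCat.of ℤ PUnit.{u + 1})
    (ModuleCat.of ℤ (ULift.{u} ℤ)) 1) := by
  have : Projective (ModuleCat.of ℤ PUnit.{u + 1}) :=
    (ModuleCat.isZero_of_subsingleton (ModuleCat.of ℤ PUnit.{u + 1})).projective
  exact ⟨fun x y => (Abelian.Ext.eq_zero_of_projective x).trans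
    (Abelian.Ext.eq_zero_of_projective y).symm⟩

end Main

end

end Bredon

/-! ### The universal coefficient sequence for Bredon cohomology. -/

theorem mainTheorem1 {G : Type u} [Group G] {X : Type u} [TopologicalSpace X] [T2Space X]
    [CWComplex (Set.univ : Set X)] [MulAction G X] [Bredon.IsGCWComplex G X]
    (hproper : Bredon.IsProperGCW G X) (hfinite : Bredon.IsFiniteGCW G X)
    (F : Set (Subgroup G)) (hF : ∀ x : X, MulAction.stabilizer G x ∈ F)
    (M : (Bredon.OrbitCat F)ᵒᵖ ⥤ ModuleCat.{u} ℤ) (N : Bredon.OrbitCat F ⥤ ModuleCat.{u} ℤ)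
    (hMN : Bredon.DualBases M N) (n : ℤ) :
    ∃ (f : Abelian.Ext.{u} (Bredon.homology X N (n - 1)) (ModuleCat.of ℤ (ULift.{u} ℤ)) 1 →+
        Bredon.cohomology X M n)
      (g : Bredon.cohomology X M n →+ (Bredon.homology X N n →+ ℤ)),
      Function.Injective f ∧ Function.Exact f g ∧ Function.Surjective g := by
  have hfree := fun k => Bredon.chainComplex_free hF hMN hfinite k
  have hfin := fun k => Bredon.chainComplex_finite hF hMN hfinite k
  match n with
  -- The homology in degree `-1` is the zero module, so the sequence reduces to the bijectivity of
  -- evaluation.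
  | .ofNat 0 =>
    obtain ⟨g, hg⟩ := Bredon.exists_evaluation_bijective (Bredon.cochainEquiv X hF hMN)
      (Bredon.cochainEquiv_d hF hMN)
    have hs : Subsingleton (Abelian.Ext.{u} (Bredon.homology X N (Int.ofNat 0 - 1))
        (ModuleCat.of ℤ (ULift.{u} ℤ)) 1) :=
      inferInstanceAs (Subsingleton (Abelian.Ext.{u} (ModuleCat.of ℤ PUnit.{u + 1})
        (ModuleCat.of ℤ (ULift.{u} ℤ)) 1))
    refine ⟨0, (Bredon.intDualEquiv _).toAddMonoidHom.comp g, Function.injective_of_subsingleton _,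
      fun y => ⟨fun hy => ⟨0, ?_⟩, ?_⟩, (Bredon.intDualEquiv _).surjective.comp hg.surjective⟩
    · have h1 : g y = 0 := (Bredon.intDualEquiv _).injective (hy.trans (map_zero _).symm)
      exact (hg.injective (h1.trans (map_zero g).symm)).symm
    · rintro ⟨x, rfl⟩
      exact map_zero ((Bredon.intDualEquiv _).toAddMonoidHom.comp g)
  | .ofNat (m + 1) =>
    obtain ⟨f, g, hf, hfg, hg⟩ := Bredon.exists_universalCoefficients
      (Bredon.cochainEquiv X hF hMN) (Bredon.cochainEquiv_d hF hMN) m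
    -- The index is brought to constructor form so that homology in degree `n - 1` unfolds to that
    -- of the chain complex.
    have hm : Int.ofNat (m + 1) - 1 = Int.ofNat m := by simp
    rw [hm]
    refine ⟨f, (Bredon.intDualEquiv _).toAddMonoidHom.comp g, hf, fun y => ?_,
      (Bredon.intDualEquiv _).surjective.comp hg⟩
    exact ((Bredon.intDualEquiv _).map_eq_zero_iff (x := g y)).trans (hfg y)
  | .negSucc m =>
    have hs : Subsingleton (Abelian.Ext.{u} (Bredon.homology X N (Int.negSucc m - 1))
        (ModuleCat.of ℤ (ULift.{u} ℤ)) 1) :=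
      inferInstanceAs (Subsingleton (Abelian.Ext.{u} (ModuleCat.of ℤ PUnit.{u + 1})
        (ModuleCat.of ℤ (ULift.{u} ℤ)) 1))
    have hs' : Subsingleton (Bredon.cohomology X M (Int.negSucc m)) :=
      inferInstanceAs (Subsingleton PUnit)
    have hs'' : Subsingleton (Bredon.homology X N (Int.negSucc m)) :=
      inferInstanceAs (Subsingleton PUnit)
    refine ⟨0, 0, Function.injective_of_subsingleton _, fun y => ⟨fun _ => ⟨0, ?_⟩, fun _ => rfl⟩,
      fun k => ⟨0, ?_⟩⟩
    · exact Subsingleton.elim _ _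
    · exact AddMonoidHom.ext fun x => by rw [Subsingleton.elim x 0, map_zero, map_zero]
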